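/- Let $d\ge 1$ be an integer, $s>0$, $\beta>0$. Work in momentum space with $\epsilon(k)=|k|^s$ on $\mathbb{R}^d$, $\rho=(e^{\beta\epsilon}-1)^{-1}$ and $\omega_n=2\pi n/\beta$ ($n\in\mathbb{Z}$); real-valued functions of position are represented by their Fourier transforms, i.e. by functions with $g(-k)=\overline{g(k)}$. *Path space.* Let $\mathcal{R}$ be the real Hilbert space of all $g$ on $\mathbb{R}^d$ with $g(-k)=\overline{g(k)}$ and $\int |g(k)|^2\,\frac{1}{2\epsilon(k)}\coth\frac{\beta\epsilon(k)}{2}\,dk<\infty$. Let $\mathcal{Q}^\sharp$ be the real Hilbert space of all $f$ on $\mathbb{Z}\times\mathbb{R}^d$ with $f(-n,-k)=\overline{f(n,k)}$ and $q(f)=\sum_n\int\frac{|f(n,k)|^2}{\omega_n^2+\epsilon(k)^2}\,dk<\infty$ (Fourier variables for functions on the circle of length $\beta$ times space, with covariance $C=(D_t^2+\epsilon^2)^{-1}$). On $\mathcal{Q}^\sharp$ let $(u_tf)(n,k)=e^{-i\omega_nt}f(n,k)$ be time translation, and let $j_0g=\delta_0\otimes g$, i.e. $(j_0g)(n,k)=\beta^{-1/2}g(k)$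 for $g\in\mathcal{R}$. Let $Q$ be the space of real linear functionals $\phi$ on $\mathcal{Q}^\sharp$ with the $\sigma$-algebra generated by all $\phi\mapsto\phi(f)$. Let $(U_tF)(\phi)=F(\phi\circ u_t)$, let $\mathfrak{S}_0$ be the $\sigma$-algebra generated by the functions $e^{i\phi(j_0g)}$, $g\in\mathcal{R}$, let $\mathfrak{S}_t=U_t\mathfrak{S}_0$ and $\mathfrak{S}_{\{0,\beta/2\}}=\mathfrak{S}_0\vee\mathfrak{S}_{\beta/2}$. *Araki–Woods space.* Let $\mathcal{F}$ be the bosonic Fock space, with vacuum $\Omega$ and vacuum state $\omega=\langle\Omega,\,\cdot\,\Omega\rangle$, over $\mathcal{Z}=L^2(\mathbb{R}^d,\frac{dk}{2\epsilon})\oplus L^2(\mathbb{R}^d,\frac{dk}{2\epsilon})$ (the second summand realizing the complex conjugate space). Let $W(f)=e^{i\Phi(f)}$, $\Phi(f)=\frac1{\sqrt2}(a^*(f)+a(f))$, be the Weyl operators, $W_{\rho,l}(g)=W\big(\sqrt{1+\rho}\,g\oplus\sqrt{\rho}\,\overline{g}\big)$ for $g\in\mathcal{R}$, and $L=d\Gamma(\epsilon\oplus(-\epsilon))$.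 For a bounded operator $A$ on $\mathcal{F}$ let $\tau_{it}(A)=e^{-tL}Ae^{tL}$, a generally unbounded operator with its natural domain. **Theorem.** There is a probability measure $\mu$ on $Q$ with $\mathbb{E}_\mu[e^{i\phi(f)}]=e^{-q(f)/4}$ for all $f\in\mathcal{Q}^\sharp$. For every such $\mu$ there is a unitary $T:L^2(Q,\mathfrak{S}_{\{0,\beta/2\}},\mu)\to\mathcal{F}$ with $T1=\Omega$ and $T\,e^{i\phi(j_0g)}\,T^{-1}=W_{\rho,l}(g)$ for all $g\in\mathcal{R}$ (functions acting by multiplication). For every such $\mu$ and $T$, every $n\ge1$, all $0\le t_1\le\dots\le t_n\le\beta/2$ and all $G_1,\dots,G_n\in L^\infty(Q,\mathfrak{S}_0,\mu)$, with $\tilde G_j=TG_jT^{-1}$, the vector $\Omega$ lies in the domain of the operator product $\tau_{it_1}(\tilde G_1)\cdots\tau_{it_n}(\tilde G_n)$ and $$\omega\big(\tau_{it_1}(\tilde G_1)\cdots\tau_{it_n}(\tilde G_n)\big)=\mathbb{E}_\mu\big[U_{t_1}G_1\cdots U_{t_n}G_n\big].$$ -/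

import Mathlib

open MeasureTheory Filter Topology
open scoped ENNReal NNReal ComplexConjugate

noncomputable section

namespace ThermalBose

/-! ### Parameters, dispersion relation, thermal weights -/

/-- Space dimension `d ≥ 1`, dispersion exponent `s > 0`, inverse temperature `β > 0`. -/
structure Params where
  d : ℕ
  s : ℝ
  β : ℝ
  d_pos : 0 < d
  s_pos : 0 < s
  β_pos : 0 < β

/-- Momentum space `ℝ^d`. -/
abbrev Mom (P : Params) : Type := EuclideanSpace ℝ (Fin P.d)

/-- The one-particle Hamiltonian in momentum space, `ε(k) = |k|^s`. -/
def disp (P : Params) (k : Mom P) : ℝ := ‖k‖ ^ P.s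

/-- The density `ρ(k) = (e^{β ε(k)} - 1)⁻¹`. -/
def rho (P : Params) (k : Mom P) : ℝ := (Real.exp (P.β * disp P k) - 1)⁻¹

/-- The Matsubara frequencies `ω_n = 2πn/β`. -/
def matsubara (P : Params) (n : ℤ) : ℝ := 2 * Real.pi * n / P.β

/-- The covariance `C(ω_n, k) = 1/(ω_n² + ε(k)²)` in Fourier variables. -/
def covSymbol (P : Params) (x : ℤ × Mom P) : ℝ := 1 / (matsubara P x.1 ^ 2 + disp P x.2 ^ 2)

/-- The symbol of `(2 ε tanh (βε/2))⁻¹ = (2ε)⁻¹ coth (βε/2)`. -/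
def timeZeroSymbol (P : Params) (k : Mom P) : ℝ :=
  1 / (2 * disp P k * Real.tanh (P.β * disp P k / 2))

/-- The symbol of `(2ε)⁻¹`. -/
def oneParticleSymbol (P : Params) (k : Mom P) : ℝ := 1 / (2 * disp P k)

/-- `C(ω_n, k) dk` on `ℤ × ℝ^d` (counting measure in `n`). -/
def covMeasure (P : Params) : Measure (ℤ × Mom P) :=
  ((Measure.count : Measure ℤ).prod (volume : Measure (Mom P))).withDensity
    fun x => ENNReal.ofReal (covSymbol P x)

/-- `(2ε)⁻¹ coth (βε/2) dk` on `ℝ^d`. -/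
def timeZeroMeasure (P : Params) : Measure (Mom P) :=
  (volume : Measure (Mom P)).withDensity fun k => ENNReal.ofReal (timeZeroSymbol P k)

/-- `(2ε)⁻¹ dk` on two copies of `ℝ^d`; the label `false` stands for the first summand, the
label `true` for the second (complex conjugate) one. -/
def oneParticleMeasure (P : Params) : Measure (Bool × Mom P) :=
  ((Measure.count : Measure Bool).prod (volume : Measure (Mom P))).withDensity
    fun x => ENNReal.ofReal (oneParticleSymbol P x.2)

section Weights

variable (P : Params)

theorem measurable_disp : Measurable (disp P) := by unfold disp; fun_prop

theorem measurable_rho : Measurable (rho P) := by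
  have := measurable_disp P
  unfold rho; fun_prop

theorem measurable_covSymbol : Measurable (covSymbol P) := by
  have h1 : Measurable fun x : ℤ × Mom P => matsubara P x.1 :=
    (measurable_from_top (f := matsubara P)).comp measurable_fst
  have h2 : Measurable fun x : ℤ × Mom P => disp P x.2 := (measurable_disp P).comp measurable_snd
  unfold covSymbol
  exact measurable_const.div ((h1.pow_const 2).add (h2.pow_const 2))

theorem measurable_timeZeroSymbol : Measurable (timeZeroSymbol P) := by
  have h := measurable_disp P
  unfold timeZeroSymbol
  have : Measurable Real.tanh := by
    have : Real.tanh = fun x => Real.sinh x / Real.cosh x := funext Real.tanh_eq_sinh_div_cosh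
    rw [this]; fun_prop
  fun_prop

theorem measurable_oneParticleSymbol : Measurable (oneParticleSymbol P) := by
  have h := measurable_disp P
  unfold oneParticleSymbol
  fun_prop

theorem disp_pos {k : Mom P} (hk : k ≠ 0) : 0 < disp P k :=
  Real.rpow_pos_of_pos (norm_pos_iff.mpr hk) _

theorem ae_ne_zero : ∀ᵐ k : Mom P, k ≠ 0 := by
  have : Nonempty (Fin P.d) := ⟨⟨0, P.d_pos⟩⟩
  exact (measure_eq_zero_iff_ae_notMem (s := {(0 : Mom P)})).mp (measure_singleton _)

theorem covSymbol_neg (x : ℤ × Mom P) : covSymbol P (-x) = covSymbol P x := by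
  simp only [covSymbol, matsubara, disp, Prod.fst_neg, Prod.snd_neg, norm_neg, Int.cast_neg]
  ring

theorem timeZeroSymbol_neg (k : Mom P) : timeZeroSymbol P (-k) = timeZeroSymbol P k := by
  simp only [timeZeroSymbol, disp, norm_neg]

theorem negInvariant_withDensity {α : Type*} [MeasurableSpace α] [InvolutiveNeg α]
    [MeasurableNeg α] (ν : Measure α) [ν.IsNegInvariant] {w : α → ℝ≥0∞} (hm : Measurable w)
    (hw : ∀ x, w (-x) = w x) : MeasurePreserving (fun x : α => -x) (ν.withDensity w)
      (ν.withDensity w) := by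
  refine ⟨measurable_neg, ?_⟩
  ext A hA
  rw [Measure.map_apply measurable_neg hA, withDensity_apply _ (measurable_neg hA),
    withDensity_apply _ hA]
  conv_rhs => rw [← (Measure.measurePreserving_neg ν).setLIntegral_comp_preimage hA hm]
  simp only [hw]

theorem measurePreserving_neg_timeZero :
    MeasurePreserving (fun k : Mom P => -k) (timeZeroMeasure P) (timeZeroMeasure P) :=
  negInvariant_withDensity _ (measurable_timeZeroSymbol P).ennreal_ofReal
    fun k => by rw [timeZeroSymbol_neg]

theorem measurePreserving_neg_cov :
    MeasurePreserving (fun x : ℤ × Mom P => -x) (covMeasure P) (covMeasure P) := by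
  have : ((Measure.count : Measure ℤ).prod (volume : Measure (Mom P))).IsNegInvariant :=
    ⟨((Measure.measurePreserving_neg (Measure.count : Measure ℤ)).prod
      (Measure.measurePreserving_neg (volume : Measure (Mom P)))).map_eq⟩
  exact negInvariant_withDensity _ (measurable_covSymbol P).ennreal_ofReal
    fun x => by rw [covSymbol_neg]

instance : SigmaFinite (oneParticleMeasure P) := by
  unfold oneParticleMeasure
  exact SigmaFinite.withDensity_ofReal _

theorem hasSum_inv_sq_add_sq (y : ℝ) (hy : 0 < y) : HasSum (fun n : ℤ => 1 / (y^2 + (n:ℝ)^2)) (Real.pi / (y * Real.tanh (Real.pi * y))) := by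
  have hx : (Complex.I * y : ℂ) ∈ Complex.integerComplement := by
    rintro ⟨n, hn⟩
    have := congrArg Complex.im hn
    simp at this
    exact hy.ne this
  have htanh : 0 < Real.tanh (Real.pi * y) := by
    rw [Real.tanh_eq_sinh_div_cosh]
    exact div_pos (Real.sinh_pos_iff.mpr (by positivity)) (Real.cosh_pos _)
  have h1 := cot_series_rep' hx
  have h2 := summable_cotTerm hx
  have hyc : (y : ℂ) ≠ 0 := by exact_mod_cast hy.ne'
  have h3 : ∀ n : ℕ, (1 / ((Complex.I * y : ℂ) - (n + 1)) + 1 / (Complex.I * y + (n + 1)))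
     = (-2 * Complex.I * y) * ((1 / (y^2 + ((n:ℝ)+1)^2) : ℝ) : ℂ) := by
    intro n
    have e1 : (Complex.I * y - (n + 1) : ℂ) ≠ 0 := by
      intro h; have := congrArg Complex.im h; simp at this; exact hy.ne' this
    have e2 : (Complex.I * y + (n + 1) : ℂ) ≠ 0 := by
      intro h; have := congrArg Complex.im h; simp at this; exact hy.ne' this
    have e3 : ((y:ℂ)^2 + ((n:ℂ)+1)^2) ≠ 0 := by
      have : (y^2 + ((n:ℝ)+1)^2) ≠ 0 := by positivity
      exact_mod_cast this
    push_cast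
    field_simp
    ring_nf
    simp only [show Complex.I^3 = -Complex.I by rw [pow_succ, Complex.I_sq]; ring]
    ring
  have hc : (-2 * Complex.I * y : ℂ) ≠ 0 := by simp [hyc]
  have h4 : Summable fun n : ℕ => (1 / (y^2 + ((n:ℝ)+1)^2) : ℝ) := by
    have : Summable fun n : ℕ => (-2 * Complex.I * y : ℂ) * ((1 / (y^2 + ((n:ℝ)+1)^2) : ℝ) : ℂ) := by
      refine h2.congr fun n => ?_
      exact (h3 n)
    rw [summable_mul_left_iff hc] at this
    exact_mod_cast this
  have h5 : Complex.cot (Real.pi * (Complex.I * y)) = -Complex.I * ((1 / Real.tanh (Real.pi * y) : ℝ) : ℂ) := by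
    rw [show (Real.pi * (Complex.I * y) : ℂ) = ((Real.pi * y : ℝ) : ℂ) * Complex.I by push_cast; ring]
    rw [Complex.cot_eq_cos_div_sin, Complex.cos_mul_I, Complex.sin_mul_I, Real.tanh_eq_sinh_div_cosh]
    push_cast
    have : Complex.sinh (Real.pi * y) ≠ 0 := by
      have := (Real.sinh_pos_iff.mpr (show 0 < Real.pi * y by positivity)).ne'
      exact_mod_cast this
    field_simp
    simp
  have h6 : ∑' n : ℕ, (1 / (y^2 + ((n:ℝ)+1)^2) : ℝ) = (Real.pi / Real.tanh (Real.pi * y) - 1 / y) / (2 * y) := by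
    rw [h5, tsum_congr h3, tsum_mul_left, ← Complex.ofReal_tsum] at h1
    have h7 : (∑' n : ℕ, (1 / (y^2 + ((n:ℝ)+1)^2) : ℝ) : ℂ) = (((Real.pi / Real.tanh (Real.pi * y) - 1 / y) / (2 * y) : ℝ) : ℂ) := by
      apply mul_left_cancel₀ hc
      rw [← Complex.ofReal_tsum, ← h1]
      push_cast
      have : (Real.tanh (Real.pi * y) : ℂ) ≠ 0 := by
        have := htanh.ne'
        exact_mod_cast this
      push_cast at this
      field_simp
      ring_nf
      simp [sub_eq_add_neg]
    exact_mod_cast h7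
  have hA : HasSum (fun n : ℕ => (1 / (y^2 + ((n:ℝ)+1)^2) : ℝ)) ((Real.pi / Real.tanh (Real.pi * y) - 1 / y) / (2 * y)) := h6 ▸ h4.hasSum
  have hB : HasSum (fun n : ℕ => 1 / (y^2 + (n:ℝ)^2)) ((Real.pi / Real.tanh (Real.pi * y) - 1 / y) / (2 * y) + 1 / y^2) := by
    rw [← hasSum_nat_add_iff' 1]
    simpa using hA
  convert HasSum.of_nat_of_neg_add_one (f := fun n : ℤ => 1 / (y^2 + (n:ℝ)^2)) (by simpa using hB) (m' := ((Real.pi / Real.tanh (Real.pi * y) - 1 / y) / (2 * y))) ?_ using 1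
  · have := htanh.ne'
    field_simp
    ring
  · convert hA using 4
    push_cast
    ring

theorem hasSum_covSymbol {k : Mom P} (hk : k ≠ 0) :
    HasSum (fun n : ℤ => covSymbol P (n, k)) (P.β * timeZeroSymbol P k) := by
  have he := disp_pos P hk
  have hβ := P.β_pos
  have hpi := Real.pi_pos
  have hy : 0 < P.β * disp P k / (2 * Real.pi) := by positivity
  have h := (hasSum_inv_sq_add_sq _ hy).mul_left ((P.β / (2 * Real.pi)) ^ 2)
  have e1 : Real.pi * (P.β * disp P k / (2 * Real.pi)) = P.β * disp P k / 2 := by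
    field_simp
  rw [e1] at h
  have htanh : 0 < Real.tanh (P.β * disp P k / 2) := by
    rw [Real.tanh_eq_sinh_div_cosh]
    exact div_pos (Real.sinh_pos_iff.mpr (by positivity)) (Real.cosh_pos _)
  have hf : (fun n : ℤ => covSymbol P (n, k)) = fun n : ℤ => (P.β / (2 * Real.pi)) ^ 2 *
      (1 / ((P.β * disp P k / (2 * Real.pi)) ^ 2 + (n : ℝ) ^ 2)) := by
    funext n
    simp only [covSymbol, matsubara]
    have h1 : 0 < (2 * Real.pi * n / P.β) ^ 2 + disp P k ^ 2 := by positivity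
    have h2 : 0 < (P.β * disp P k / (2 * Real.pi)) ^ 2 + (n : ℝ) ^ 2 := by positivity
    field_simp
    ring
  have hv : P.β * timeZeroSymbol P k = (P.β / (2 * Real.pi)) ^ 2 * (Real.pi /
      (P.β * disp P k / (2 * Real.pi) * Real.tanh (P.β * disp P k / 2))) := by
    simp only [timeZeroSymbol]
    field_simp
  rw [hf, hv]
  exact h

theorem memLp_two_of_lintegral {α : Type*} [MeasurableSpace α] {ν : Measure α} {f : α → ℂ}
    (hf : AEStronglyMeasurable f ν) (h : ∫⁻ x, ‖f x‖ₑ ^ 2 ∂ν < ∞) : MemLp f 2 ν := by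
  refine ⟨hf, ?_⟩
  rw [eLpNorm_lt_top_iff_lintegral_rpow_enorm_lt_top (by simp) (by simp)]
  simpa using h

theorem lintegral_of_memLp_two {α : Type*} [MeasurableSpace α] {ν : Measure α} {f : α → ℂ}
    (h : MemLp f 2 ν) : ∫⁻ x, ‖f x‖ₑ ^ 2 ∂ν < ∞ := by
  have := h.2
  rw [eLpNorm_lt_top_iff_lintegral_rpow_enorm_lt_top (by simp) (by simp)] at this
  simpa using this

theorem lintegral_covMeasure_snd {F : Mom P → ℝ≥0∞} (hF : Measurable F) :
    ∫⁻ x, F x.2 ∂(covMeasure P) = ENNReal.ofReal P.β * ∫⁻ k, F k ∂(timeZeroMeasure P) := by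
  have hw := (measurable_covSymbol P).ennreal_ofReal
  have hw0 := (measurable_timeZeroSymbol P).ennreal_ofReal
  have hF2 : Measurable fun x : ℤ × Mom P => F x.2 := hF.comp measurable_snd
  rw [covMeasure, lintegral_withDensity_eq_lintegral_mul _ hw hF2, timeZeroMeasure,
    lintegral_withDensity_eq_lintegral_mul _ hw0 hF,
    lintegral_prod_symm _ (hw.mul hF2).aemeasurable, ← lintegral_const_mul _ (hw0.mul hF)]
  refine lintegral_congr_ae ?_
  filter_upwards [ae_ne_zero P] with k hk
  have hsum := hasSum_covSymbol P hk
  have hnn : ∀ n : ℤ, 0 ≤ covSymbol P (n, k) := fun n => by unfold covSymbol; positivity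
  simp only [Pi.mul_apply]
  rw [lintegral_count, ENNReal.tsum_mul_right, ← ENNReal.ofReal_tsum_of_nonneg hnn hsum.summable,
    hsum.tsum_eq, ENNReal.ofReal_mul P.β_pos.le, mul_assoc]

/-- `1 + 2ρ = coth (βε/2)`, divided by `2ε`. -/
theorem timeZeroSymbol_eq {k : Mom P} (hk : k ≠ 0) :
    timeZeroSymbol P k = (1 + 2 * rho P k) * oneParticleSymbol P k := by
  have he := disp_pos P hk
  have hx : 0 < P.β * disp P k / 2 := by have := P.β_pos; positivity
  have hsinh := Real.sinh_pos_iff.mpr hx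
  have e : P.β * disp P k = P.β * disp P k / 2 + P.β * disp P k / 2 := by ring
  have h1 : 1 < Real.exp (P.β * disp P k / 2) := Real.one_lt_exp_iff.mpr hx
  simp only [timeZeroSymbol, rho, oneParticleSymbol, Real.tanh_eq_sinh_div_cosh]
  rw [e, Real.exp_add, ← e, Real.sinh_eq, Real.cosh_eq, Real.exp_neg]
  generalize Real.exp (P.β * disp P k / 2) = y at *
  have h2 : y * y - 1 ≠ 0 := by nlinarith
  have h3 : y - y⁻¹ ≠ 0 := by
    have : y⁻¹ < 1 := inv_lt_one_of_one_lt₀ h1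
    linarith
  have h4 : y ^ 2 - 1 ≠ 0 := by nlinarith
  have h5 : y ≠ 0 := by linarith
  field_simp
  ring

theorem rho_nonneg {k : Mom P} : 0 ≤ rho P k := by
  unfold rho
  have : 0 ≤ disp P k := by unfold disp; positivity
  have : 1 ≤ Real.exp (P.β * disp P k) := Real.one_le_exp (mul_nonneg P.β_pos.le this)
  exact inv_nonneg.mpr (by linarith)

end Weights

/-! ### The real Hilbert spaces of test functions and of sharp-time test functions -/

/-- The real Hilbert space of those `f` in the complex space `L²(ν)` with `f(-x) = conj (f x)`:
the Fourier transforms of real-valued functions. -/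
def hermitianL2 {α : Type*} [MeasurableSpace α] [Neg α] (ν : Measure α)
    (hν : MeasurePreserving (fun x : α => -x) ν ν) : Submodule ℝ (Lp ℂ 2 ν) where
  carrier := {f | ∀ᵐ x ∂ν, f (-x) = conj (f x)}
  zero_mem' := by
    have h := Lp.coeFn_zero ℂ 2 ν
    filter_upwards [h, hν.quasiMeasurePreserving.ae h] with x h1 h2
    rw [h1, h2]; simp
  add_mem' := by
    intro f g hf hg
    have h := Lp.coeFn_add f g
    change ∀ᵐ x ∂ν, (f + g : Lp ℂ 2 ν) (-x) = conj ((f + g : Lp ℂ 2 ν) x)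
    filter_upwards [h, hν.quasiMeasurePreserving.ae h, hf, hg] with x h1 h2 h3 h4
    rw [h1, h2, Pi.add_apply, Pi.add_apply, h3, h4, map_add]
  smul_mem' := by
    intro c f hf
    have h := Lp.coeFn_smul c f
    change ∀ᵐ x ∂ν, (c • f : Lp ℂ 2 ν) (-x) = conj ((c • f : Lp ℂ 2 ν) x)
    filter_upwards [h, hν.quasiMeasurePreserving.ae h, hf] with x h1 h2 h3
    rw [h1, h2, Pi.smul_apply, Pi.smul_apply, h3]
    simp

/-- The space of time-zero test functions `(2 ε tanh (βε/2))^{1/2} 𝒳`, where `𝒳 = L²(ℝ^d; ℝ)`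
is written in momentum space: `∫ |g(k)|² (2ε)⁻¹ coth (βε/2) dk < ∞`. -/
abbrev TimeZeroSpace (P : Params) : Type :=
  hermitianL2 (timeZeroMeasure P) (measurePreserving_neg_timeZero P)

/-- The space of test functions on the thermal circle times space, in Fourier variables, normed by
the covariance `C = (D_t² + ε²)⁻¹`: `∑ₙ ∫ |f(n,k)|² / (ω_n² + ε(k)²) dk < ∞`. -/
abbrev TestSpace (P : Params) : Type :=
  hermitianL2 (covMeasure P) (measurePreserving_neg_cov P)

/-- The covariance form `q(f) = ‖C^{1/2} f‖² = ∑ₙ ∫ |f(n,k)|² / (ω_n² + ε(k)²) dk`. -/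
def covForm (P : Params) (f : TestSpace P) : ℝ :=
  ∫ x, ‖(f : Lp ℂ 2 (covMeasure P)) x‖ ^ 2 ∂(covMeasure P)

/-- The factor `e^{-i ω_n t}` by which translation by `t` acts on Fourier coefficients. -/
def timePhase (P : Params) (t : ℝ) (n : ℤ) : ℂ :=
  Complex.exp (-(Complex.I * (matsubara P n * t : ℝ)))

theorem norm_timePhase (P : Params) (t : ℝ) (n : ℤ) : ‖timePhase P t n‖ = 1 := by
  unfold timePhase
  rw [Complex.norm_exp]
  simp

theorem timePhase_neg (P : Params) (t : ℝ) (n : ℤ) :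
    timePhase P t (-n) = conj (timePhase P t n) := by
  unfold timePhase
  rw [← Complex.exp_conj]
  congr 1
  simp only [matsubara, map_neg, map_mul, Complex.conj_I, Complex.conj_ofReal, Int.cast_neg]
  push_cast
  ring

theorem timePhase_zero (P : Params) (n : ℤ) : timePhase P 0 n = 1 := by simp [timePhase]

theorem measurable_timePhase (P : Params) (t : ℝ) :
    Measurable fun x : ℤ × Mom P => timePhase P t x.1 :=
  (measurable_from_top (f := timePhase P t)).comp measurable_fst

theorem memLp_timePhase_mul (P : Params) (t : ℝ) (f : Lp ℂ 2 (covMeasure P)) :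
    MemLp (fun x => timePhase P t x.1 * f x) 2 (covMeasure P) := by
  refine (Lp.memLp f).of_le
    ((measurable_timePhase P t).aestronglyMeasurable.mul (Lp.aestronglyMeasurable f)) ?_
  filter_upwards with x
  rw [norm_mul, norm_timePhase, one_mul]

/-- Time translation `(u_t f)(s) = f(s - t)` on test functions. -/
def translate (P : Params) (t : ℝ) : TestSpace P →ₗ[ℝ] TestSpace P where
  toFun f := ⟨(memLp_timePhase_mul P t f).toLp _, by
    have h := (memLp_timePhase_mul P t f).coeFn_toLp
    change ∀ᵐ x ∂(covMeasure P), (memLp_timePhase_mul P t f).toLp _ (-x) =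
      conj ((memLp_timePhase_mul P t f).toLp _ x)
    filter_upwards [h, (measurePreserving_neg_cov P).quasiMeasurePreserving.ae h, f.2]
      with x h1 h2 h3
    rw [h1, h2, h3, map_mul, Prod.fst_neg, timePhase_neg]⟩
  map_add' f g := by
    apply Subtype.ext
    apply Lp.ext
    filter_upwards [(memLp_timePhase_mul P t (f + g : TestSpace P)).coeFn_toLp,
      (memLp_timePhase_mul P t f).coeFn_toLp, (memLp_timePhase_mul P t g).coeFn_toLp,
      Lp.coeFn_add (f : Lp ℂ 2 (covMeasure P)) g,
      Lp.coeFn_add ((memLp_timePhase_mul P t f).toLp _) ((memLp_timePhase_mul P t g).toLp _)]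
      with x h1 h2 h3 h4 h5
    rw [h1, Submodule.coe_add, Submodule.coe_add, h4, h5, Pi.add_apply, Pi.add_apply, h2, h3,
      mul_add]
  map_smul' c f := by
    apply Subtype.ext
    apply Lp.ext
    filter_upwards [(memLp_timePhase_mul P t (c • f : TestSpace P)).coeFn_toLp,
      (memLp_timePhase_mul P t f).coeFn_toLp,
      Lp.coeFn_smul c (f : Lp ℂ 2 (covMeasure P)),
      Lp.coeFn_smul c ((memLp_timePhase_mul P t f).toLp _)] with x h1 h2 h3 h4
    rw [h1, RingHom.id_apply, Submodule.coe_smul, Submodule.coe_smul, h3, h4, Pi.smul_apply,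
      Pi.smul_apply, h2, mul_smul_comm]

theorem translate_zero (P : Params) (f : TestSpace P) : translate P 0 f = f := by
  apply Subtype.ext
  apply Lp.ext
  filter_upwards [(memLp_timePhase_mul P 0 f).coeFn_toLp] with x h1
  refine h1.trans ?_
  rw [timePhase_zero, one_mul]

theorem memLp_sharpTime (P : Params) (g : Lp ℂ 2 (timeZeroMeasure P)) :
    MemLp (fun x : ℤ × Mom P => ((Real.sqrt P.β)⁻¹ : ℂ) * g x.2) 2 (covMeasure P) := by
  have hg := (Lp.stronglyMeasurable g).measurable
  refine MemLp.const_mul (memLp_two_of_lintegral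
    (hg.comp measurable_snd).aestronglyMeasurable ?_) _
  have e := lintegral_covMeasure_snd P (F := fun k => ‖g k‖ₑ ^ 2) (hg.enorm.pow_const 2)
  refine e.trans_lt ?_
  exact ENNReal.mul_lt_top ENNReal.ofReal_lt_top (lintegral_of_memLp_two (Lp.memLp g))

/-- The sharp-time test function `j_0 g = δ_0 ⊗ g`, with Fourier coefficients
`β^{-1/2} g(k)`, `n ∈ ℤ`. -/
def sharpTimeZero (P : Params) (g : TimeZeroSpace P) : TestSpace P :=
  ⟨(memLp_sharpTime P g).toLp _, by
    have h := (memLp_sharpTime P g).coeFn_toLp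
    change ∀ᵐ x ∂(covMeasure P), (memLp_sharpTime P g).toLp _ (-x) =
      conj ((memLp_sharpTime P g).toLp _ x)
    have hg : ∀ᵐ x ∂(covMeasure P),
        (g : Lp ℂ 2 (timeZeroMeasure P)) (-x.2) = conj ((g : Lp ℂ 2 (timeZeroMeasure P)) x.2) := by
      have hm := (Lp.stronglyMeasurable (g : Lp ℂ 2 (timeZeroMeasure P))).measurable
      have hA : MeasurableSet {k : Mom P | ¬ (g : Lp ℂ 2 (timeZeroMeasure P)) (-k) =
          conj ((g : Lp ℂ 2 (timeZeroMeasure P)) k)} :=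
        (measurableSet_eq_fun (hm.comp measurable_neg)
          (Complex.continuous_conj.measurable.comp hm)).compl
      have h0 : (timeZeroMeasure P) {k : Mom P | ¬ (g : Lp ℂ 2 (timeZeroMeasure P)) (-k) =
          conj ((g : Lp ℂ 2 (timeZeroMeasure P)) k)} = 0 := g.2
      have h1 := lintegral_covMeasure_snd P (measurable_one.indicator hA)
      rw [lintegral_indicator_one hA, h0, mul_zero] at h1
      rw [ae_iff]
      refine Eq.trans (lintegral_indicator_one (measurable_snd hA)).symm h1
    filter_upwards [h, (measurePreserving_neg_cov P).quasiMeasurePreserving.ae h, hg]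
      with x h1 h2 h3
    rw [h1, h2, Prod.snd_neg, h3]
    simp⟩

/-! ### The path space -/

/-- Paths: real linear functionals `f ↦ φ(f)` on the space of test functions. -/
def PathSpace (P : Params) : Type := Module.Dual ℝ (TestSpace P)

/-- The field `φ(f)`. -/
def pathField {P : Params} (f : TestSpace P) (φ : PathSpace P) : ℝ :=
  (show Module.Dual ℝ (TestSpace P) from φ) f

/-- The cylinder `σ`-algebra, generated by all fields `φ(f)`. -/
instance (P : Params) : MeasurableSpace (PathSpace P) :=
  ⨆ f : TestSpace P, MeasurableSpace.comap (pathField f) inferInstance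

theorem measurable_pathField {P : Params} (f : TestSpace P) : Measurable (pathField f) :=
  Measurable.mono (comap_measurable (pathField f))
    (le_iSup (fun f : TestSpace P => MeasurableSpace.comap (pathField f) inferInstance) f) le_rfl

/-- `μ` is the Gaussian measure with characteristic functional `exp (-q(f)/4)`. -/
def IsGaussianPathMeasure (P : Params) (μ : Measure (PathSpace P)) : Prop :=
  ∀ f : TestSpace P,
    ∫ φ, Complex.exp (Complex.I * pathField f φ) ∂μ = Complex.exp (-(covForm P f : ℂ) / 4)

/-- The dual translation on paths, `(ũ_t φ)(f) = φ(u_t f)`. -/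
def shift (P : Params) (t : ℝ) (φ : PathSpace P) : PathSpace P :=
  (show Module.Dual ℝ (TestSpace P) from φ) ∘ₗ translate P t

theorem pathField_shift {P : Params} (t : ℝ) (f : TestSpace P) (φ : PathSpace P) :
    pathField f (shift P t φ) = pathField (translate P t f) φ := rfl

theorem shift_zero (P : Params) : shift P 0 = id := by
  funext φ
  refine LinearMap.ext fun f => ?_
  change pathField (translate P 0 f) φ = pathField f φ
  rw [translate_zero]

/-- The time evolution `(U_t F)(φ) = F(ũ_t φ)`. -/
def evolve (P : Params) (t : ℝ) (F : PathSpace P → ℂ) : PathSpace P → ℂ := fun φ => F (shift P t φ)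

/-- The exponential `e^{i φ(j_0 g)}` of the time-zero field. -/
def expField {P : Params} (g : TimeZeroSpace P) (φ : PathSpace P) : ℂ :=
  Complex.exp (Complex.I * pathField (sharpTimeZero P g) φ)

/-- The `σ`-algebra at time `0`, generated by the `e^{i φ(j_0 g)}`. -/
abbrev sigmaZero (P : Params) : MeasurableSpace (PathSpace P) :=
  ⨆ g : TimeZeroSpace P, MeasurableSpace.comap (expField g) inferInstance

/-- The `σ`-algebra at time `t`: the image of the `σ`-algebra at time `0` under `U_t`. -/
abbrev sigmaAt (P : Params) (t : ℝ) : MeasurableSpace (PathSpace P) :=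
  MeasurableSpace.comap (shift P t) (sigmaZero P)

/-- The `σ`-algebra of a set `I` of times. -/
abbrev sigmaOn (P : Params) (I : Set ℝ) : MeasurableSpace (PathSpace P) := ⨆ t ∈ I, sigmaAt P t

theorem sigmaZero_le (P : Params) {I : Set ℝ} (hI : (0 : ℝ) ∈ I) : sigmaZero P ≤ sigmaOn P I := by
  have h : sigmaZero P = sigmaAt P 0 := by
    rw [sigmaAt, shift_zero, MeasurableSpace.comap_id]
  rw [h]
  exact le_iSup₂ (f := fun t (_ : t ∈ I) => sigmaAt P t) 0 hI

theorem measurable_expField {P : Params} (g : TimeZeroSpace P) :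
    Measurable[sigmaZero P] (expField g) :=
  Measurable.mono (comap_measurable (expField g))
    (le_iSup (fun g : TimeZeroSpace P => MeasurableSpace.comap (expField g) inferInstance) g)
    le_rfl

theorem norm_expField {P : Params} (g : TimeZeroSpace P) (φ : PathSpace P) :
    ‖expField g φ‖ = 1 := by
  unfold expField
  rw [Complex.norm_exp]
  simp

/-- The physical Hilbert space `L²(Q, 𝔖_{{0, β/2}}, μ)`. -/
abbrev PhysSpace (P : Params) (μ : Measure (PathSpace P)) : Type :=
  lpMeas ℂ ℂ (sigmaOn P {0, P.β / 2}) 2 μ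

/-- The time-zero algebra `L^∞(Q, 𝔖_0, μ)`. -/
abbrev TimeZeroAlgebra (P : Params) (μ : Measure (PathSpace P)) : Type :=
  lpMeas ℂ ℂ (sigmaZero P) ∞ μ

/-- The constant function `1` in the physical Hilbert space. -/
def thermalOne (P : Params) (μ : Measure (PathSpace P)) [IsProbabilityMeasure μ] :
    PhysSpace P μ :=
  ⟨(memLp_const (1 : ℂ)).toLp _, by
    rw [mem_lpMeas_iff_aestronglyMeasurable]
    exact (aestronglyMeasurable_const (b := (1 : ℂ))).congr (MemLp.coeFn_toLp _).symm⟩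

theorem measurable_expField' {P : Params} (g : TimeZeroSpace P) : Measurable (expField g) := by
  have := measurable_pathField (sharpTimeZero P g)
  unfold expField
  fun_prop

theorem memLp_expField {P : Params} (μ : Measure (PathSpace P)) [IsProbabilityMeasure μ]
    (g : TimeZeroSpace P) : MemLp (expField g) ∞ μ :=
  memLp_top_of_bound (measurable_expField' g).aestronglyMeasurable 1
    (Eventually.of_forall fun φ => (norm_expField g φ).le)

/-- `e^{i φ(j_0 g)}` as an element of the time-zero algebra. -/
def expFieldAlg {P : Params} (μ : Measure (PathSpace P)) [IsProbabilityMeasure μ]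
    (g : TimeZeroSpace P) : TimeZeroAlgebra P μ :=
  ⟨(memLp_expField μ g).toLp _, by
    rw [mem_lpMeas_iff_aestronglyMeasurable]
    exact AEStronglyMeasurable.congr
      (measurable_expField g).stronglyMeasurable.aestronglyMeasurable
      (MemLp.coeFn_toLp _).symm⟩

theorem memLp_mul_phys {P : Params} {μ : Measure (PathSpace P)} (G : TimeZeroAlgebra P μ)
    (ψ : PhysSpace P μ) :
    ((ContinuousLinearMap.mul ℂ ℂ).holderL μ ∞ 2 2 (G : Lp ℂ ∞ μ)) (ψ : Lp ℂ 2 μ) ∈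
      lpMeas ℂ ℂ (sigmaOn P {0, P.β / 2}) 2 μ := by
  rw [mem_lpMeas_iff_aestronglyMeasurable]
  have hG := (mem_lpMeas_iff_aestronglyMeasurable.mp G.2).mono
    (sigmaZero_le P (I := {0, P.β / 2}) (by simp))
  have hψ := mem_lpMeas_iff_aestronglyMeasurable.mp ψ.2
  exact (hG.mul hψ).congr ((ContinuousLinearMap.mul ℂ ℂ).coeFn_holder _ _).symm

/-- The operator of multiplication by an element `G` of the time-zero algebra on the physical
Hilbert space. -/
def mulOp {P : Params} {μ : Measure (PathSpace P)} (G : TimeZeroAlgebra P μ) :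
    PhysSpace P μ →L[ℂ] PhysSpace P μ :=
  (((ContinuousLinearMap.mul ℂ ℂ).holderL μ ∞ 2 2 (G : Lp ℂ ∞ μ)).comp
    (lpMeas ℂ ℂ (sigmaOn P {0, P.β / 2}) 2 μ).subtypeL).codRestrict
    (lpMeas ℂ ℂ (sigmaOn P {0, P.β / 2}) 2 μ) (memLp_mul_phys G)

/-! ### Bosonic Fock space, Weyl operators, Araki–Woods fields -/

section Fock

variable {M : Type*} [MeasurableSpace M] (m : Measure M) [SigmaFinite m]

theorem measurePreserving_perm {n : ℕ} (σ : Equiv.Perm (Fin n)) :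
    MeasurePreserving (fun (x : Fin n → M) i => x (σ i))
      (Measure.pi fun _ : Fin n => m) (Measure.pi fun _ : Fin n => m) := by
  have h := measurePreserving_piCongrLeft (α := fun _ : Fin n => M) (fun _ => m) σ.symm
  convert h using 1
  funext x i
  have := MeasurableEquiv.piCongrLeft_apply_apply (β := fun _ : Fin n => M) (e := σ.symm) x (σ i)
  simpa using this.symm

/-- The `n`-particle space: square integrable functions on `M^n`, symmetric under permutations. -/
def symL2 (n : ℕ) : Submodule ℂ (Lp ℂ 2 (Measure.pi fun _ : Fin n => m)) where
  carrier := {ψ | ∀ σ : Equiv.Perm (Fin n),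
    ∀ᵐ x ∂(Measure.pi fun _ : Fin n => m), ψ (fun i => x (σ i)) = ψ x}
  zero_mem' := by
    intro σ
    have h := Lp.coeFn_zero ℂ 2 (Measure.pi fun _ : Fin n => m)
    filter_upwards [h, (measurePreserving_perm m σ).quasiMeasurePreserving.ae h] with x h1 h2
    rw [h1, h2]; rfl
  add_mem' := by
    intro ψ χ hψ hχ σ
    have h := Lp.coeFn_add ψ χ
    filter_upwards [h, (measurePreserving_perm m σ).quasiMeasurePreserving.ae h, hψ σ, hχ σ]
      with x h1 h2 h3 h4
    rw [h1, h2, Pi.add_apply, Pi.add_apply, h3, h4]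
  smul_mem' := by
    intro c ψ hψ σ
    have h := Lp.coeFn_smul c ψ
    filter_upwards [h, (measurePreserving_perm m σ).quasiMeasurePreserving.ae h, hψ σ]
      with x h1 h2 h3
    rw [h1, h2, Pi.smul_apply, Pi.smul_apply, h3]

/-- The bosonic Fock space over `L²(M, m)`: the Hilbert space direct sum of the `n`-particle
spaces. -/
abbrev Fock : Type _ := lp (fun n : ℕ => symL2 m n) 2

variable {m}

theorem memLp_prod (h : Lp ℂ 2 m) (n : ℕ) :
    MemLp (fun x : Fin n → M => ((Real.sqrt n.factorial)⁻¹ : ℂ) * ∏ i, h (x i)) 2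
      (Measure.pi fun _ : Fin n => m) := by
  refine MemLp.const_mul ?_ _
  have hm := (Lp.stronglyMeasurable h).measurable
  have hmeas : Measurable fun x : Fin n → M => ∏ i, h (x i) :=
    Finset.measurable_prod _ fun i _ => hm.comp (measurable_pi_apply i)
  rw [memLp_two_iff_integrable_sq_norm hmeas.aestronglyMeasurable]
  have hi := (memLp_two_iff_integrable_sq_norm (Lp.aestronglyMeasurable h)).mp (Lp.memLp h)
  have := Integrable.fintype_prod (ι := Fin n) (f := fun _ y => ‖h y‖ ^ 2) fun _ => hi
  simpa only [norm_prod, Finset.prod_pow] using this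

theorem norm_sq_Lp {α : Type*} [MeasurableSpace α] {ν : Measure α} (f : Lp ℂ 2 ν) :
    ‖f‖ ^ 2 = ∫ x, ‖f x‖ ^ 2 ∂ν := by
  rw [← inner_self_eq_norm_sq (𝕜 := ℂ), L2.inner_def, ← integral_re (L2.integrable_inner f f)]
  refine integral_congr_ae (Eventually.of_forall fun x => ?_)
  exact inner_self_eq_norm_sq (𝕜 := ℂ) (f x)

/-- The `n`-particle component `(n!)^{-1/2} h^{⊗n}` of the coherent vector of `h`. -/
def coherentComponent (h : Lp ℂ 2 m) (n : ℕ) : symL2 m n :=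
  ⟨(memLp_prod h n).toLp _, by
    intro σ
    have e := (memLp_prod h n).coeFn_toLp
    filter_upwards [e, (measurePreserving_perm m σ).quasiMeasurePreserving.ae e] with x h1 h2
    rw [h1, h2, Equiv.prod_comp σ fun i => h (x i)]⟩

theorem norm_sq_coherentComponent (h : Lp ℂ 2 m) (n : ℕ) :
    ‖coherentComponent h n‖ ^ 2 = (‖h‖ ^ 2) ^ n / n.factorial := by
  have e0 : ‖coherentComponent h n‖ = ‖(memLp_prod h n).toLp _‖ := rfl
  rw [e0, norm_sq_Lp, norm_sq_Lp h]
  have e1 : ∫ x, ‖(memLp_prod h n).toLp _ x‖ ^ 2 ∂(Measure.pi fun _ : Fin n => m) =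
      ∫ x, (n.factorial : ℝ)⁻¹ * ∏ i : Fin n, ‖h (x i)‖ ^ 2 ∂(Measure.pi fun _ : Fin n => m) := by
    refine integral_congr_ae ?_
    filter_upwards [(memLp_prod h n).coeFn_toLp] with x hx
    rw [hx, norm_mul, mul_pow, norm_prod, Finset.prod_pow, norm_inv, inv_pow, Complex.norm_real,
      Real.norm_eq_abs, sq_abs, Real.sq_sqrt (by positivity)]
  rw [e1, integral_const_mul, integral_fintype_prod_eq_pow (fun y => ‖h y‖ ^ 2), Fintype.card_fin]
  ring

theorem memℓp_coherent (h : Lp ℂ 2 m) : Memℓp (fun n => coherentComponent h n) 2 := by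
  refine memℓp_gen ?_
  have := Real.summable_pow_div_factorial (‖h‖ ^ 2)
  refine this.congr fun n => ?_
  rw [← norm_sq_coherentComponent]
  simp

/-- The coherent (exponential) vector `∑ₙ (n!)^{-1/2} h^{⊗n}`. -/
def coherent (h : Lp ℂ 2 m) : Fock m := ⟨fun n => coherentComponent h n, memℓp_coherent h⟩

/-- The Fock vacuum. -/
def vacuum (m : Measure M) [SigmaFinite m] : Fock m := coherent 0

/-- `W` is the Weyl operator `e^{iΦ(f)}` of the Segal field `Φ(f) = (a*(f) + a(f))/√2`: the
bounded operator acting on the (total) set of coherent vectors by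
`W coh(h) = exp (-‖f‖²/4 + (i/√2) ⟨f, h⟩) coh(h + (i/√2) f)`. -/
def IsWeylOperator (f : Lp ℂ 2 m) (W : Fock m →L[ℂ] Fock m) : Prop :=
  ∀ h : Lp ℂ 2 m, W (coherent h) =
    Complex.exp (-(‖f‖ ^ 2 : ℝ) / 4 + Complex.I / (Real.sqrt 2 : ℝ) * inner ℂ f h) •
      coherent (h + (Complex.I / (Real.sqrt 2 : ℝ)) • f)

/-- The graph of the (in general unbounded) self-adjoint operator `e^{-tL}` with its natural
domain, where `L = dΓ(e)` is the second quantization of the multiplication operator by `e`, that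
is, multiplication by `e(x_1) + ⋯ + e(x_n)` on the `n`-particle space. -/
def ExpGraph (e : M → ℝ) (t : ℝ) (ψ χ : Fock m) : Prop :=
  ∀ n : ℕ, ∀ᵐ x ∂(Measure.pi fun _ : Fin n => m),
    (χ n : Lp ℂ 2 (Measure.pi fun _ : Fin n => m)) x =
      (Real.exp (-(t * ∑ i, e (x i))) : ℂ) * (ψ n : Lp ℂ 2 (Measure.pi fun _ : Fin n => m)) x

/-- The graph of `τ_{it}(A) = e^{-tL} A e^{tL}` on its natural domain, the value at imaginary time
`it` of `τ_r(A) = e^{irL} A e^{-irL}`. -/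
def ImagTimeGraph (e : M → ℝ) (t : ℝ) (A : Fock m →L[ℂ] Fock m) (ψ χ : Fock m) : Prop :=
  ∃ η : Fock m, ExpGraph e (-t) ψ η ∧ ExpGraph e t (A η) χ

/-- `ω(τ_{it₁}(A₁) ⋯ τ_{itₙ}(Aₙ))` exists and equals `c`, for the vector state `ω` of the vacuum
`Ω`: the vector `Ω` lies in the domain of the product `τ_{it₁}(A₁) ⋯ τ_{itₙ}(Aₙ)` of (in general
unbounded) operators and `⟨Ω, τ_{it₁}(A₁) ⋯ τ_{itₙ}(Aₙ) Ω⟩ = c`.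
Here `v j = τ_{it_{j+1}}(A_{j+1}) ⋯ τ_{itₙ}(Aₙ) Ω`. -/
def HasImagTimeCorrelation (e : M → ℝ) {n : ℕ} (t : Fin n → ℝ)
    (A : Fin n → (Fock m →L[ℂ] Fock m)) (c : ℂ) : Prop :=
  ∃ v : Fin (n + 1) → Fock m, v (Fin.last n) = vacuum m ∧
    (∀ j : Fin n, ImagTimeGraph e (t j) (A j) (v j.succ) (v j.castSucc)) ∧
    inner ℂ (vacuum m) (v 0) = c

end Fock

/-- The Fock space over `(2ε)^{1/2} ℂ𝒳 ⊕ conj ((2ε)^{1/2} ℂ𝒳)`. -/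
abbrev ThermalFock (P : Params) : Type := Fock (oneParticleMeasure P)

/-- The symbol of the one-particle Liouvillian `ε ⊕ (-ε)`. -/
def liouvilleSymbol (P : Params) (x : Bool × Mom P) : ℝ :=
  if x.1 then -disp P x.2 else disp P x.2

/-- The function `(1+ρ)^{1/2} g ⊕ ρ^{1/2} conj(g)`. -/
def leftArakiWoodsFun (P : Params) (g : Mom P → ℂ) (x : Bool × Mom P) : ℂ :=
  if x.1 then (Real.sqrt (rho P x.2) : ℂ) * conj (g x.2)
  else (Real.sqrt (1 + rho P x.2) : ℂ) * g x.2

theorem memLp_leftArakiWoods (P : Params) (g : Lp ℂ 2 (timeZeroMeasure P)) :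
    MemLp (leftArakiWoodsFun P g) 2 (oneParticleMeasure P) := by
  have hg := (Lp.stronglyMeasurable g).measurable
  have hr := measurable_rho P
  have hm : Measurable (leftArakiWoodsFun P g) := by
    refine measurable_from_prod_countable_right fun b => ?_
    cases b
    · simp only [leftArakiWoodsFun, Bool.false_eq_true, if_false]
      fun_prop
    · have := Complex.continuous_conj.measurable.comp hg
      simp only [leftArakiWoodsFun, if_true]
      fun_prop
  refine memLp_two_of_lintegral hm.aestronglyMeasurable ?_
  have hw := (measurable_oneParticleSymbol P).ennreal_ofReal
  have hw2 : Measurable fun x : Bool × Mom P => ENNReal.ofReal (oneParticleSymbol P x.2) :=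
    hw.comp measurable_snd
  have hw0 := (measurable_timeZeroSymbol P).ennreal_ofReal
  have hfin := lintegral_of_memLp_two (Lp.memLp g)
  have hfin' : ∫⁻ k, ((fun k => ENNReal.ofReal (timeZeroSymbol P k)) * fun k => ‖g k‖ₑ ^ 2) k <
      ∞ := by
    refine lt_of_eq_of_lt ?_ hfin
    exact (lintegral_withDensity_eq_lintegral_mul _ hw0 (hg.enorm.pow_const 2)).symm
  rw [oneParticleMeasure, lintegral_withDensity_eq_lintegral_mul _ hw2
    (hm.enorm.pow_const 2), lintegral_prod_symm _ ((hw2.mul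
    (hm.enorm.pow_const 2)).aemeasurable)]
  refine lt_of_le_of_lt (le_of_eq ?_) hfin'
  refine lintegral_congr_ae ?_
  filter_upwards [ae_ne_zero P] with k hk
  have h1 := rho_nonneg P (k := k)
  have h2 : 0 ≤ oneParticleSymbol P k := by
    have := disp_pos P hk
    unfold oneParticleSymbol; positivity
  have e1 : ∀ r : ℝ, 0 ≤ r → ∀ z : ℂ, ‖(Real.sqrt r : ℂ) * z‖ₑ ^ 2 = ENNReal.ofReal r * ‖z‖ₑ ^ 2 := by
    intro r hr z
    rw [enorm_mul, mul_pow, ← ofReal_norm, Complex.norm_real, Real.norm_eq_abs,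
      abs_of_nonneg (Real.sqrt_nonneg r), ← ENNReal.ofReal_pow (Real.sqrt_nonneg r),
      Real.sq_sqrt hr]
  have e2 : ‖conj (g k)‖ₑ = ‖g k‖ₑ := by
    rw [← ofReal_norm, ← ofReal_norm, RCLike.norm_conj]
  rw [lintegral_count, tsum_bool]
  simp only [Pi.mul_apply, leftArakiWoodsFun, Bool.false_eq_true, if_false,
    if_true]
  rw [e1 _ h1, e1 _ (by linarith), e2, timeZeroSymbol_eq P hk, ← mul_add, ← add_mul,
    ← ENNReal.ofReal_add (by linarith) h1, ← mul_assoc, ← ENNReal.ofReal_mul h2]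
  congr 2
  ring

/-- The one-particle vector `(1+ρ)^{1/2} g ⊕ ρ^{1/2} conj(g)` of the left Araki–Woods Weyl operator
`W_{ρ,l}(g)`. -/
def leftArakiWoods (P : Params) (g : TimeZeroSpace P) : Lp ℂ 2 (oneParticleMeasure P) :=
  (memLp_leftArakiWoods P g).toLp _

/-- The operator `T A T⁻¹`. -/
def transport {P : Params} {μ : Measure (PathSpace P)}
    (T : PhysSpace P μ ≃ₗᵢ[ℂ] ThermalFock P) (A : PhysSpace P μ →L[ℂ] PhysSpace P μ) :
    ThermalFock P →L[ℂ] ThermalFock P :=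
  (T.toContinuousLinearEquiv : PhysSpace P μ →L[ℂ] ThermalFock P).comp
    (A.comp (T.symm.toContinuousLinearEquiv : ThermalFock P →L[ℂ] PhysSpace P μ))

/-- A unitary map `T` of the physical Hilbert space onto the Araki–Woods Fock space with
`T 1 = Ω` and `T e^{i φ(j_0 g)} T⁻¹ = W_{ρ,l}(g)` for all time-zero test functions `g`. -/
structure IsEuclideanUnitary {P : Params} {μ : Measure (PathSpace P)} [IsProbabilityMeasure μ]
    (T : PhysSpace P μ ≃ₗᵢ[ℂ] ThermalFock P) : Prop where
  map_one : T (thermalOne P μ) = vacuum (oneParticleMeasure P)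
  map_exp : ∀ g : TimeZeroSpace P,
    IsWeylOperator (leftArakiWoods P g) (transport T (mulOp (expFieldAlg μ g)))

end ThermalBose

end

noncomputable section

namespace ThermalBose

/-! ### Isometries determined by Gram matrices -/

section Gram

variable {𝕜 E F : Type*} [RCLike 𝕜] [NormedAddCommGroup E] [InnerProductSpace 𝕜 E] [NormedAddCommGroup F]
  [InnerProductSpace 𝕜 F]

/-! Write `Z` for the one-particle space, `q` for the covariance form, and `z_s(g) = e^{-sL}(√(1+ρ)
g ⊕ √ρ ḡ)` for `0 ≤ s ≤ β/2` (`araki`). The relation `e^{βε}ρ = 1+ρ` keeps `z_s(g)` in `Z` for these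
times.

The heart is an identity of inner products: `⟨z_s(g), z_{s'}(g')⟩` equals the covariance of `δ_s ⊗
g` and `δ_{s'} ⊗ g'` whenever `s ∈ {0, β/2}` and `s' ∈ [0, β/2]` (`inner_araki_eq_inner_sharpAt`).
The left side depends on `s+s'` through the kernel `(1+ρ)e^{-rε} + ρe^{rε}`, whose Fourier
coefficients on the circle are `(2ε/β)/(ω_n²+ε²)`. The right side depends on `s'-s`. They agree
because `0` and `β/2` are the fixed points of the reflection of the circle. Moreover the vectors
`z_0(g) + z_{β/2}(g')` have dense complex span in `Z` (`boundaryVector_total`), so a test function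
at times in `[0, β/2]` is seen from the boundary as a vector `z` of `Z` (`Represents`).

Second quantization turns this into operators. Put `c = i/√2`. The families `coh(c z)` and
`e^{q(f)/4} e^{iφ(f)}`, for `f` at the times `0` and `β/2`, have the same Gram matrix, which gives
an isometry `J` from Fock space onto the physical space. Its inverse is a `T` as required. The
adjoint satisfies `J* e^{iφ(f)} = e^{-q(f)/4} coh(c z)` for every `f` at times in `[0, β/2]`
(`projection_charLp`). Hence `J*` turns the translation `U_t` into `e^{-tL}`, as long as the times
stay in `[0, β/2]` (`expGraph_projection_translate`), and turns multiplication by `e^{iφ(j_0 g)}`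
into a Weyl operator.

An arbitrary `T` enters only through the Weyl relation. By density, `T G T⁻¹ J*F = J*(GF)` for all
bounded time-zero `G` and all bounded `F` of times in `[0, β/2]` (`transport_mulOp_projection`). The
vectors needed for the correlation are `v_j = J*(∏_{i>j} U_{t_i} G_i)`: translate back by `t_j`,
multiply by `G_j`, translate forward. That `e^{t_j L}` is unbounded does no harm, because its graph
is the inverse of the graph of `e^{-t_j L}`.

Two totality results make it enough to compute on exponentials: `mem_closure_span_of_unitary_system`
in `L²` of path space and `coherent_total` in Fock space. The measure is obtained from independent
Gaussian variables, corrected to have linear sample paths. -/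

theorem inner_linearCombination_of_gram {ι : Type*} {u : ι → E} {v : ι → F}
    (h : ∀ i j, inner 𝕜 (v i) (v j) = inner 𝕜 (u i) (u j)) (a b : ι →₀ 𝕜) :
    inner 𝕜 (Finsupp.linearCombination 𝕜 v a) (Finsupp.linearCombination 𝕜 v b) =
      inner 𝕜 (Finsupp.linearCombination 𝕜 u a) (Finsupp.linearCombination 𝕜 u b) := by
  simp only [Finsupp.linearCombination_apply, Finsupp.sum, sum_inner, inner_sum, inner_smul_left,
    inner_smul_right, h]

/-- Two families with the same Gram matrix, the first of them total, are related by an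
isometry. -/
theorem exists_linearIsometry_of_gram [CompleteSpace F] {ι : Type*} {u : ι → E} {v : ι → F}
    (hu : (Submodule.span 𝕜 (Set.range u)).topologicalClosure = ⊤)
    (h : ∀ i j, inner 𝕜 (v i) (v j) = inner 𝕜 (u i) (u j)) :
    ∃ J : E →ₗᵢ[𝕜] F, ∀ i, J (u i) = v i := by
  have hn : ∀ a : ι →₀ 𝕜, ‖Finsupp.linearCombination 𝕜 v a‖ =
      ‖Finsupp.linearCombination 𝕜 u a‖ := fun a => by
    rw [@norm_eq_sqrt_re_inner 𝕜, @norm_eq_sqrt_re_inner 𝕜, inner_linearCombination_of_gram h]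
  have hd : DenseRange (Finsupp.linearCombination 𝕜 u) := by
    rw [← Finsupp.range_linearCombination] at hu
    exact (Submodule.dense_iff_topologicalClosure_eq_top.mpr hu)
  let A : (ι →₀ 𝕜) →ₗ[𝕜] F := Finsupp.linearCombination 𝕜 v
  let B : (ι →₀ 𝕜) →ₗ[𝕜] E := Finsupp.linearCombination 𝕜 u
  have hb : ∃ C, ∀ a, ‖A a‖ ≤ C * ‖B a‖ := ⟨1, fun a => by rw [one_mul]; exact (hn a).le⟩
  -- The equality of norms makes `B a ↦ A a` well defined even if the family `u` is linearly
  -- dependent.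
  let J := A.extendOfNorm B
  have hJ : ∀ a, J (B a) = A a := fun a => LinearMap.extendOfNorm_eq hd hb a
  have hJn : ∀ x, ‖J x‖ = ‖x‖ := fun x =>
    hd.induction_on (p := fun x => ‖J x‖ = ‖x‖) x
      (isClosed_eq (by fun_prop) (by fun_prop)) fun a => by
        change ‖J (B a)‖ = ‖B a‖
        rw [hJ]; exact hn a
  refine ⟨⟨J.toLinearMap, hJn⟩, fun i => ?_⟩
  have := hJ (Finsupp.single i 1)
  simpa [A, B] using this

end Gram

/-! ### Multipliers of closed subspaces of `L²` -/

section Multipliers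

variable {α : Type*} [MeasurableSpace α] {ν : Measure α}

/-- Multiplication by `F` maps the subspace `V` of `L²` to itself. -/
def IsMultiplier (V : Submodule ℂ (Lp ℂ 2 ν)) (F : α → ℂ) : Prop :=
  ∀ τ ∈ V, ∃ χ ∈ V, (χ : α → ℂ) =ᵐ[ν] fun x => F x * τ x

variable {V : Submodule ℂ (Lp ℂ 2 ν)} {F G : α → ℂ}

theorem IsMultiplier.const (c : ℂ) : IsMultiplier V fun _ => c := fun τ hτ =>
  ⟨c • τ, V.smul_mem c hτ, Lp.coeFn_smul c τ⟩

theorem IsMultiplier.add (hF : IsMultiplier V F) (hG : IsMultiplier V G) :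
    IsMultiplier V fun x => F x + G x := by
  intro τ hτ
  obtain ⟨χ, hχ, h1⟩ := hF τ hτ
  obtain ⟨χ', hχ', h2⟩ := hG τ hτ
  refine ⟨χ + χ', V.add_mem hχ hχ', ?_⟩
  filter_upwards [h1, h2, Lp.coeFn_add χ χ'] with x e1 e2 e3
  rw [e3, Pi.add_apply, e1, e2, add_mul]

theorem IsMultiplier.mul (hF : IsMultiplier V F) (hG : IsMultiplier V G) :
    IsMultiplier V fun x => F x * G x := by
  intro τ hτ
  obtain ⟨χ, hχ, h1⟩ := hG τ hτ
  obtain ⟨χ', hχ', h2⟩ := hF χ hχ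
  refine ⟨χ', hχ', ?_⟩
  filter_upwards [h1, h2] with x e1 e2
  rw [e2, e1, mul_assoc]

theorem IsMultiplier.one_sub (hF : IsMultiplier V F) : IsMultiplier V fun x => 1 - F x := by
  have := (IsMultiplier.const (V := V) 1).add ((IsMultiplier.const (-1)).mul hF)
  convert this using 2
  ring

/-- Dominated convergence for the squared differences, with majorant `(2C)²‖τ‖²`. -/
theorem tendsto_Lp_two_of_dominated {χ : ℕ → Lp ℂ 2 ν} {χ₀ τ : Lp ℂ 2 ν} {C : ℝ}
    (hb : ∀ n, ∀ᵐ x ∂ν, ‖χ n x‖ ≤ C * ‖τ x‖)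
    (hl : ∀ᵐ x ∂ν, Tendsto (fun n => χ n x) atTop (𝓝 (χ₀ x))) :
    Tendsto χ atTop (𝓝 χ₀) := by
  rw [tendsto_iff_norm_sub_tendsto_zero]
  have key : Tendsto (fun n => ∫ x, ‖(χ n - χ₀ : Lp ℂ 2 ν) x‖ ^ 2 ∂ν) atTop (𝓝 (∫ _, (0 : ℝ) ∂ν)) := by
    have hτ := (memLp_two_iff_integrable_sq_norm (Lp.aestronglyMeasurable τ)).mp (Lp.memLp τ)
    refine tendsto_integral_of_dominated_convergence (fun x => (2 * C) ^ 2 * ‖τ x‖ ^ 2)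
      (fun n => (Lp.aestronglyMeasurable _).norm.pow 2) (hτ.const_mul _) (fun n => ?_) ?_
    · filter_upwards [Lp.coeFn_sub (χ n) χ₀, ae_all_iff.mpr hb, hl] with x h1 h2 h3
      have h4 : ‖χ₀ x‖ ≤ C * ‖τ x‖ := le_of_tendsto h3.norm (Eventually.of_forall h2)
      rw [h1, Pi.sub_apply, Real.norm_eq_abs, abs_of_nonneg (by positivity), ← mul_pow]
      refine pow_le_pow_left₀ (norm_nonneg _) ?_ 2
      calc ‖χ n x - χ₀ x‖ ≤ ‖χ n x‖ + ‖χ₀ x‖ := norm_sub_le _ _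
        _ ≤ 2 * C * ‖τ x‖ := by linarith [h2 n]
    · filter_upwards [ae_all_iff.mpr fun n => Lp.coeFn_sub (χ n) χ₀, hl] with x h1 h3
      simp only [h1, Pi.sub_apply]
      have := ((h3.sub_const (χ₀ x)).norm).pow 2
      simpa using this
  simp only [← norm_sq_Lp, integral_zero] at key
  have := key.sqrt
  simpa using this

/-- For fixed `τ ∈ V` the functions `Fn n * τ` lie in `V`, are dominated by `C‖τ‖` and converge
pointwise, so their limit is an `L²` limit and stays in the closed space `V`. -/
theorem IsMultiplier.of_tendsto (hV : IsClosed (V : Set (Lp ℂ 2 ν))) {Fn : ℕ → α → ℂ} {C : ℝ}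
    (hF : ∀ n, IsMultiplier V (Fn n)) (hb : ∀ n x, ‖Fn n x‖ ≤ C)
    (hl : ∀ x, Tendsto (fun n => Fn n x) atTop (𝓝 (F x))) : IsMultiplier V F := by
  intro τ hτ
  choose χ hχ h1 using fun n => hF n τ hτ
  have hFb : ∀ x, ‖F x‖ ≤ C := fun x =>
    le_of_tendsto (hl x).norm (Eventually.of_forall fun n => hb n x)
  have hm : AEStronglyMeasurable (fun x => F x * τ x) ν := by
    refine aestronglyMeasurable_of_tendsto_ae atTop
      (fun n => (Lp.aestronglyMeasurable (χ n))) ?_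
    filter_upwards [ae_all_iff.mpr h1] with x hx
    simp only [hx]
    exact (hl x).mul_const _
  have hL : MemLp (fun x => F x * τ x) 2 ν := by
    refine MemLp.of_le_mul (c := C) (Lp.memLp τ) hm (Eventually.of_forall fun x => ?_)
    rw [norm_mul]
    exact mul_le_mul_of_nonneg_right (hFb x) (norm_nonneg _)
  refine ⟨hL.toLp _, ?_, hL.coeFn_toLp⟩
  refine hV.mem_of_tendsto (tendsto_Lp_two_of_dominated (χ := χ) (τ := τ) (C := C) (fun n => ?_) ?_)
    (Eventually.of_forall hχ)
  · filter_upwards [h1 n] with x hx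
    rw [hx, norm_mul]
    exact mul_le_mul_of_nonneg_right (hb n x) (norm_nonneg _)
  · filter_upwards [ae_all_iff.mpr h1, hL.coeFn_toLp] with x hx h2
    simp only [hx, h2]
    exact (hl x).mul_const _

/-- A bounded `F` acts continuously on `L²`, so invariance of the closed span needs checking only on
the generators. -/
theorem isMultiplier_topologicalClosure_span {U : Set (Lp ℂ 2 ν)} {C : ℝ}
    (hm : AEStronglyMeasurable F ν) (hb : ∀ x, ‖F x‖ ≤ C)
    (h : ∀ τ ∈ U, ∃ χ ∈ Submodule.span ℂ U, (χ : α → ℂ) =ᵐ[ν] fun x => F x * τ x) :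
    IsMultiplier (Submodule.span ℂ U).topologicalClosure F := by
  have hF := memLp_top_of_bound hm C (Eventually.of_forall hb)
  let B : Lp ℂ 2 ν →L[ℂ] Lp ℂ 2 ν :=
    (ContinuousLinearMap.mul ℂ ℂ).holderL ν ∞ 2 2 (hF.toLp _)
  have hB : ∀ τ : Lp ℂ 2 ν, B τ =ᵐ[ν] fun x => F x * τ x := by
    intro τ
    filter_upwards [(ContinuousLinearMap.mul ℂ ℂ).coeFn_holder (r := 2) (hF.toLp _) τ,
      hF.coeFn_toLp] with x h1 h2
    refine h1.trans ?_
    rw [h2]; rfl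
  have hBU : ∀ τ ∈ Submodule.span ℂ U, B τ ∈ Submodule.span ℂ U := by
    intro τ hτ
    induction hτ using Submodule.span_induction with
    | mem τ hτ =>
      obtain ⟨χ, hχ, he⟩ := h τ hτ
      rwa [Lp.ext ((hB τ).trans he.symm)]
    | zero => rw [map_zero]; exact Submodule.zero_mem _
    | add a b _ _ ha hb => rw [map_add]; exact Submodule.add_mem _ ha hb
    | smul c a _ ha => rw [map_smul]; exact Submodule.smul_mem _ c ha
  exact fun τ hτ => ⟨B τ, map_mem_closure B.continuous hτ hBU, hB τ⟩

/-- The `σ`-algebra of the sets whose indicator functions are multipliers. -/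
@[reducible] def multiplierSpace (V : Submodule ℂ (Lp ℂ 2 ν)) (hV : IsClosed (V : Set (Lp ℂ 2 ν))) :
    MeasurableSpace α where
  MeasurableSet' A := IsMultiplier V (A.indicator fun _ => 1)
  measurableSet_empty := by
    have := IsMultiplier.const (V := V) 0
    convert this using 1
    exact Set.indicator_empty _
  measurableSet_compl A hA := by
    have := hA.one_sub
    convert this using 1
    funext x
    by_cases h : x ∈ A <;> simp [h]
  measurableSet_iUnion A hA := by
    -- The indicator of the union is the bounded pointwise limit of `1 - ∏_{i<n} (1 - 1_{A_i})`,
    -- which avoids making the sets disjoint.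
    have hp : ∀ n : ℕ, IsMultiplier V fun x =>
        ∏ i ∈ Finset.range n, (1 - (A i).indicator (fun _ => (1 : ℂ)) x) := by
      intro n
      induction n with
      | zero => simpa using IsMultiplier.const (V := V) 1
      | succ n ih => simpa only [Finset.prod_range_succ] using ih.mul (hA n).one_sub
    have hp1 : ∀ (n : ℕ) x, ‖∏ i ∈ Finset.range n, (1 - (A i).indicator (fun _ => (1 : ℂ)) x)‖ ≤ 1 := by
      intro n x
      rw [norm_prod]
      refine Finset.prod_le_one (fun _ _ => norm_nonneg _) fun i _ => ?_
      by_cases h : x ∈ A i <;> simp [h]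
    refine IsMultiplier.of_tendsto hV (C := 2) (fun n => (hp n).one_sub) (fun n x => ?_) fun x => ?_
    · refine (norm_sub_le _ _).trans ?_
      rw [norm_one]
      linarith [hp1 n x]
    · by_cases h : x ∈ ⋃ i, A i
      · obtain ⟨j, hj⟩ := Set.mem_iUnion.mp h
        refine tendsto_const_nhds.congr' ?_
        filter_upwards [eventually_gt_atTop j] with n hn
        rw [Finset.prod_eq_zero (Finset.mem_range.mpr hn) (by simp [hj])]
        simp [h]
      · refine tendsto_const_nhds.congr fun n => ?_
        have h' := h
        simp only [Set.mem_iUnion, not_exists] at h'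
        rw [Set.indicator_of_notMem h, Finset.prod_eq_one, sub_self]
        intro i _
        simp [h' i]

/-- The vector `1_A τ` is again in `V`, hence orthogonal to `ψ`. -/
theorem setIntegral_inner_eq_zero {hV : IsClosed (V : Set (Lp ℂ 2 ν))} {A : Set α}
    (hA : MeasurableSet[multiplierSpace V hV] A) (hA' : MeasurableSet A) {ψ τ : Lp ℂ 2 ν} (hψ : ψ ∈ Vᗮ)
    (hτ : τ ∈ V) : ∫ x in A, inner ℂ (τ x) (ψ x) ∂ν = 0 := by
  obtain ⟨χ, hχ, h⟩ := hA τ hτ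
  have h0 := hψ χ hχ
  rw [L2.inner_def] at h0
  rw [← integral_indicator hA', ← h0]
  refine integral_congr_ae ?_
  filter_upwards [h] with x hx
  rw [hx]
  by_cases h' : x ∈ A <;> simp [h']

/-- By Stone–Weierstrass on the circle, every continuous function of `e` is a uniform limit of
polynomials in `e` and its conjugate, hence a multiplier. Indicators of closed sets are bounded
pointwise limits of continuous functions, and closed sets generate the Borel sets. -/
theorem comap_le_multiplierSpace (hV : IsClosed (V : Set (Lp ℂ 2 ν))) {e : α → ℂ}
    (he : ∀ x, ‖e x‖ = 1) (h : IsMultiplier V e) (h' : IsMultiplier V fun x => conj (e x)) :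
    MeasurableSpace.comap e inferInstance ≤ multiplierSpace V hV := by
  have hs : ∀ x, e x ∈ Metric.sphere (0 : ℂ) 1 := fun x => by simpa using he x
  have : CompactSpace (Metric.sphere (0 : ℂ) 1) :=
    isCompact_iff_compactSpace.mp (isCompact_sphere 0 1)
  have hcont : ∀ f : C(Metric.sphere (0 : ℂ) 1, ℂ), IsMultiplier V fun x => f ⟨e x, hs x⟩ := by
    intro f
    induction f using ContinuousMap.induction_on_of_compact with
    | const r => exact IsMultiplier.const r
    | id => exact h
    | star_id => exact h'
    | add f g hf hg => exact hf.add hg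
    | mul f g hf hg => exact hf.mul hg
    | frequently f hf =>
      have hex : ∀ n : ℕ, ∃ g : C(Metric.sphere (0 : ℂ) 1, ℂ), dist g f < 1 / (n + 1 : ℝ) ∧
          IsMultiplier V fun x => g ⟨e x, hs x⟩ := fun n => by
        have := hf.and_eventually (Metric.ball_mem_nhds f (show (0 : ℝ) < 1 / (n + 1 : ℝ) by positivity))
        obtain ⟨g, hg, hg'⟩ := this.exists
        exact ⟨g, hg', hg⟩
      choose g hg hgm using hex
      have hgf : Tendsto g atTop (𝓝 f) := by
        rw [tendsto_iff_dist_tendsto_zero]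
        exact squeeze_zero (fun _ => dist_nonneg) (fun n => (hg n).le)
          tendsto_one_div_add_atTop_nhds_zero_nat
      obtain ⟨C, hC⟩ := hgf.norm.bddAbove_range
      refine IsMultiplier.of_tendsto hV (C := C) hgm (fun n x => ?_) fun x => ?_
      · exact ((g n).norm_coe_le_norm _).trans (hC ⟨n, rfl⟩)
      · exact ((continuous_eval_const _).tendsto f).comp hgf
  have hcl : ∀ C : Set ℂ, IsClosed C → MeasurableSet[multiplierSpace V hV] (e ⁻¹' C) := by
    intro C hC
    change IsMultiplier V _
    refine IsMultiplier.of_tendsto hV (C := 1)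
      (Fn := fun n x => ((hC.apprSeq n (e x) : ℝ≥0) : ℂ)) (fun n => ?_) (fun n x => ?_) fun x => ?_
    · exact hcont ⟨fun z => ((hC.apprSeq n z : ℝ≥0) : ℂ), by fun_prop⟩
    · have := HasOuterApproxClosed.apprSeq_apply_le_one hC n (e x)
      simpa using this
    · have := tendsto_pi_nhds.mp (HasOuterApproxClosed.tendsto_apprSeq hC) (e x)
      have h2 : Tendsto (fun n => ((hC.apprSeq n (e x) : ℝ≥0) : ℂ)) atTop
          (𝓝 ((C.indicator (fun _ => (1 : ℝ≥0)) (e x) : ℝ≥0) : ℂ)) :=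
        (Complex.continuous_ofReal.tendsto _).comp ((NNReal.continuous_coe.tendsto _).comp this)
      convert h2 using 2
      by_cases hx : e x ∈ C <;> simp [hx]
  have hm : @Measurable _ _ (multiplierSpace V hV) _ e :=
    @measurable_of_isClosed _ _ _ _ _ (multiplierSpace V hV) _ hcl
  exact hm.comap_le

end Multipliers

/-! ### Density of multiplicative unitary systems in `L²` -/

/-- The span of a multiplicative system of unitary functions is dense in the `L²`-space of the
`σ`-algebra that the system generates. -/
theorem mem_closure_span_of_unitary_system {α : Type*} {S m0 : MeasurableSpace α} {ν : Measure α}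
    [IsFiniteMeasure ν] {ι : Type*} {e : ι → α → ℂ}
    (hm : ∀ i, Measurable (e i)) (hn : ∀ i x, ‖e i x‖ = 1)
    (hmul : ∀ i j, ∃ k, ∀ x, e k x = e i x * e j x) (hconj : ∀ i, ∃ k, ∀ x, e k x = conj (e i x))
    (hone : ∃ k, ∀ x, e k x = 1) {ψ : Lp ℂ 2 ν}
    (hS : S = ⨆ i, MeasurableSpace.comap (e i) inferInstance) (hψ : AEStronglyMeasurable[S] ψ ν) :
    ψ ∈ (Submodule.span ℂ {f : Lp ℂ 2 ν | ∃ i, f =ᵐ[ν] e i}).topologicalClosure := by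
  set U : Submodule ℂ (Lp ℂ 2 ν) := Submodule.span ℂ {f : Lp ℂ 2 ν | ∃ i, f =ᵐ[ν] e i} with hU
  set V := U.topologicalClosure with hVdef
  have hV : IsClosed (V : Set (Lp ℂ 2 ν)) := U.isClosed_topologicalClosure
  have hSle : S ≤ m0 := hS ▸ iSup_le fun i => (hm i).comap_le
  have hL : ∀ i, MemLp (e i) 2 ν := fun i =>
    MemLp.of_bound (hm i).aestronglyMeasurable 1 (Eventually.of_forall fun x => (hn i x).le)
  have hmult : ∀ i, IsMultiplier V (e i) := by
    refine fun i => isMultiplier_topologicalClosure_span (hm i).aestronglyMeasurable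
      (fun x => (hn i x).le) ?_
    rintro τ ⟨j, hj⟩
    obtain ⟨k, hk⟩ := hmul i j
    refine ⟨(hL k).toLp _, Submodule.subset_span ⟨k, (hL k).coeFn_toLp⟩, ?_⟩
    filter_upwards [(hL k).coeFn_toLp, hj] with x h1 h2
    rw [h1, h2, hk]
  have hle : S ≤ multiplierSpace V hV := by
    refine hS ▸ iSup_le fun i => comap_le_multiplierSpace hV (hn i) (hmult i) ?_
    obtain ⟨k, hk⟩ := hconj i
    convert hmult k using 2
    exact (hk _).symm
  obtain ⟨k1, hk1⟩ := hone
  have h1V : (hL k1).toLp _ ∈ V := U.le_topologicalClosure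
    (Submodule.subset_span ⟨k1, (hL k1).coeFn_toLp⟩)
  have hUS : V ≤ lpMeas ℂ ℂ S 2 ν := by
    refine Submodule.topologicalClosure_minimal _ (Submodule.span_le.mpr ?_) ?_
    · rintro f ⟨i, hi⟩
      rw [SetLike.mem_coe, mem_lpMeas_iff_aestronglyMeasurable]
      have : Measurable[S] (e i) := (comap_measurable (e i)).mono
        (hS ▸ le_iSup (fun i => MeasurableSpace.comap (e i) inferInstance) i) le_rfl
      exact (this.stronglyMeasurable.aestronglyMeasurable).congr hi.symm
    · exact isClosed_aestronglyMeasurable hSle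
  have : V.HasOrthogonalProjection := by
    have : CompleteSpace V := hV.completeSpace_coe
    infer_instance
  -- The component `z` orthogonal to `V` is still `S`-measurable. Since `1 ∈ V` and indicators of
  -- sets of `S` are multipliers, `z` integrates to zero over each set of `S`, hence vanishes.
  obtain ⟨y, hy, z, hz, hyz⟩ := V.exists_add_mem_mem_orthogonal ψ
  have hzS : z ∈ lpMeas ℂ ℂ S 2 ν := by
    have hψ' : ψ ∈ lpMeas ℂ ℂ S 2 ν := mem_lpMeas_iff_aestronglyMeasurable.mpr hψ
    have : z = ψ - y := by rw [hyz]; abel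
    rw [this]
    exact Submodule.sub_mem _ hψ' (hUS hy)
  have hz0 : z =ᵐ[ν] (0 : α → ℂ) := by
    refine lpMeas.ae_eq_zero_of_forall_setIntegral_eq_zero (𝕜 := ℂ) hSle ⟨z, hzS⟩ (by simp) (by simp)
      (fun s _ _ => ((Lp.memLp z).integrable (by norm_num)).integrableOn) fun s hs _ => ?_
    have := setIntegral_inner_eq_zero (hle s hs) (hSle s hs) hz h1V
    rw [← this]
    refine integral_congr_ae (ae_restrict_of_ae ?_)
    filter_upwards [(hL k1).coeFn_toLp] with x hx
    rw [hx, hk1]; simp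
  have hz1 : z = 0 := Lp.eq_zero_iff_ae_eq_zero.mpr hz0
  rw [hyz, hz1, add_zero]
  exact hy

/-! ### Tensor products of `L²`-functions -/

section Tensor

variable {M : Type*} [MeasurableSpace M] {m : Measure M} [SigmaFinite m]

theorem memLp_tensor {n : ℕ} (v : Fin n → Lp ℂ 2 m) :
    MemLp (fun x : Fin n → M => ∏ i, v i (x i)) 2 (Measure.pi fun _ : Fin n => m) := by
  have hmeas : Measurable fun x : Fin n → M => ∏ i, v i (x i) :=
    Finset.measurable_prod _ fun i _ =>
      (Lp.stronglyMeasurable (v i)).measurable.comp (measurable_pi_apply i)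
  rw [memLp_two_iff_integrable_sq_norm hmeas.aestronglyMeasurable]
  have := Integrable.fintype_prod (ι := Fin n) (f := fun i y => ‖v i y‖ ^ 2)
    (μ := fun _ => m) fun i =>
      (memLp_two_iff_integrable_sq_norm (Lp.aestronglyMeasurable (v i))).mp (Lp.memLp (v i))
  simpa only [norm_prod, Finset.prod_pow] using this

/-- The function `v₁(x₁) ⋯ vₙ(xₙ)`. -/
def tensor {n : ℕ} (v : Fin n → Lp ℂ 2 m) : Lp ℂ 2 (Measure.pi fun _ : Fin n => m) :=
  (memLp_tensor v).toLp _

theorem coeFn_tensor {n : ℕ} (v : Fin n → Lp ℂ 2 m) :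
    tensor v =ᵐ[Measure.pi fun _ : Fin n => m] fun x => ∏ i, v i (x i) :=
  (memLp_tensor v).coeFn_toLp

theorem inner_tensor {n : ℕ} (v w : Fin n → Lp ℂ 2 m) :
    inner ℂ (tensor v) (tensor w) = ∏ i, inner ℂ (v i) (w i) := by
  simp only [L2.inner_def]
  rw [← integral_fintype_prod_eq_prod (𝕜 := ℂ) (fun i y => inner ℂ (v i y) (w i y))]
  refine integral_congr_ae ?_
  filter_upwards [coeFn_tensor v, coeFn_tensor w] with x h1 h2
  rw [h1, h2]
  simp only [RCLike.inner_apply, map_prod, Finset.prod_mul_distrib]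

theorem norm_tensor {n : ℕ} (v : Fin n → Lp ℂ 2 m) : ‖tensor v‖ = ∏ i, ‖v i‖ := by
  have h : ((‖tensor v‖ : ℂ)) ^ 2 = (((∏ i, ‖v i‖ : ℝ) : ℂ)) ^ 2 := by
    have := inner_tensor v v
    simp only [inner_self_eq_norm_sq_to_K] at this
    rw [Complex.ofReal_prod, ← Finset.prod_pow]
    exact this
  exact (pow_left_inj₀ (norm_nonneg _) (Finset.prod_nonneg fun _ _ => norm_nonneg _)
    two_ne_zero).mp (by exact_mod_cast h)

theorem coeFn_tensor_update {n : ℕ} (v : Fin n → Lp ℂ 2 m) (i : Fin n) (w : Lp ℂ 2 m) :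
    tensor (Function.update v i w) =ᵐ[Measure.pi fun _ : Fin n => m]
      fun x => w (x i) * ∏ j ∈ Finset.univ.erase i, v j (x j) := by
  filter_upwards [coeFn_tensor (Function.update v i w)] with x hx
  rw [hx, ← Finset.mul_prod_erase _ _ (Finset.mem_univ i), Function.update_self]
  congr 1
  exact Finset.prod_congr rfl fun j hj => by rw [Function.update_of_ne (Finset.ne_of_mem_erase hj)]

theorem ae_pi_eval {n : ℕ} (i : Fin n) {p : M → Prop} (h : ∀ᵐ y ∂m, p y) :
    ∀ᵐ x ∂(Measure.pi fun _ : Fin n => m), p (x i) :=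
  (Measure.quasiMeasurePreserving_eval (fun _ : Fin n => m) i).ae h

/-- The tensor product as a continuous multilinear map. -/
def tensorL (m : Measure M) [SigmaFinite m] (n : ℕ) :
    ContinuousMultilinearMap ℂ (fun _ : Fin n => Lp ℂ 2 m)
      (Lp ℂ 2 (Measure.pi fun _ : Fin n => m)) :=
  MultilinearMap.mkContinuous
    { toFun := tensor
      map_update_add' := by
        intro inst v i a b
        have e : inst = instDecidableEqFin n := Subsingleton.elim _ _
        subst e
        apply Lp.ext
        filter_upwards [coeFn_tensor_update v i (a + b), coeFn_tensor_update v i a,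
          coeFn_tensor_update v i b, Lp.coeFn_add (tensor (Function.update v i a))
            (tensor (Function.update v i b)), ae_pi_eval i (Lp.coeFn_add a b)] with x h1 h2 h3 h4 h5
        rw [h1, h4, Pi.add_apply, h2, h3, h5, Pi.add_apply, add_mul]
      map_update_smul' := by
        intro inst v i c a
        have e : inst = instDecidableEqFin n := Subsingleton.elim _ _
        subst e
        apply Lp.ext
        filter_upwards [coeFn_tensor_update v i (c • a), coeFn_tensor_update v i a,
          Lp.coeFn_smul c (tensor (Function.update v i a)), ae_pi_eval i (Lp.coeFn_smul c a)]
          with x h1 h2 h4 h5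
        rw [h1, h4, Pi.smul_apply, h2, h5, Pi.smul_apply, smul_mul_assoc] } 1
    fun v => by rw [one_mul]; exact (norm_tensor v).le

theorem tensorL_apply {n : ℕ} (v : Fin n → Lp ℂ 2 m) : tensorL m n v = tensor v := rfl

/-- The tensor products are total. -/
theorem eq_zero_of_inner_tensor_eq_zero {n : ℕ} {ψ : Lp ℂ 2 (Measure.pi fun _ : Fin n => m)}
    (h : ∀ v : Fin n → Lp ℂ 2 m, inner ℂ (tensor v) ψ = 0) : ψ = 0 := by
  set U : Set (Lp ℂ 2 (Measure.pi fun _ : Fin n => m)) := Set.range tensor with hU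
  set V := (Submodule.span ℂ U).topologicalClosure with hV
  have hVc : IsClosed (V : Set (Lp ℂ 2 (Measure.pi fun _ : Fin n => m))) :=
    (Submodule.span ℂ U).isClosed_topologicalClosure
  have hψ : ψ ∈ Vᗮ := by
    rw [hV, Submodule.orthogonal_closure, Submodule.mem_orthogonal]
    intro u hu
    induction hu using Submodule.span_induction with
    | mem u hu => obtain ⟨v, rfl⟩ := hu; exact h v
    | zero => exact inner_zero_left _
    | add a b _ _ ha hb => rw [inner_add_left, ha, hb, add_zero]
    | smul c a _ ha => rw [inner_smul_left, ha, mul_zero]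
  -- The indicator of a condition on the `i`-th coordinate can be absorbed into the `i`-th factor of
  -- a product function, so it preserves the span.
  have hle : (MeasurableSpace.pi : MeasurableSpace (Fin n → M)) ≤ multiplierSpace V hVc := by
    refine iSup_le fun i => ?_
    rintro _ ⟨B, hB, rfl⟩
    have hBm : MeasurableSet ((fun x : Fin n → M => x i) ⁻¹' B) := measurable_pi_apply i hB
    refine isMultiplier_topologicalClosure_span (C := 1)
      (measurable_const.indicator hBm).aestronglyMeasurable (fun x => ?_) ?_
    · refine (norm_indicator_le_norm_self _ _).trans (by simp)
    · rintro _ ⟨v, rfl⟩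
      have hw : MemLp (B.indicator (v i)) 2 m := (Lp.memLp (v i)).indicator hB
      refine ⟨tensor (Function.update v i (hw.toLp _)), Submodule.subset_span ⟨_, rfl⟩, ?_⟩
      filter_upwards [coeFn_tensor_update v i (hw.toLp _), coeFn_tensor v,
        ae_pi_eval i hw.coeFn_toLp] with x h1 h2 h3
      rw [h1, h2, h3, ← Finset.mul_prod_erase _ _ (Finset.mem_univ i)]
      by_cases hx : x i ∈ B <;> simp [hx]
  -- Pairing with the tensor power of the indicator of a set of finite measure shows that `ψ` has
  -- zero integral over all measurable parts of a cube, so `ψ` vanishes there. These cubes exhaust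
  -- `M^n`.
  have hk : ∀ k : ℕ, ∀ᵐ x ∂(Measure.pi fun _ : Fin n => m),
      (∀ i, x i ∈ spanningSets m k) → ψ x = 0 := by
    intro k
    let w : Lp ℂ 2 m := indicatorConstLp 2 (measurableSet_spanningSets m k)
      (measure_spanningSets_lt_top m k).ne 1
    have hτ : tensor (fun _ : Fin n => w) ∈ V :=
      Submodule.le_topologicalClosure _ (Submodule.subset_span ⟨_, rfl⟩)
    have hz := (L2.integrable_inner (tensor fun _ : Fin n => w) ψ).ae_eq_zero_of_forall_setIntegral_eq_zero
      fun A hA _ => setIntegral_inner_eq_zero (hle A hA) hA hψ hτ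
    have hw : ∀ i : Fin n, ∀ᵐ x ∂(Measure.pi fun _ : Fin n => m),
        w (x i) = (spanningSets m k).indicator (fun _ => 1) (x i) := fun i =>
      ae_pi_eval i indicatorConstLp_coeFn
    filter_upwards [hz, coeFn_tensor (fun _ : Fin n => w), ae_all_iff.mpr hw] with x h1 h2 h3 h4
    rw [h2] at h1
    simpa [h3, h4] using h1
  refine Lp.eq_zero_iff_ae_eq_zero.mpr ?_
  filter_upwards [ae_all_iff.mpr hk] with x hx
  refine hx (Finset.univ.sup fun i => spanningSetsIndex m (x i)) fun i => ?_
  exact monotone_spanningSets m (Finset.le_sup (Finset.mem_univ i)) (mem_spanningSetsIndex m (x i))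

end Tensor

/-! ### Coherent vectors -/

section Coherent

variable {M : Type*} [MeasurableSpace M] {m : Measure M} [SigmaFinite m]

theorem coe_coherentComponent (h : Lp ℂ 2 m) (n : ℕ) :
    (coherentComponent h n : Lp ℂ 2 (Measure.pi fun _ : Fin n => m)) =
      ((Real.sqrt n.factorial)⁻¹ : ℂ) • tensor fun _ => h := by
  apply Lp.ext
  filter_upwards [(memLp_prod h n).coeFn_toLp, coeFn_tensor (fun _ : Fin n => h),
    Lp.coeFn_smul ((Real.sqrt n.factorial)⁻¹ : ℂ) (tensor fun _ : Fin n => h)] with x h1 h2 h3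
  rw [h3, Pi.smul_apply, h2]
  exact h1

theorem inner_coherentComponent (g h : Lp ℂ 2 m) (n : ℕ) :
    inner ℂ (coherentComponent g n) (coherentComponent h n) =
      (n.factorial : ℂ)⁻¹ * inner ℂ g h ^ n := by
  rw [Submodule.coe_inner, coe_coherentComponent, coe_coherentComponent, inner_smul_left,
    inner_smul_right, inner_tensor, Finset.prod_const, Finset.card_univ, Fintype.card_fin,
    ← mul_assoc]
  congr 1
  rw [map_inv₀, Complex.conj_ofReal, ← mul_inv, ← Complex.ofReal_mul,
    Real.mul_self_sqrt (by positivity), Complex.ofReal_natCast]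

theorem inner_coherent (g h : Lp ℂ 2 m) :
    inner ℂ (coherent g) (coherent h) = Complex.exp (inner ℂ g h) := by
  have h1 := lp.hasSum_inner (𝕜 := ℂ) (coherent g) (coherent h)
  have h2 := NormedSpace.exp_series_hasSum_exp' (𝕂 := ℂ) (inner ℂ g h : ℂ)
  rw [← Complex.exp_eq_exp_ℂ] at h2
  refine HasSum.unique h1 (h2.congr_fun fun n => ?_)
  exact inner_coherentComponent g h n

/-- The symmetric functions are the common fixed points of the permutation isometries. Closedness
makes Fock space complete, as needed to extend isometries into it and to take adjoints. -/
theorem isClosed_symL2 (n : ℕ) : IsClosed (symL2 m n : Set (Lp ℂ 2 (Measure.pi fun _ : Fin n => m))) := by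
  have : (symL2 m n : Set (Lp ℂ 2 (Measure.pi fun _ : Fin n => m))) = ⋂ σ : Equiv.Perm (Fin n),
      {ψ | Lp.compMeasurePreserving _ (measurePreserving_perm m σ) ψ = ψ} := by
    ext ψ
    simp only [Set.mem_iInter, Set.mem_ofPred_eq]
    refine forall_congr' fun σ => ?_
    rw [Lp.ext_iff]
    have h := Lp.coeFn_compMeasurePreserving ψ (measurePreserving_perm m σ)
    exact ⟨fun h' => h.trans h', fun h' => h.symm.trans h'⟩
  rw [this]
  refine isClosed_iInter fun σ => isClosed_eq ?_ continuous_id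
  exact (Lp.isometry_compMeasurePreserving (measurePreserving_perm m σ)).continuous

instance (n : ℕ) : CompleteSpace (symL2 m n) := (isClosed_symL2 n).completeSpace_coe

/-- Uniqueness of power series in a real variable. Real scalings are all that a real subspace
allows. -/
theorem eq_zero_of_hasSum_pow_eq_zero {a : ℕ → ℂ}
    (h : ∀ t : ℝ, HasSum (fun n => (t : ℂ) ^ n * a n) 0) (n : ℕ) : a n = 0 := by
  let p : FormalMultilinearSeries ℝ ℝ ℂ := fun n => ContinuousMultilinearMap.mkPiRing ℝ (Fin n) (a n)
  have hp : ∀ n, p.coeff n = a n := fun n => by simp [p, FormalMultilinearSeries.coeff]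
  have h0 : HasFPowerSeriesAt (fun _ : ℝ => (0 : ℂ)) p 0 := by
    rw [hasFPowerSeriesAt_iff]
    refine Eventually.of_forall fun z => ?_
    refine (h z).congr_fun fun n => ?_
    rw [hp, Complex.real_smul, Complex.ofReal_pow]
  rw [← hp, HasFPowerSeriesAt.eq_zero h0]
  rfl

theorem coherentComponent_smul (c : ℂ) (h : Lp ℂ 2 m) (n : ℕ) :
    coherentComponent (c • h) n = c ^ n • coherentComponent h n := by
  apply Subtype.ext
  rw [Submodule.coe_smul, coe_coherentComponent, coe_coherentComponent, smul_comm (c ^ n)]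
  congr 1
  have := (tensorL m n).map_smul_univ (fun _ => c) fun _ => h
  simpa [tensorL_apply] using this

/-- The coherent vectors of a real subspace whose complex span is dense are total. -/
theorem coherent_total {K : Submodule ℝ (Lp ℂ 2 m)}
    (hK : (Submodule.span ℂ (K : Set (Lp ℂ 2 m))).topologicalClosure = ⊤) :
    (Submodule.span ℂ (coherent '' (K : Set (Lp ℂ 2 m)))).topologicalClosure = ⊤ := by
  rw [Submodule.topologicalClosure_eq_top_iff, Submodule.eq_bot_iff]
  intro ψ hψ
  have h0 : ∀ h ∈ K, inner ℂ ψ (coherent h) = 0 := fun h hh =>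
    inner_eq_zero_symm.mp (hψ _ (Submodule.subset_span ⟨h, hh, rfl⟩))
  apply lp.ext
  funext n
  apply Subtype.ext
  set ψn : Lp ℂ 2 (Measure.pi fun _ : Fin n => m) :=
    (show symL2 m n from ψ n) with hψn
  -- Replacing `h` by `t h` weights the `n`-particle term by `t^n`, so the terms can be separated by
  -- particle number.
  have h1 : ∀ h ∈ K, inner ℂ ψn (tensor fun _ => h) = 0 := by
    intro h hh
    have h2 : ∀ t : ℝ, HasSum (fun n => (t : ℂ) ^ n * inner ℂ (ψ n) (coherentComponent h n)) 0 := by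
      intro t
      have h3 := lp.hasSum_inner (𝕜 := ℂ) ψ (coherent ((t : ℂ) • h))
      rw [h0 _ (by
        have e : (t : ℂ) • h = t • h := algebraMap_smul ℂ t h
        rw [e]; exact K.smul_mem t hh)] at h3
      refine h3.congr_fun fun n => ?_
      change (t : ℂ) ^ n * inner ℂ (show symL2 m n from ψ n) (coherentComponent h n) =
        inner ℂ (show symL2 m n from ψ n) (coherentComponent ((t : ℂ) • h) n)
      rw [coherentComponent_smul]
      exact (inner_smul_right (𝕜 := ℂ) (E := symL2 m n) _ _ _).symm
    have h4 := eq_zero_of_hasSum_pow_eq_zero h2 n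
    rw [Submodule.coe_inner, coe_coherentComponent, inner_smul_right] at h4
    refine (mul_eq_zero.mp h4).resolve_left (inv_ne_zero ?_)
    exact_mod_cast (Real.sqrt_pos.mpr (by positivity)).ne'
  have hperm : ∀ (v : Fin n → Lp ℂ 2 m) (σ : Equiv.Perm (Fin n)),
      inner ℂ ψn (tensor fun i => v (σ i)) = inner ℂ ψn (tensor v) := by
    intro v σ
    simp only [L2.inner_def]
    have hσ := measurePreserving_perm m σ
    have hemb : MeasurableEmbedding fun (x : Fin n → M) i => x (σ i) := by
      convert (MeasurableEquiv.piCongrLeft (fun _ : Fin n => M) σ.symm).measurableEmbedding using 1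
      funext x i
      have := MeasurableEquiv.piCongrLeft_apply_apply (β := fun _ : Fin n => M) (e := σ.symm) x (σ i)
      simpa using this.symm
    rw [← hσ.integral_comp hemb]
    refine integral_congr_ae ?_
    filter_upwards [(ψ n).2 σ, coeFn_tensor v,
      hσ.quasiMeasurePreserving.ae (coeFn_tensor fun i => v (σ i))] with x h2 h3 h4
    have h2' : ψn (fun i => x (σ i)) = ψn x := h2
    rw [h2', h3, h4, Equiv.prod_comp σ fun i => v i (x i)]
  -- Polarization: the `n`-th derivative of the vanishing diagonal map `h ↦ ⟨ψ_n, h^{⊗n}⟩` is a sum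
  -- over permutations, and by symmetry of `ψ_n` all `n!` terms are equal.
  have h5 : ∀ v : Fin n → Lp ℂ 2 m, (∀ i, v i ∈ K) → inner ℂ ψn (tensor v) = 0 := by
    intro v hv
    let f : ContinuousMultilinearMap ℝ (fun _ : Fin n => K) ℂ :=
      (((innerSL ℂ ψn).compContinuousMultilinearMap (tensorL m n)).restrictScalars ℝ).compContinuousLinearMap
        fun _ => K.subtypeL
    have hf : ∀ w : Fin n → K, f w = inner ℂ ψn (tensor fun i => (w i : Lp ℂ 2 m)) := fun _ => rfl
    have hd : (fun x : K => f fun _ => x) = 0 := by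
      funext x
      rw [hf]; exact h1 x x.2
    have h6 := f.iteratedFDeriv_comp_diagonal 0 fun i => ⟨v i, hv i⟩
    rw [hd] at h6
    simp only [hf, hperm] at h6
    have h7 : ((n.factorial : ℕ) : ℂ) * inner ℂ ψn (tensor v) = 0 := by
      rw [Finset.sum_const, Finset.card_univ, Fintype.card_perm, Fintype.card_fin, nsmul_eq_mul] at h6
      rw [← h6]
      simp
    exact (mul_eq_zero.mp h7).resolve_left (by exact_mod_cast n.factorial_ne_zero)
  -- The set `s` collects the slots whose arguments are no longer confined to `K`. A slot is
  -- released by continuity and complex linearity in it, since the complex span of `K` is dense.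
  have h8 : ∀ s : Finset (Fin n), ∀ v : Fin n → Lp ℂ 2 m, (∀ i ∉ s, v i ∈ K) →
      inner ℂ ψn (tensor v) = 0 := by
    intro s
    induction s using Finset.induction_on with
    | empty => exact fun v hv => h5 v fun i => hv i (by simp)
    | insert i s _ ih =>
      intro v hv
      let g : Lp ℂ 2 m →L[ℂ] ℂ := (innerSL ℂ ψn).comp ((tensorL m n).toContinuousLinearMap v i)
      have hg : ∀ w, g w = inner ℂ ψn (tensor (Function.update v i w)) := fun _ => rfl
      have hle : (Submodule.span ℂ (K : Set (Lp ℂ 2 m))).topologicalClosure ≤ LinearMap.ker g.toLinearMap := by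
        refine Submodule.topologicalClosure_minimal _ (Submodule.span_le.mpr fun w hw => ?_)
          g.isClosed_ker
        change g w = 0
        rw [hg]
        refine ih _ fun j hj => ?_
        by_cases hji : j = i
        · subst hji; simpa using hw
        · rw [Function.update_of_ne hji]
          exact hv j (by simp [hji, hj])
      have : g (v i) = 0 := hle (hK ▸ Submodule.mem_top)
      rwa [hg, Function.update_eq_self] at this
  exact eq_zero_of_inner_tensor_eq_zero fun v =>
    inner_eq_zero_symm.mp (h8 Finset.univ v fun i hi => absurd (Finset.mem_univ i) hi)

theorem coherent_total_univ :
    (Submodule.span ℂ (Set.range (coherent : Lp ℂ 2 m → Fock m))).topologicalClosure = ⊤ := by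
  have := coherent_total (m := m) (K := ⊤) (by
    rw [Submodule.top_coe, Submodule.span_univ]
    exact top_le_iff.mp (Submodule.le_topologicalClosure _))
  simpa using this

/-- Weyl operators exist. -/
theorem exists_isWeylOperator (f : Lp ℂ 2 m) : ∃ W : Fock m →L[ℂ] Fock m, IsWeylOperator f W := by
  -- The prescribed images have the Gram matrix of the coherent vectors: the two factors
  -- `e^{-‖f‖²/4}` cancel the `‖f‖²/2` created by the displacement, and the cross terms cancel
  -- because `i/√2` is purely imaginary.
  obtain ⟨J, hJ⟩ := exists_linearIsometry_of_gram (u := (coherent : Lp ℂ 2 m → Fock m))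
    (v := fun h => Complex.exp (-(‖f‖ ^ 2 : ℝ) / 4 + Complex.I / (Real.sqrt 2 : ℝ) * inner ℂ f h) •
      coherent (h + (Complex.I / (Real.sqrt 2 : ℝ)) • f)) coherent_total_univ fun g h => by
    have h2 : (Real.sqrt 2 : ℂ) ^ 2 = 2 := by
      rw [← Complex.ofReal_pow, Real.sq_sqrt (by norm_num)]; norm_num
    have h0 : (Real.sqrt 2 : ℂ) ≠ 0 := fun h => by rw [h] at h2; norm_num at h2
    rw [inner_smul_left, inner_smul_right, inner_coherent, inner_coherent, ← Complex.exp_conj,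
      ← Complex.exp_add, ← Complex.exp_add]
    congr 1
    simp only [inner_add_left, inner_add_right, inner_smul_left, inner_smul_right, map_add, map_mul,
      map_div₀, map_neg, Complex.conj_I, Complex.conj_ofReal, inner_self_eq_norm_sq_to_K,
      inner_conj_symm, Complex.ofReal_pow, Complex.coe_algebraMap]
    have h4 : (starRingEnd ℂ) (4 : ℂ) = 4 := Complex.conj_ofNat 4
    simp only [map_pow, Complex.conj_ofReal, h4]
    field_simp
    rw [h2]
    ring_nf
    simp only [Complex.I_sq, h2]
    ring
  exact ⟨J.toContinuousLinearMap, hJ⟩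

theorem clm_ext_of_total {E F : Type*} [NormedAddCommGroup E] [NormedSpace ℂ E]
    [NormedAddCommGroup F] [NormedSpace ℂ F] {U : Set E}
    (hU : (Submodule.span ℂ U).topologicalClosure = ⊤) {A B : E →L[ℂ] F} (h : ∀ u ∈ U, A u = B u) :
    A = B := by
  ext x
  have hle : (Submodule.span ℂ U).topologicalClosure ≤ LinearMap.eqLocus A.toLinearMap B.toLinearMap :=
    Submodule.topologicalClosure_minimal _ (Submodule.span_le.mpr h)
      (isClosed_eq A.continuous B.continuous)
  exact hle (hU ▸ Submodule.mem_top)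

end Coherent

/-! ### The graph of `e^{-tL}` -/

section ExpGraph

/-- The graph of multiplication by a function is closed. -/
theorem isClosed_setOf_ae_eq_mul {α : Type*} [MeasurableSpace α] {ν : Measure α} (w : α → ℂ) :
    IsClosed {p : Lp ℂ 2 ν × Lp ℂ 2 ν | (p.2 : α → ℂ) =ᵐ[ν] fun x => w x * p.1 x} := by
  refine IsSeqClosed.isClosed fun p q hp hpq => ?_
  have h1 : Tendsto (fun k => (p k).1) atTop (𝓝 q.1) := (continuous_fst.tendsto q).comp hpq
  have h2 : Tendsto (fun k => (p k).2) atTop (𝓝 q.2) := (continuous_snd.tendsto q).comp hpq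
  -- Along a common subsequence both components converge almost everywhere. The relation then passes
  -- to the limit pointwise, whatever `w` is.
  obtain ⟨r, hr, hr'⟩ := (tendstoInMeasure_of_tendsto_Lp h1).exists_seq_tendsto_ae
  have h3 := h2.comp hr.tendsto_atTop
  obtain ⟨r', hr1, hr1'⟩ := (tendstoInMeasure_of_tendsto_Lp h3).exists_seq_tendsto_ae
  filter_upwards [hr', hr1', ae_all_iff.mpr hp] with x e1 e2 e3
  refine tendsto_nhds_unique e2 ?_
  simp only [Function.comp_apply, e3]
  exact ((e1.comp hr1.tendsto_atTop).const_mul (w x))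

variable {M : Type*} [MeasurableSpace M] {m : Measure M} [SigmaFinite m] {e : M → ℝ} {t : ℝ}

/-- Domain statements for `e^{tL}` are obtained from this inversion alone, by exhibiting a vector as
a value of `e^{-tL}`. -/
theorem ExpGraph.neg {ψ χ : Fock m} (h : ExpGraph e t ψ χ) : ExpGraph e (-t) χ ψ := by
  intro n
  filter_upwards [h n] with x hx
  rw [hx, ← mul_assoc, ← Complex.ofReal_mul, ← Real.exp_add]
  simp

/-- The graph of `e^{-tL}` as a subspace. -/
def expGraphSubmodule (m : Measure M) [SigmaFinite m] (e : M → ℝ) (t : ℝ) :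
    Submodule ℂ (Fock m × Fock m) where
  carrier := {p | ExpGraph e t p.1 p.2}
  zero_mem' := by
    intro n
    filter_upwards [Lp.coeFn_zero ℂ 2 (Measure.pi fun _ : Fin n => m)] with x hx
    change ((0 : Lp ℂ 2 (Measure.pi fun _ : Fin n => m)) : (Fin n → M) → ℂ) x =
      _ * ((0 : Lp ℂ 2 (Measure.pi fun _ : Fin n => m)) : (Fin n → M) → ℂ) x
    rw [hx, Pi.zero_apply, mul_zero]
  add_mem' := by
    intro p q hp hq n
    filter_upwards [hp n, hq n, Lp.coeFn_add (p.1 n : Lp ℂ 2 (Measure.pi fun _ : Fin n => m)) (q.1 n),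
      Lp.coeFn_add (p.2 n : Lp ℂ 2 (Measure.pi fun _ : Fin n => m)) (q.2 n)] with x h1 h2 h3 h4
    simp only [Prod.fst_add, Prod.snd_add, lp.coeFn_add, Pi.add_apply, Submodule.coe_add, h3, h4,
      h1, h2]
    ring
  smul_mem' := by
    intro c p hp n
    filter_upwards [hp n, Lp.coeFn_smul c (p.1 n : Lp ℂ 2 (Measure.pi fun _ : Fin n => m)),
      Lp.coeFn_smul c (p.2 n : Lp ℂ 2 (Measure.pi fun _ : Fin n => m))] with x h1 h3 h4
    simp only [Prod.smul_fst, Prod.smul_snd, lp.coeFn_smul, Pi.smul_apply, Submodule.coe_smul, h3,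
      h4, h1, smul_eq_mul]
    ring

theorem isClosed_expGraphSubmodule :
    IsClosed (expGraphSubmodule m e t : Set (Fock m × Fock m)) := by
  have : (expGraphSubmodule m e t : Set (Fock m × Fock m)) = ⋂ n : ℕ,
      (fun p : Fock m × Fock m => ((p.1 n : Lp ℂ 2 (Measure.pi fun _ : Fin n => m)),
        (p.2 n : Lp ℂ 2 (Measure.pi fun _ : Fin n => m)))) ⁻¹'
      {p | (p.2 : (Fin n → M) → ℂ) =ᵐ[Measure.pi fun _ : Fin n => m]
        fun x => (Real.exp (-(t * ∑ i, e (x i))) : ℂ) * p.1 x} := by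
    ext p
    simp only [Set.mem_iInter]
    rfl
  rw [this]
  refine isClosed_iInter fun n => (isClosed_setOf_ae_eq_mul _).preimage ?_
  have hc : Continuous fun ψ : Fock m => ψ n :=
    (lp.evalCLM ℂ (fun n : ℕ => symL2 m n) 2 n).continuous
  exact (continuous_subtype_val.comp (hc.comp continuous_fst)).prodMk
    (continuous_subtype_val.comp (hc.comp continuous_snd))

/-- The exponential of a sum over particles is a product of one-particle exponentials. That `z'`
lies in `L²` is the only domain condition, even if `e` takes both signs. -/
theorem expGraph_coherent {z z' : Lp ℂ 2 m} (h : ∀ᵐ y ∂m, z' y = (Real.exp (-(t * e y)) : ℂ) * z y) :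
    ExpGraph e t (coherent z) (coherent z') := by
  intro n
  have hall : ∀ i : Fin n, ∀ᵐ x ∂(Measure.pi fun _ : Fin n => m),
      z' (x i) = (Real.exp (-(t * e (x i))) : ℂ) * z (x i) := fun i => ae_pi_eval i h
  filter_upwards [(memLp_prod z n).coeFn_toLp, (memLp_prod z' n).coeFn_toLp, ae_all_iff.mpr hall]
    with x h1 h2 h3
  refine h2.trans ?_
  refine Eq.trans ?_ (congrArg _ h1.symm)
  simp only [h3, Finset.prod_mul_distrib]
  rw [← Complex.ofReal_prod, ← Real.exp_sum, Finset.sum_neg_distrib, ← Finset.mul_sum]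
  ring

end ExpGraph

/-! ### Existence of Gaussian processes with given covariance -/

section Isonormal

open ProbabilityTheory

/-- The law of independent standard Gaussian variables. -/
abbrev whiteNoise (ι : Type*) : Measure (ι → ℝ) := Measure.infinitePi fun _ : ι => gaussianReal 0 1

theorem memLp_coord {ι : Type*} (i : ι) : MemLp (fun x : ι → ℝ => x i) 2 (whiteNoise ι) :=
  (memLp_id_gaussianReal' 2 (by simp)).comp_measurePreserving
    (measurePreserving_eval_infinitePi (fun _ : ι => gaussianReal 0 1) i)

theorem orthonormal_coord (ι : Type*) :
    Orthonormal ℝ fun i : ι => (memLp_coord i).toLp (fun x : ι → ℝ => x i) := by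
  classical
  rw [orthonormal_iff_ite]
  intro i j
  have h1 : inner ℝ ((memLp_coord i).toLp (fun x : ι → ℝ => x i))
      ((memLp_coord j).toLp (fun x : ι → ℝ => x j)) = ∫ x, x i * x j ∂(whiteNoise ι) := by
    rw [L2.inner_def]
    refine integral_congr_ae ?_
    filter_upwards [(memLp_coord i).coeFn_toLp, (memLp_coord j).coeFn_toLp] with x h1 h2
    rw [h1, h2]
    simp [mul_comm]
  have h0 : ∀ k : ι, ∫ x, x k ∂(whiteNoise ι) = 0 := fun k => by
    have := integral_map (μ := whiteNoise ι) (φ := fun x => x k) (f := fun y : ℝ => y)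
      (measurable_pi_apply k).aemeasurable (by fun_prop)
    rw [← this, Measure.infinitePi_map_eval]
    exact integral_id_gaussianReal
  rw [h1]
  split_ifs with hij
  · subst hij
    have h2 := integral_map (μ := whiteNoise ι) (φ := fun x => x i) (f := fun y : ℝ => y * y)
      (measurable_pi_apply i).aemeasurable (by fun_prop)
    rw [← h2, Measure.infinitePi_map_eval]
    have h3 := variance_fun_id_gaussianReal (μ := 0) (v := 1)
    rw [variance_eq_integral measurable_id'.aemeasurable, integral_id_gaussianReal] at h3
    simpa [sq] using h3
  · have hind := (iIndepFun_infinitePi (P := fun _ : ι => gaussianReal 0 1)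
      (X := fun _ x => x) (fun _ => measurable_id)).indepFun hij
    have := hind.integral_fun_mul_eq_mul_integral (measurable_pi_apply i).aestronglyMeasurable
      (measurable_pi_apply j).aestronglyMeasurable
    rw [this, h0, zero_mul]

theorem integral_exp_sum_coord {ι : Type*} (s : Finset ι) (a : ι → ℝ) :
    ∫ x, Complex.exp (Complex.I * (∑ i ∈ s, a i * x i : ℝ)) ∂(whiteNoise ι) =
      Complex.exp (-(∑ i ∈ s, a i ^ 2 : ℝ) / 2) := by
  have h1 := integral_restrict_infinitePi (μ := fun _ : ι => gaussianReal 0 1) (s := s)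
    (f := fun y : s → ℝ => ∏ i : s, Complex.exp (a i * y i * Complex.I))
    (Continuous.aestronglyMeasurable (by fun_prop))
  have h2 := integral_fintype_prod_eq_prod (𝕜 := ℂ) (μ := fun _ : s => gaussianReal 0 1)
    (fun (i : s) (y : ℝ) => Complex.exp (a i * y * Complex.I))
  have h3 : ∀ t : ℝ, ∫ y : ℝ, Complex.exp (t * y * Complex.I) ∂(gaussianReal 0 1) =
      Complex.exp (-(t ^ 2 : ℝ) / 2) := fun t => by
    rw [← charFun_apply_real, charFun_gaussianReal]
    congr 1
    push_cast
    ring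
  rw [h2] at h1
  simp only [h3] at h1
  rw [← Complex.exp_sum, Finset.sum_coe_sort s fun i => -(((a i) ^ 2 : ℝ) : ℂ) / 2] at h1
  convert h1 using 1
  · refine integral_congr_ae (Eventually.of_forall fun x => ?_)
    simp only [← Complex.exp_sum]
    congr 1
    have := Finset.sum_coe_sort s fun i => ((a i : ℂ) * x i * Complex.I)
    simp only [Finset.restrict]
    rw [this, Complex.ofReal_sum, Finset.mul_sum]
    refine Finset.sum_congr rfl fun i _ => ?_
    push_cast; ring
  · congr 1
    rw [← Finset.sum_div, Finset.sum_neg_distrib, Complex.ofReal_sum]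

/-- The isonormal Gaussian process of a real Hilbert space. -/
theorem exists_isonormal (H : Type*) [NormedAddCommGroup H] [InnerProductSpace ℝ H]
    [CompleteSpace H] : ∃ (ι : Set H) (W : H →ₗᵢ[ℝ] Lp ℝ 2 (whiteNoise ι)),
      ∀ f, ∫ x, Complex.exp (Complex.I * (W f x : ℝ)) ∂(whiteNoise ι) =
        Complex.exp (-(‖f‖ ^ 2 : ℝ) / 2) := by
  classical
  obtain ⟨ι, b, -⟩ := exists_hilbertBasis ℝ H
  refine ⟨ι, ?_⟩
  have hspan := b.dense_span
  have ho := orthonormal_coord ι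
  obtain ⟨W, hW⟩ := exists_linearIsometry_of_gram (𝕜 := ℝ) (u := b) hspan (fun i j => by
    rw [orthonormal_iff_ite.mp ho, orthonormal_iff_ite.mp b.orthonormal])
  refine ⟨W, fun f => ?_⟩
  -- After closedness it suffices to treat finite combinations of basis vectors. `L²` convergence
  -- gives almost everywhere convergence along a subsequence, and the integrands have modulus one.
  have hcl : IsClosed {f : H | ∫ x, Complex.exp (Complex.I * (W f x : ℝ)) ∂(whiteNoise ι) =
        Complex.exp (-(‖f‖ ^ 2 : ℝ) / 2)} := by
    refine IsSeqClosed.isClosed fun f g hf hfg => ?_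
    obtain ⟨r, hr, hr'⟩ := (tendstoInMeasure_of_tendsto_Lp
      ((W.continuous.tendsto g).comp hfg)).exists_seq_tendsto_ae
    have h1 : Tendsto (fun k => ∫ x, Complex.exp (Complex.I * (W (f (r k)) x : ℝ)) ∂(whiteNoise ι))
        atTop (𝓝 (∫ x, Complex.exp (Complex.I * (W g x : ℝ)) ∂(whiteNoise ι))) := by
      refine tendsto_integral_of_dominated_convergence (fun _ => 1) (fun k => ?_)
        (integrable_const _) (fun k => ?_) ?_
      · have := (Lp.stronglyMeasurable (W (f (r k)))).measurable
        exact Measurable.aestronglyMeasurable (by fun_prop)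
      · refine Eventually.of_forall fun x => ?_
        rw [mul_comm, Complex.norm_exp_ofReal_mul_I]
      · filter_upwards [hr'] with x hx
        have hc : Continuous fun y : ℝ => Complex.exp (Complex.I * (y : ℂ)) := by fun_prop
        exact (hc.tendsto _).comp hx
    have h2 : Tendsto (fun k => Complex.exp (-(‖f (r k)‖ ^ 2 : ℝ) / 2)) atTop
        (𝓝 (Complex.exp (-(‖g‖ ^ 2 : ℝ) / 2))) := by
      have hc : Continuous fun y : H => Complex.exp (-((‖y‖ ^ 2 : ℝ) : ℂ) / 2) := by fun_prop
      exact (hc.tendsto g).comp (hfg.comp hr.tendsto_atTop)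
    refine tendsto_nhds_unique h1 (h2.congr fun k => ?_)
    exact (hf (r k)).symm
  have hsub : (Submodule.span ℝ (Set.range b) : Set H) ⊆ {f : H |
      ∫ x, Complex.exp (Complex.I * (W f x : ℝ)) ∂(whiteNoise ι) =
        Complex.exp (-(‖f‖ ^ 2 : ℝ) / 2)} := by
    intro g hg
    rw [SetLike.mem_coe, ← Finsupp.range_linearCombination] at hg
    obtain ⟨a, rfl⟩ := hg
    have hWa : W (Finsupp.linearCombination ℝ b a) =ᵐ[whiteNoise ι]
        fun x => ∑ i ∈ a.support, a i * x i := by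
      have e : W (Finsupp.linearCombination ℝ b a) =
          ∑ i ∈ a.support, a i • (memLp_coord i).toLp (fun x : ι → ℝ => x i) := by
        simp only [Finsupp.linearCombination_apply, Finsupp.sum, map_sum, map_smul, hW]
      rw [e]
      have hall : ∀ i : ι, ∀ᵐ x ∂(whiteNoise ι),
          (a i • (memLp_coord i).toLp (fun x : ι → ℝ => x i) : Lp ℝ 2 (whiteNoise ι)) x =
            a i * x i := fun i => by
        filter_upwards [Lp.coeFn_smul (a i) ((memLp_coord i).toLp (fun x : ι → ℝ => x i)),
          (memLp_coord i).coeFn_toLp] with x h1 h2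
        rw [h1, Pi.smul_apply, h2, smul_eq_mul]
      have hfin := (Finset.eventually_all a.support).mpr fun i _ => hall i
      filter_upwards [Lp.coeFn_finsetSum a.support fun i : ι =>
        a i • (memLp_coord i).toLp (fun x : ι → ℝ => x i), hfin] with x h1 h2
      rw [h1, Finset.sum_apply]
      exact Finset.sum_congr rfl h2
    have hn : ‖Finsupp.linearCombination ℝ b a‖ ^ 2 = ∑ i ∈ a.support, a i ^ 2 := by
      rw [← real_inner_self_eq_norm_sq, Finsupp.linearCombination_apply, Finsupp.sum,
        b.orthonormal.inner_sum]
      exact Finset.sum_congr rfl fun i _ => by simp [sq]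
    change _ = _
    rw [hn, ← integral_exp_sum_coord]
    refine integral_congr_ae ?_
    filter_upwards [hWa] with x hx
    rw [hx]
  have := hcl.closure_subset_iff.mpr hsub
  refine this ?_
  have h3 : f ∈ (Submodule.span ℝ (Set.range b)).topologicalClosure := hspan ▸ Submodule.mem_top
  exact h3

/-- A linear map into `L²` has a version whose sample functions are linear. -/
theorem exists_dual_version {Ω E : Type*} [MeasurableSpace Ω] {ν : Measure Ω} [AddCommGroup E]
    [Module ℝ E] (A : E →ₗ[ℝ] Lp ℝ 2 ν) :
    ∃ Φ : Ω → Module.Dual ℝ E, ∀ f, Measurable (fun x => Φ x f) ∧ (fun x => Φ x f) =ᵐ[ν] A f := by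
  -- An algebraic basis: representatives are fixed on basis vectors and extended linearly, so
  -- linearity holds for every sample. Each `f` involves finitely many basis vectors, so
  -- measurability and the almost everywhere identity survive.
  let b := Module.Basis.ofVectorSpace ℝ E
  refine ⟨fun x => b.constr ℝ fun i => A (b i) x, fun f => ?_⟩
  have e : ∀ x, b.constr ℝ (fun i => A (b i) x) f = ∑ i ∈ (b.repr f).support, b.repr f i * A (b i) x :=
    fun x => by
      rw [Module.Basis.constr_apply, Finsupp.sum]
      rfl
  simp only [e]
  refine ⟨Finset.measurable_sum _ fun i _ =>
    (Lp.stronglyMeasurable (A (b i))).measurable.const_mul _, ?_⟩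
  have e2 : A f = ∑ i ∈ (b.repr f).support, b.repr f i • A (b i) := by
    conv_lhs => rw [← b.linearCombination_repr f, Finsupp.linearCombination_apply, Finsupp.sum]
    rw [map_sum]
    exact Finset.sum_congr rfl fun i _ => map_smul _ _ _
  have hall : ∀ i, ∀ᵐ x ∂ν, (b.repr f i • A (b i) : Lp ℝ 2 ν) x = b.repr f i * A (b i) x :=
    fun i => Lp.coeFn_smul _ _
  have hfin := (Finset.eventually_all (b.repr f).support).mpr fun i _ => hall i
  rw [e2]
  filter_upwards [Lp.coeFn_finsetSum (b.repr f).support fun i => b.repr f i • A (b i), hfin]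
    with x h1 h2
  rw [h1, Finset.sum_apply]
  exact (Finset.sum_congr rfl h2).symm

end Isonormal

/-! ### The Gaussian measure on path space -/

theorem measurable_to_pathSpace {P : Params} {Ω : Type*} [MeasurableSpace Ω] {Φ : Ω → PathSpace P}
    (h : ∀ f, Measurable fun x => pathField f (Φ x)) : Measurable Φ := by
  rw [measurable_iff_comap_le]
  change MeasurableSpace.comap Φ (⨆ f : TestSpace P, MeasurableSpace.comap (pathField f) inferInstance) ≤ _
  rw [MeasurableSpace.comap_iSup]
  refine iSup_le fun f => ?_
  rw [MeasurableSpace.comap_comp]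
  exact (h f).comap_le

theorem covForm_eq_norm_sq {P : Params} (f : TestSpace P) :
    covForm P f = ‖(f : Lp ℂ 2 (covMeasure P))‖ ^ 2 := (norm_sq_Lp _).symm

/-- The Gaussian measure on path space exists. -/
theorem exists_isGaussianPathMeasure (P : Params) :
    ∃ μ : ProbabilityMeasure (PathSpace P), IsGaussianPathMeasure P (μ : Measure (PathSpace P)) := by
  -- The process is built on all of `L²`, viewed as a complete real Hilbert space, and then
  -- restricted to the hermitian functions. The rescaling by `1/√2` gives variance `q(f)/2`, hence
  -- the exponent `-q(f)/4`.
  obtain ⟨ι, W, hW⟩ := exists_isonormal (Lp ℂ 2 (covMeasure P))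
  obtain ⟨Φ, hΦ⟩ := exists_dual_version
    ((W.toLinearMap.comp (hermitianL2 (covMeasure P) (measurePreserving_neg_cov P)).subtype).comp
      ((Real.sqrt 2)⁻¹ • LinearMap.id))
  let Φ' : (ι → ℝ) → PathSpace P := Φ
  have hm : Measurable Φ' := measurable_to_pathSpace fun f => (hΦ f).1
  refine ⟨⟨(whiteNoise ι).map Φ', Measure.isProbabilityMeasure_map hm.aemeasurable⟩, fun f => ?_⟩
  have hme : Measurable fun φ : PathSpace P => Complex.exp (Complex.I * pathField f φ) := by
    have := measurable_pathField f
    fun_prop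
  rw [ProbabilityMeasure.coe_mk, integral_map hm.aemeasurable hme.aestronglyMeasurable]
  have h1 := hW ((Real.sqrt 2)⁻¹ • (f : Lp ℂ 2 (covMeasure P)))
  have h2 : ‖(Real.sqrt 2)⁻¹ • (f : Lp ℂ 2 (covMeasure P))‖ ^ 2 = covForm P f / 2 := by
    rw [norm_smul, mul_pow, covForm_eq_norm_sq, norm_inv, Real.norm_eq_abs,
      abs_of_nonneg (Real.sqrt_nonneg 2), inv_pow, Real.sq_sqrt (by norm_num)]
    ring
  rw [h2] at h1
  convert h1 using 1
  · refine integral_congr_ae ?_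
    filter_upwards [(hΦ f).2] with x hx
    have : pathField f (Φ' x) = W ((Real.sqrt 2)⁻¹ • (f : Lp ℂ 2 (covMeasure P))) x := hx
    rw [this]
  · congr 1
    push_cast
    ring

/-! ### The thermal covariance at sharp times -/

section ThermalKernel

variable (P : Params)

/-- The function `(1+ρ) e^{-rε} + ρ e^{rε}`. -/
def thermalKernel (k : Mom P) (r : ℝ) : ℝ :=
  (1 + rho P k) * Real.exp (-(r * disp P k)) + rho P k * Real.exp (r * disp P k)

variable {P}

/-- The detailed balance (KMS) relation. It accounts for the periodicity of the thermal kernel, the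
time range `[0, β/2]`, and the exchange of the two weights at `β/2`. -/
theorem exp_mul_rho {k : Mom P} (hk : k ≠ 0) :
    Real.exp (P.β * disp P k) * rho P k = 1 + rho P k := by
  have h1 : 1 < Real.exp (P.β * disp P k) :=
    Real.one_lt_exp_iff.mpr (mul_pos P.β_pos (disp_pos P hk))
  have h2 : Real.exp (P.β * disp P k) - 1 ≠ 0 := by linarith
  unfold rho
  field_simp
  ring

theorem thermalKernel_endpoints {k : Mom P} (hk : k ≠ 0) :
    thermalKernel P k 0 = thermalKernel P k P.β := by
  have h := exp_mul_rho hk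
  have h0 := Real.exp_pos (P.β * disp P k)
  unfold thermalKernel
  have h1 : (1 + rho P k) * (Real.exp (P.β * disp P k))⁻¹ = rho P k := by
    rw [← h]; field_simp
  simp only [zero_mul, neg_zero, Real.exp_zero]
  rw [Real.exp_neg, h1, mul_comm (rho P k) (Real.exp _), h]
  ring

/-- Since `e^{-iω_nβ} = 1`, each exponential integrates explicitly, and `e^{βε}ρ = 1+ρ` combines the
boundary terms into `1/(ε+iω_n) + 1/(ε-iω_n)`. -/
theorem integral_fourier_thermalKernel {k : Mom P} (hk : k ≠ 0) (n : ℤ) :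
    ∫ x in (0 : ℝ)..P.β, Complex.exp (-(Complex.I * (matsubara P n * x : ℝ))) * thermalKernel P k x =
      2 * disp P k * covSymbol P (n, k) := by
  have he := disp_pos P hk
  have hβ := P.β_pos
  set e := disp P k with hedef
  set w := matsubara P n with hw
  have h1 : (-(Complex.I * w) - e : ℂ) ≠ 0 := fun h => by
    have := congrArg Complex.re h; simp at this; exact he.ne' this
  have h2 : (-(Complex.I * w) + e : ℂ) ≠ 0 := fun h => by
    have := congrArg Complex.re h; simp at this; exact he.ne' this
  have hper : Complex.exp (-(Complex.I * w) * P.β) = 1 := by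
    rw [Complex.exp_eq_one_iff]
    refine ⟨-n, ?_⟩
    rw [hw, matsubara]
    have : (P.β : ℂ) ≠ 0 := by exact_mod_cast hβ.ne'
    push_cast
    field_simp
  have hint : ∀ c : ℂ, IntervalIntegrable (fun x : ℝ => Complex.exp (c * x)) volume 0 P.β :=
    fun c => Continuous.intervalIntegrable (by fun_prop) _ _
  have e1 : ∀ x : ℝ, Complex.exp (-(Complex.I * (w * x : ℝ))) * thermalKernel P k x =
      (1 + rho P k : ℝ) * Complex.exp ((-(Complex.I * w) - e) * x) +
        (rho P k : ℝ) * Complex.exp ((-(Complex.I * w) + e) * x) := by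
    intro x
    rw [sub_mul, add_mul, sub_eq_add_neg, Complex.exp_add, Complex.exp_add, thermalKernel]
    push_cast
    rw [← hedef]
    ring_nf
  simp only [e1]
  rw [intervalIntegral.integral_add ((hint _).const_mul _) ((hint _).const_mul _),
    intervalIntegral.integral_const_mul, intervalIntegral.integral_const_mul,
    integral_exp_mul_complex h1, integral_exp_mul_complex h2, sub_mul, add_mul, sub_eq_add_neg _ (_ * _),
    Complex.exp_add, Complex.exp_add, hper]
  have hr := exp_mul_rho hk
  rw [← hedef] at hr
  have hrc : Complex.exp (e * P.β) * rho P k = 1 + rho P k := by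
    have : ((Real.exp (P.β * e) * rho P k : ℝ) : ℂ) = ((1 + rho P k : ℝ) : ℂ) := by rw [hr]
    push_cast at this
    rw [mul_comm (e : ℂ)]; exact this
  have hE : Complex.exp (e * P.β) ≠ 0 := Complex.exp_ne_zero _
  have h12 : ((w ^ 2 + e ^ 2 : ℝ) : ℂ) = (-(Complex.I * w) - e) * (-1) * (-(Complex.I * w) + e) := by
    push_cast
    ring_nf
    rw [Complex.I_sq]; ring
  rw [covSymbol, ← hw, ← hedef]
  simp only [Complex.ofReal_div, Complex.ofReal_one, Complex.ofReal_zero, mul_zero, Complex.exp_zero, one_mul, h12,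
    Complex.exp_neg]
  push_cast
  rw [← hrc]
  field_simp
  linear_combination (-2 * (e : ℂ)) * hrc

/-- The kernel has equal values at `0` and `β`, so it is continuous on the circle. Its Fourier
coefficients are summable, so its Fourier series converges at every point. -/
theorem hasSum_timePhase_mul_covSymbol {k : Mom P} (hk : k ≠ 0) {r : ℝ} (hr : r ∈ Set.Icc 0 P.β) :
    HasSum (fun n : ℤ => timePhase P r n * covSymbol P (n, k))
      (P.β * oneParticleSymbol P k * thermalKernel P k r : ℝ) := by
  have he := disp_pos P hk
  have hβ := P.β_pos
  -- The lift to the circle is evaluated on the half-open interval. The remaining time `r = β`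
  -- occurs for two copies of `β/2` and follows from `r = 0` by periodicity.
  suffices H : ∀ r ∈ Set.Ico 0 P.β, HasSum (fun n : ℤ => timePhase P r n * covSymbol P (n, k))
      (P.β * oneParticleSymbol P k * thermalKernel P k r : ℝ) by
    rcases eq_or_lt_of_le hr.2 with h | h
    · have h0 := H 0 ⟨le_rfl, hβ⟩
      rw [thermalKernel_endpoints hk] at h0
      rw [h]
      refine h0.congr_fun fun n => ?_
      congr 1
      rw [timePhase_zero, timePhase, Complex.exp_eq_one_iff]
      refine ⟨-n, ?_⟩
      rw [matsubara]
      have : (P.β : ℂ) ≠ 0 := by exact_mod_cast hβ.ne'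
      push_cast
      field_simp
    · exact H r ⟨hr.1, h⟩
  intro r hr
  have : Fact (0 < P.β) := ⟨hβ⟩
  have hcont : Continuous fun x : ℝ => (thermalKernel P k x : ℂ) := by
    unfold thermalKernel; fun_prop
  let B : C(AddCircle P.β, ℂ) := ⟨AddCircle.liftIco P.β 0 fun x : ℝ => (thermalKernel P k x : ℂ),
    AddCircle.liftIco_zero_continuous (by rw [thermalKernel_endpoints hk]) hcont.continuousOn⟩
  have hB : ∀ n : ℤ, fourierCoeff B n = (2 * disp P k / P.β : ℝ) * covSymbol P (n, k) := by
    intro n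
    rw [show (B : AddCircle P.β → ℂ) = AddCircle.liftIco P.β 0 fun x : ℝ => (thermalKernel P k x : ℂ)
      from rfl, fourierCoeff_liftIco_eq, fourierCoeffOn_eq_integral]
    simp only [zero_add, sub_zero]
    have e : ∀ x : ℝ, fourier (-n) (x : AddCircle (0 + P.β - 0)) • (thermalKernel P k x : ℂ) =
        Complex.exp (-(Complex.I * (matsubara P n * x : ℝ))) * thermalKernel P k x := by
      intro x
      rw [fourier_coe_apply, smul_eq_mul, matsubara]
      congr 2
      push_cast
      ring
    have e' := intervalIntegral.integral_congr (μ := volume) (a := 0) (b := P.β) fun x _ => e x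
    rw [e', integral_fourier_thermalKernel hk, Complex.real_smul]
    push_cast
    ring
  have hs : Summable (fourierCoeff B) := by
    have h1 := (hasSum_covSymbol P hk).summable
    have h2 : Summable fun n : ℤ => (covSymbol P (n, k) : ℂ) := by exact_mod_cast h1
    exact (h2.mul_left _).congr fun n => (hB n).symm
  have h := has_pointwise_sum_fourier_series_of_summable hs (r : AddCircle P.β)
  have hBr : B (r : AddCircle P.β) = thermalKernel P k r :=
    AddCircle.liftIco_coe_apply (f := fun x : ℝ => (thermalKernel P k x : ℂ))
      (show r ∈ Set.Ico 0 (0 + P.β) by rwa [zero_add])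
  -- The Fourier series carries `e^{iω_n r}` and `timePhase` carries `e^{-iω_n r}`. The symbol is
  -- even in `n`.
  rw [hBr, ← (Equiv.neg ℤ).hasSum_iff] at h
  have h3 := h.mul_left ((P.β * oneParticleSymbol P k : ℝ) : ℂ)
  rw [Complex.ofReal_mul _ (thermalKernel P k r)]
  refine h3.congr_fun fun n => ?_
  have hc : covSymbol P (-n, k) = covSymbol P (n, k) := by
    simp [covSymbol, matsubara]; ring
  simp only [Function.comp_apply, Equiv.neg_apply, hB, hc, fourier_coe_apply, smul_eq_mul,
    oneParticleSymbol, timePhase, matsubara]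
  have h4 : Complex.exp (2 * Real.pi * Complex.I * (-n : ℤ) * r / P.β) =
      Complex.exp (-(Complex.I * ((2 * Real.pi * n / P.β * r : ℝ) : ℂ))) := by
    congr 1; push_cast; ring
  rw [h4]
  have h5 : (P.β : ℂ) ≠ 0 := by exact_mod_cast hβ.ne'
  have h6 : (disp P k : ℂ) ≠ 0 := by exact_mod_cast he.ne'
  push_cast
  field_simp

end ThermalKernel

/-! ### Null sets and integrals of the weighted measures -/

section WeightedMeasures

variable {P : Params}

theorem oneParticleSymbol_pos {k : Mom P} (hk : k ≠ 0) : 0 < oneParticleSymbol P k := by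
  have := disp_pos P hk
  unfold oneParticleSymbol; positivity

theorem ae_of_ae_snd {κ : Type*} [MeasurableSpace κ] (c : Measure κ) [SFinite c]
    {w : κ × Mom P → ℝ≥0∞} {q : Mom P → Prop} (h : ∀ᵐ k : Mom P, q k) :
    ∀ᵐ x ∂((c.prod (volume : Measure (Mom P))).withDensity w), q x.2 :=
  (withDensity_absolutelyContinuous _ _).ae_le (Measure.quasiMeasurePreserving_snd.ae h)

theorem ae_oneParticle_of_ae {p : Bool × Mom P → Prop} (h : ∀ᵐ k : Mom P, ∀ b, p (b, k)) :
    ∀ᵐ x ∂(oneParticleMeasure P), p x := by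
  filter_upwards [ae_of_ae_snd (w := fun x => ENNReal.ofReal (oneParticleSymbol P x.2)) .count h]
    with x hx using hx x.1

/-- The density is strictly positive away from the Lebesgue null set `{0}`. -/
theorem ae_timeZero_iff {p : Mom P → Prop} :
    (∀ᵐ k ∂(timeZeroMeasure P), p k) ↔ ∀ᵐ k : Mom P, p k := by
  rw [timeZeroMeasure, ae_withDensity_iff (measurable_timeZeroSymbol P).ennreal_ofReal]
  refine ⟨fun h => ?_, fun h => h.mono fun k hk _ => hk⟩
  filter_upwards [h, ae_ne_zero P] with k h1 h2
  refine h1 ?_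
  rw [timeZeroSymbol_eq P h2]
  have := oneParticleSymbol_pos h2
  have := rho_nonneg P (k := k)
  simp only [ne_eq, ENNReal.ofReal_eq_zero, not_le]
  positivity

theorem ae_of_ae_oneParticle {p : Bool × Mom P → Prop} (h : ∀ᵐ x ∂(oneParticleMeasure P), p x) :
    ∀ᵐ k : Mom P, ∀ b, p (b, k) := by
  have hw : Measurable fun x : Bool × Mom P => ENNReal.ofReal (oneParticleSymbol P x.2) :=
    (measurable_oneParticleSymbol P).ennreal_ofReal.comp measurable_snd
  rw [oneParticleMeasure, ae_withDensity_iff hw] at h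
  have h1 := Measure.ae_count_iff.mp (Measure.ae_ae_of_ae_prod h)
  rw [ae_all_iff]
  intro b
  filter_upwards [h1 b, ae_ne_zero P] with k h2 h3
  refine h2 ?_
  simpa using oneParticleSymbol_pos h3

theorem ae_volume_neg {p : Mom P → Prop} (h : ∀ᵐ k : Mom P, p k) : ∀ᵐ k : Mom P, p (-k) :=
  (Measure.measurePreserving_neg (volume : Measure (Mom P))).quasiMeasurePreserving.ae h

theorem lintegral_oneParticle {F : Bool × Mom P → ℝ≥0∞} (hF : Measurable F) :
    ∫⁻ x, F x ∂(oneParticleMeasure P) =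
      ∫⁻ k, ENNReal.ofReal (oneParticleSymbol P k) * (F (false, k) + F (true, k)) := by
  have hw : Measurable fun x : Bool × Mom P => ENNReal.ofReal (oneParticleSymbol P x.2) :=
    (measurable_oneParticleSymbol P).ennreal_ofReal.comp measurable_snd
  rw [oneParticleMeasure, lintegral_withDensity_eq_lintegral_mul _ hw hF,
    lintegral_prod_symm _ (hw.mul hF).aemeasurable]
  refine lintegral_congr fun k => ?_
  rw [lintegral_count, tsum_bool]
  simp only [Pi.mul_apply]
  ring

theorem lintegral_timeZero {F : Mom P → ℝ≥0∞} (hF : Measurable F) :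
    ∫⁻ k, F k ∂(timeZeroMeasure P) = ∫⁻ k, ENNReal.ofReal (timeZeroSymbol P k) * F k :=
  lintegral_withDensity_eq_lintegral_mul _ (measurable_timeZeroSymbol P).ennreal_ofReal hF

theorem integral_count_prod_withDensity {κ : Type*} [MeasurableSpace κ] [Countable κ]
    [MeasurableSingletonClass κ] {w : κ × Mom P → ℝ} (hw : Measurable w) (hw0 : ∀ x, 0 ≤ w x)
    {F : κ × Mom P → ℂ} (hF : Integrable F (((Measure.count : Measure κ).prod
      (volume : Measure (Mom P))).withDensity fun x => ENNReal.ofReal (w x))) :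
    ∫ x, F x ∂(((Measure.count : Measure κ).prod (volume : Measure (Mom P))).withDensity
      fun x => ENNReal.ofReal (w x)) = ∫ k : Mom P, ∑' n : κ, (w (n, k) : ℂ) * F (n, k) := by
  have hlt : ∀ᵐ x ∂((Measure.count : Measure κ).prod (volume : Measure (Mom P))),
      ENNReal.ofReal (w x) < ∞ := Eventually.of_forall fun x => ENNReal.ofReal_lt_top
  rw [integrable_withDensity_iff_integrable_smul' hw.ennreal_ofReal hlt] at hF
  rw [integral_withDensity_eq_integral_toReal_smul hw.ennreal_ofReal hlt, integral_prod_symm _ hF]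
  refine integral_congr_ae ?_
  filter_upwards [hF.prod_left_ae] with k hk
  rw [integral_countable hk]
  refine tsum_congr fun n => ?_
  rw [ENNReal.toReal_ofReal (hw0 _), Complex.real_smul]
  simp [Measure.real]

end WeightedMeasures

/-! ### Sharp-time one-particle vectors -/

section ArakiVectors

variable {P : Params}

/-- The function `e^{-sε} (1+ρ)^{1/2} g ⊕ e^{sε} ρ^{1/2} conj(g)`. -/
def arakiFun (P : Params) (s : ℝ) (g : Mom P → ℂ) (x : Bool × Mom P) : ℂ :=
  if x.1 then (Real.exp (s * disp P x.2) * Real.sqrt (rho P x.2) : ℝ) * conj (g x.2)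
  else (Real.exp (-(s * disp P x.2)) * Real.sqrt (1 + rho P x.2) : ℝ) * g x.2

theorem measurable_arakiFun (s : ℝ) {g : Mom P → ℂ} (hg : Measurable g) :
    Measurable (arakiFun P s g) := by
  have hr := measurable_rho P
  have hd := measurable_disp P
  refine measurable_from_prod_countable_right fun b => ?_
  cases b
  · simp only [arakiFun, Bool.false_eq_true, if_false]
    fun_prop
  · have := Complex.continuous_conj.measurable.comp hg
    simp only [arakiFun, if_true]
    fun_prop

/-- Here the restriction to half the circle enters: `e^{2sε}ρ ≤ e^{βε}ρ = 1+ρ` for `s ≤ β/2`, so the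
growing second component is controlled by the time-zero norm. -/
theorem exp_mul_sqrt_rho_le {k : Mom P} (hk : k ≠ 0) {s : ℝ} (hs : s ∈ Set.Icc 0 (P.β / 2)) :
    (Real.exp (s * disp P k) * Real.sqrt (rho P k)) ^ 2 ≤ 1 + rho P k := by
  rw [mul_pow, Real.sq_sqrt (rho_nonneg P), ← exp_mul_rho hk, ← Real.exp_nat_mul]
  refine mul_le_mul_of_nonneg_right (Real.exp_le_exp.mpr ?_) (rho_nonneg P)
  have := disp_pos P hk
  push_cast
  nlinarith [hs.2]

theorem exp_neg_mul_sqrt_le {k : Mom P} (hk : k ≠ 0) {s : ℝ} (hs : s ∈ Set.Icc 0 (P.β / 2)) :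
    (Real.exp (-(s * disp P k)) * Real.sqrt (1 + rho P k)) ^ 2 ≤ 1 + rho P k := by
  have h := rho_nonneg P (k := k)
  rw [mul_pow, Real.sq_sqrt (by linarith), ← Real.exp_nat_mul]
  refine mul_le_of_le_one_left (by linarith) (Real.exp_le_one_iff.mpr ?_)
  have := disp_pos P hk
  push_cast
  nlinarith [hs.1, mul_nonneg hs.1 this.le]

theorem enorm_ofReal_mul_sq (a : ℝ) (z : ℂ) :
    ‖(a : ℂ) * z‖ₑ ^ 2 = ENNReal.ofReal (a ^ 2) * ‖z‖ₑ ^ 2 := by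
  rw [enorm_mul, mul_pow, ← ofReal_norm, Complex.norm_real, Real.norm_eq_abs,
    ← ENNReal.ofReal_pow (abs_nonneg a), sq_abs]

theorem memLp_arakiFun {s : ℝ} (hs : s ∈ Set.Icc 0 (P.β / 2)) (g : Lp ℂ 2 (timeZeroMeasure P)) :
    MemLp (arakiFun P s g) 2 (oneParticleMeasure P) := by
  have hg := (Lp.stronglyMeasurable g).measurable
  have hm := measurable_arakiFun s hg
  refine memLp_two_of_lintegral hm.aestronglyMeasurable ?_
  have hfin := lintegral_of_memLp_two (Lp.memLp g)
  rw [lintegral_timeZero (hg.enorm.pow_const 2)] at hfin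
  rw [lintegral_oneParticle (hm.enorm.pow_const 2)]
  refine lt_of_le_of_lt (b := ∫⁻ k, ENNReal.ofReal 2 * (ENNReal.ofReal (timeZeroSymbol P k) * ‖g k‖ₑ ^ 2)) ?_ ?_
  · refine lintegral_mono_ae ?_
    filter_upwards [ae_ne_zero P] with k hk
    have e2 : ‖conj (g k)‖ₑ = ‖g k‖ₑ := by rw [← ofReal_norm, ← ofReal_norm, RCLike.norm_conj]
    have h1 := exp_mul_sqrt_rho_le hk hs
    have h2 := exp_neg_mul_sqrt_le hk hs
    have h3 := oneParticleSymbol_pos hk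
    have h4 := rho_nonneg P (k := k)
    simp only [arakiFun, Bool.false_eq_true, if_false, if_true]
    rw [enorm_ofReal_mul_sq, enorm_ofReal_mul_sq, e2, ← add_mul, ← ENNReal.ofReal_add (sq_nonneg _)
      (sq_nonneg _), ← mul_assoc, ← mul_assoc, ← ENNReal.ofReal_mul h3.le,
      ← ENNReal.ofReal_mul (by norm_num)]
    refine mul_le_mul_left (ENNReal.ofReal_le_ofReal ?_) _
    rw [timeZeroSymbol_eq P hk]
    nlinarith
  · rw [lintegral_const_mul _ (by
      have := (measurable_timeZeroSymbol P)
      fun_prop)]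
    exact ENNReal.mul_lt_top (by simp) hfin

/-- The vector `e^{-sL} ((1+ρ)^{1/2} g ⊕ ρ^{1/2} conj(g))`, for `0 ≤ s ≤ β/2`. -/
def araki {s : ℝ} (hs : s ∈ Set.Icc 0 (P.β / 2)) (g : Lp ℂ 2 (timeZeroMeasure P)) :
    Lp ℂ 2 (oneParticleMeasure P) :=
  (memLp_arakiFun hs g).toLp _

theorem coeFn_araki {s : ℝ} (hs : s ∈ Set.Icc 0 (P.β / 2)) (g : Lp ℂ 2 (timeZeroMeasure P)) :
    araki hs g =ᵐ[oneParticleMeasure P] arakiFun P s g := (memLp_arakiFun hs g).coeFn_toLp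

theorem zero_mem_times (P : Params) : (0 : ℝ) ∈ Set.Icc 0 (P.β / 2) :=
  ⟨le_rfl, by have := P.β_pos; positivity⟩

theorem half_mem_times (P : Params) : P.β / 2 ∈ Set.Icc 0 (P.β / 2) :=
  ⟨by have := P.β_pos; positivity, le_rfl⟩

theorem araki_zero (g : TimeZeroSpace P) : araki (zero_mem_times P) g = leftArakiWoods P g := by
  apply Lp.ext
  filter_upwards [coeFn_araki (zero_mem_times P) g, (memLp_leftArakiWoods P g).coeFn_toLp]
    with x h1 h2
  refine h1.trans (Eq.trans ?_ h2.symm)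
  simp [arakiFun, leftArakiWoodsFun]

theorem araki_shift {s t : ℝ} (hs : s ∈ Set.Icc 0 (P.β / 2)) (hst : s + t ∈ Set.Icc 0 (P.β / 2))
    (g : Lp ℂ 2 (timeZeroMeasure P)) : ∀ᵐ x ∂(oneParticleMeasure P),
      araki hst g x = (Real.exp (-(t * liouvilleSymbol P x)) : ℂ) * araki hs g x := by
  filter_upwards [coeFn_araki hst g, coeFn_araki hs g] with x h1 h2
  rw [h1, h2]
  rcases x with ⟨b, k⟩
  cases b
  · simp only [arakiFun, liouvilleSymbol, Bool.false_eq_true, if_false]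
    rw [← mul_assoc, ← Complex.ofReal_mul, ← mul_assoc, ← Real.exp_add]
    congr 4; ring
  · simp only [arakiFun, liouvilleSymbol, if_true]
    rw [← mul_assoc, ← Complex.ofReal_mul, ← mul_assoc, ← Real.exp_add]
    congr 4; ring

/-- The first summand contributes `(1+ρ)e^{-(s+s')ε}`. The second contributes `ρe^{(s+s')ε}` with
the conjugate of `g' ḡ`, and the substitution `k ↦ -k` with hermiticity removes this conjugation. -/
theorem inner_araki {s s' : ℝ} (hs : s ∈ Set.Icc 0 (P.β / 2)) (hs' : s' ∈ Set.Icc 0 (P.β / 2))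
    (g g' : TimeZeroSpace P) :
    inner ℂ (araki hs g) (araki hs' g') = ∫ k : Mom P,
      (oneParticleSymbol P k * thermalKernel P k (s + s') : ℝ) *
        ((g' : Lp ℂ 2 (timeZeroMeasure P)) k * conj ((g : Lp ℂ 2 (timeZeroMeasure P)) k)) := by
  have hg := ae_timeZero_iff.mp g.2
  have hg' := ae_timeZero_iff.mp g'.2
  set γ : Mom P → ℂ := ((g : Lp ℂ 2 (timeZeroMeasure P)) : Mom P → ℂ) with hγ
  set γ' : Mom P → ℂ := ((g' : Lp ℂ 2 (timeZeroMeasure P)) : Mom P → ℂ) with hγ'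
  have hi := L2.integrable_inner (𝕜 := ℂ) (araki hs g) (araki hs' g')
  have hw : Measurable fun x : Bool × Mom P => oneParticleSymbol P x.2 :=
    (measurable_oneParticleSymbol P).comp measurable_snd
  have hw0 : ∀ x : Bool × Mom P, 0 ≤ oneParticleSymbol P x.2 := fun x => by
    unfold oneParticleSymbol disp; positivity
  have hlt : ∀ᵐ x ∂((Measure.count : Measure Bool).prod (volume : Measure (Mom P))),
      ENNReal.ofReal (oneParticleSymbol P x.2) < ∞ := Eventually.of_forall fun x => ENNReal.ofReal_lt_top
  have hi' : ∀ b : Bool, Integrable fun k : Mom P =>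
      (oneParticleSymbol P k : ℂ) * inner ℂ (araki hs g (b, k)) (araki hs' g' (b, k)) := by
    have h1 := (integrable_withDensity_iff_integrable_smul' hw.ennreal_ofReal hlt).mp hi
    have h2 := Measure.ae_count_iff.mp h1.prod_right_ae
    intro b
    refine (h2 b).congr (Eventually.of_forall fun k => ?_)
    simp only
    rw [ENNReal.toReal_ofReal (hw0 (b, k)), Complex.real_smul]
  rw [L2.inner_def]
  refine (integral_count_prod_withDensity hw hw0 hi).trans ?_
  simp only [tsum_bool]
  rw [integral_add (hi' false) (hi' true)]
  have h1 := ae_of_ae_oneParticle (coeFn_araki hs g)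
  have h2 := ae_of_ae_oneParticle (coeFn_araki hs' g')
  have ef : (fun k : Mom P => (oneParticleSymbol P k : ℂ) *
      inner ℂ (araki hs g (false, k)) (araki hs' g' (false, k))) =ᵐ[volume] fun k =>
      (oneParticleSymbol P k * ((1 + rho P k) * Real.exp (-((s + s') * disp P k))) : ℝ) *
        (γ' k * conj (γ k)) := by
    filter_upwards [h1, h2] with k e1 e2
    rw [e1, e2]
    simp only [arakiFun, Bool.false_eq_true, if_false, RCLike.inner_apply, map_mul,
      Complex.conj_ofReal]
    rw [add_mul s, neg_add, Real.exp_add]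
    have h := rho_nonneg P (k := k)
    have : (1 + rho P k) = Real.sqrt (1 + rho P k) * Real.sqrt (1 + rho P k) :=
      (Real.mul_self_sqrt (by linarith)).symm
    conv_rhs => rw [this]
    push_cast
    ring
  have et : (fun k : Mom P => (oneParticleSymbol P k : ℂ) *
      inner ℂ (araki hs g (true, k)) (araki hs' g' (true, k))) =ᵐ[volume] fun k =>
      (oneParticleSymbol P k * (rho P k * Real.exp ((s + s') * disp P k)) : ℝ) *
        (conj (γ' k) * γ k) := by
    filter_upwards [h1, h2] with k e1 e2
    rw [e1, e2]
    simp only [arakiFun, if_true, RCLike.inner_apply, map_mul,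
      Complex.conj_ofReal, Complex.conj_conj]
    rw [add_mul s, Real.exp_add]
    have : rho P k = Real.sqrt (rho P k) * Real.sqrt (rho P k) :=
      (Real.mul_self_sqrt (rho_nonneg P)).symm
    conv_rhs => rw [this]
    push_cast
    ring
  have hn : (fun k : Mom P => (oneParticleSymbol P (-k) *
      (rho P (-k) * Real.exp ((s + s') * disp P (-k))) : ℝ) * (conj (γ' (-k)) * γ (-k))) =ᵐ[volume]
      fun k => (oneParticleSymbol P k * (rho P k * Real.exp ((s + s') * disp P k)) : ℝ) *
        (γ' k * conj (γ k)) := by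
    filter_upwards [hg, hg'] with k e1 e2
    have e1' : γ (-k) = conj (γ k) := e1
    have e2' : γ' (-k) = conj (γ' k) := e2
    rw [e1', e2']
    simp only [oneParticleSymbol, rho, disp, norm_neg, Complex.conj_conj]
  have hit := (integrable_congr et).mp (hi' true)
  have hit' := (integrable_congr hn).mp ((Measure.measurePreserving_neg
    (volume : Measure (Mom P))).integrable_comp_of_integrable hit)
  rw [integral_congr_ae ef, integral_congr_ae et, ← integral_neg_eq_self
    (fun k => ((oneParticleSymbol P k * (rho P k * Real.exp ((s + s') * disp P k)) : ℝ) : ℂ) *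
      (conj (γ' k) * γ k)), integral_congr_ae hn,
    ← integral_add ((integrable_congr ef).mp (hi' false)) hit']
  refine integral_congr_ae (Eventually.of_forall fun k => ?_)
  simp only [thermalKernel]
  push_cast
  ring

end ArakiVectors

/-! ### Sharp-time test functions -/

section SharpTime

variable {P : Params}

/-- The sharp-time test function `δ_s ⊗ g`. -/
def sharpAt (s : ℝ) (g : TimeZeroSpace P) : TestSpace P := translate P s (sharpTimeZero P g)

theorem sharpAt_zero (g : TimeZeroSpace P) : sharpAt 0 g = sharpTimeZero P g := translate_zero P _

theorem timePhase_add (s t : ℝ) (n : ℤ) : timePhase P (s + t) n = timePhase P s n * timePhase P t n := by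
  simp only [timePhase]
  rw [← Complex.exp_add]
  congr 1
  push_cast
  ring

theorem translate_translate (s t : ℝ) (f : TestSpace P) :
    translate P s (translate P t f) = translate P (s + t) f := by
  apply Subtype.ext
  apply Lp.ext
  filter_upwards [(memLp_timePhase_mul P s (translate P t f)).coeFn_toLp,
    (memLp_timePhase_mul P t f).coeFn_toLp, (memLp_timePhase_mul P (s + t) f).coeFn_toLp]
    with x h1 h2 h3
  have h2' : (translate P t f : Lp ℂ 2 (covMeasure P)) x = _ := h2
  refine h1.trans (Eq.trans ?_ h3.symm)
  rw [h2', timePhase_add, mul_assoc]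

theorem translate_sharpAt (t s : ℝ) (g : TimeZeroSpace P) :
    translate P t (sharpAt s g) = sharpAt (t + s) g := translate_translate _ _ _

theorem coeFn_sharpAt (s : ℝ) (g : TimeZeroSpace P) :
    (sharpAt s g : Lp ℂ 2 (covMeasure P)) =ᵐ[covMeasure P] fun x => timePhase P s x.1 *
      (((Real.sqrt P.β)⁻¹ : ℂ) * (g : Lp ℂ 2 (timeZeroMeasure P)) x.2) := by
  filter_upwards [(memLp_timePhase_mul P s (sharpTimeZero P g)).coeFn_toLp,
    (memLp_sharpTime P g).coeFn_toLp] with x h1 h2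
  refine h1.trans ?_
  exact congrArg _ h2

/-- The times `0` and `β/2` are fixed by `s ↦ -s` on the circle of length `β`, so their phases are
real. -/
theorem conj_timePhase_boundary {s : ℝ} (hs : s = 0 ∨ s = P.β / 2) (n : ℤ) :
    conj (timePhase P s n) = timePhase P s n := by
  rcases hs with rfl | rfl
  · rw [timePhase_zero, map_one]
  · simp only [timePhase]
    rw [← Complex.exp_conj, Complex.exp_eq_exp_iff_exists_int]
    refine ⟨n, ?_⟩
    have : (P.β : ℂ) ≠ 0 := by exact_mod_cast P.β_pos.ne'
    simp only [matsubara, map_neg, map_mul, Complex.conj_I, Complex.conj_ofReal]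
    push_cast
    field_simp
    ring

/-- The conjugated phase of the boundary time `s` equals the phase itself, so the product of phases
is that of `s+s'` instead of `s'-s`, and the sum over `n` is the thermal kernel. -/
theorem inner_sharpAt {s s' : ℝ} (hs : s = 0 ∨ s = P.β / 2) (hss : s + s' ∈ Set.Icc 0 P.β)
    (g g' : TimeZeroSpace P) :
    inner ℂ (sharpAt s g : Lp ℂ 2 (covMeasure P)) (sharpAt s' g') = ∫ k : Mom P,
      (oneParticleSymbol P k * thermalKernel P k (s + s') : ℝ) *
        ((g' : Lp ℂ 2 (timeZeroMeasure P)) k * conj ((g : Lp ℂ 2 (timeZeroMeasure P)) k)) := by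
  set γ : Mom P → ℂ := ((g : Lp ℂ 2 (timeZeroMeasure P)) : Mom P → ℂ) with hγ
  set γ' : Mom P → ℂ := ((g' : Lp ℂ 2 (timeZeroMeasure P)) : Mom P → ℂ) with hγ'
  have hi := L2.integrable_inner (𝕜 := ℂ) (sharpAt s g : Lp ℂ 2 (covMeasure P)) (sharpAt s' g')
  have e : (fun x => inner ℂ ((sharpAt s g : Lp ℂ 2 (covMeasure P)) x)
      ((sharpAt s' g' : Lp ℂ 2 (covMeasure P)) x)) =ᵐ[covMeasure P]
      fun x => (P.β⁻¹ : ℝ) * timePhase P (s + s') x.1 * (γ' x.2 * conj (γ x.2)) := by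
    filter_upwards [coeFn_sharpAt s g, coeFn_sharpAt s' g'] with x h1 h2
    rw [h1, h2]
    have hb : ((P.β⁻¹ : ℝ) : ℂ) = (Real.sqrt P.β : ℂ)⁻¹ * (Real.sqrt P.β : ℂ)⁻¹ := by
      rw [← mul_inv, ← Complex.ofReal_mul, Real.mul_self_sqrt P.β_pos.le, Complex.ofReal_inv]
    simp only [RCLike.inner_apply, map_mul, map_inv₀, Complex.conj_ofReal,
      conj_timePhase_boundary hs]
    rw [timePhase_add, hb]
    ring
  rw [L2.inner_def, integral_congr_ae e]
  refine (integral_count_prod_withDensity (measurable_covSymbol P)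
    (fun x => by unfold covSymbol; positivity) ((integrable_congr e).mp hi)).trans ?_
  refine integral_congr_ae ?_
  filter_upwards [ae_ne_zero P] with k hk
  have h := (hasSum_timePhase_mul_covSymbol hk hss).mul_left
    (((P.β⁻¹ : ℝ) : ℂ) * (γ' k * conj (γ k)))
  have h' := h.tsum_eq
  have hb : (P.β : ℂ) ≠ 0 := by exact_mod_cast P.β_pos.ne'
  refine Eq.trans (tsum_congr fun n => ?_) (h'.trans ?_)
  · ring
  · push_cast
    field_simp

/-- Both sides are the same integral of the thermal kernel at `s+s'`. Only one of the two times has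
to lie on the boundary, which is what allows interior times to be represented in the one-particle
space. -/
theorem inner_araki_eq_inner_sharpAt {s s' : ℝ} (hs : s = 0 ∨ s = P.β / 2)
    (hsI : s ∈ Set.Icc 0 (P.β / 2)) (hs' : s' ∈ Set.Icc 0 (P.β / 2)) (g g' : TimeZeroSpace P) :
    inner ℂ (araki hsI g) (araki hs' g') =
      inner ℂ (sharpAt s g : Lp ℂ 2 (covMeasure P)) (sharpAt s' g') := by
  rw [inner_araki, inner_sharpAt hs ⟨add_nonneg hsI.1 hs'.1, by linarith [hsI.2, hs'.2]⟩]

/-- The substitution `x ↦ -x` conjugates both factors. Reality makes the order of arguments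
irrelevant and removes real parts from the polarization of `q`. -/
theorem conj_inner_testSpace (f f' : TestSpace P) :
    conj (inner ℂ (f : Lp ℂ 2 (covMeasure P)) (f' : Lp ℂ 2 (covMeasure P))) =
      inner ℂ (f : Lp ℂ 2 (covMeasure P)) (f' : Lp ℂ 2 (covMeasure P)) := by
  have hmp := measurePreserving_neg_cov P
  rw [L2.inner_def, ← integral_conj, ← hmp.integral_comp (MeasurableEquiv.neg _).measurableEmbedding]
  refine integral_congr_ae ?_
  filter_upwards [f.2, f'.2] with x h1 h2
  rw [h1, h2]
  simp [RCLike.inner_apply]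

theorem ofReal_re_inner_testSpace (f f' : TestSpace P) :
    ((inner ℂ (f : Lp ℂ 2 (covMeasure P)) (f' : Lp ℂ 2 (covMeasure P))).re : ℂ) =
      inner ℂ (f : Lp ℂ 2 (covMeasure P)) (f' : Lp ℂ 2 (covMeasure P)) :=
  Complex.conj_eq_iff_re.mp (conj_inner_testSpace f f')

theorem covForm_add (f f' : TestSpace P) : (covForm P (f + f') : ℂ) =
    covForm P f + covForm P f' + 2 * inner ℂ (f : Lp ℂ 2 (covMeasure P)) (f' : Lp ℂ 2 (covMeasure P)) := by
  rw [← ofReal_re_inner_testSpace, covForm_eq_norm_sq, covForm_eq_norm_sq, covForm_eq_norm_sq,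
    Submodule.coe_add, @norm_add_sq ℂ]
  push_cast
  change _ = _ + _ + 2 * ((RCLike.re (inner ℂ (f : Lp ℂ 2 (covMeasure P)) (f' : Lp ℂ 2 (covMeasure P))) : ℝ) : ℂ)
  ring

theorem covForm_neg (f : TestSpace P) : covForm P (-f) = covForm P f := by
  rw [covForm_eq_norm_sq, covForm_eq_norm_sq, Submodule.coe_neg, norm_neg]

theorem covForm_translate (t : ℝ) (f : TestSpace P) : covForm P (translate P t f) = covForm P f := by
  refine integral_congr_ae ?_
  filter_upwards [(memLp_timePhase_mul P t f).coeFn_toLp] with x h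
  have h' : (translate P t f : Lp ℂ 2 (covMeasure P)) x = _ := h
  rw [h', norm_mul, norm_timePhase, one_mul]

end SharpTime

/-! ### The one-particle vectors at times `0` and `β/2` are total -/

section Total

variable {P : Params}

/-- The one-particle vector of `δ_0 ⊗ g + δ_{β/2} ⊗ g'`. -/
def boundaryVector (p : TimeZeroSpace P × TimeZeroSpace P) : Lp ℂ 2 (oneParticleMeasure P) :=
  araki (zero_mem_times P) p.1 + araki (half_mem_times P) p.2

/-- At time `β/2` the weights `√(1+ρ)` and `√ρ` trade places. Together with the next lemma this
makes the system for the boundary data explicitly solvable. -/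
theorem exp_half_mul_sqrt_rho {k : Mom P} (hk : k ≠ 0) :
    Real.exp (P.β / 2 * disp P k) * Real.sqrt (rho P k) = Real.sqrt (1 + rho P k) := by
  rw [← exp_mul_rho hk, Real.sqrt_mul (Real.exp_pos _).le, ← Real.exp_half]
  congr 2; ring

theorem exp_neg_half_mul_sqrt {k : Mom P} (hk : k ≠ 0) :
    Real.exp (-(P.β / 2 * disp P k)) * Real.sqrt (1 + rho P k) = Real.sqrt (rho P k) := by
  rw [← exp_half_mul_sqrt_rho hk, ← mul_assoc, ← Real.exp_add]
  simp

theorem memLp_timeZero_of_bound {g : Mom P → ℂ} (hg : Measurable g)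
    {z : Lp ℂ 2 (oneParticleMeasure P)} {C : ℝ} (hC : 0 ≤ C)
    (h : ∀ᵐ k : Mom P, timeZeroSymbol P k * ‖g k‖ ^ 2 ≤
      oneParticleSymbol P k * (C * (‖z (false, k)‖ ^ 2 + ‖z (true, k)‖ ^ 2))) :
    MemLp g 2 (timeZeroMeasure P) := by
  refine memLp_two_of_lintegral hg.aestronglyMeasurable ?_
  have hz := (Lp.stronglyMeasurable z).measurable
  have hfin := lintegral_of_memLp_two (Lp.memLp z)
  rw [lintegral_oneParticle (hz.enorm.pow_const 2)] at hfin
  rw [lintegral_timeZero (hg.enorm.pow_const 2)]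
  refine lt_of_le_of_lt (b := ∫⁻ k, ENNReal.ofReal C * (ENNReal.ofReal (oneParticleSymbol P k) *
    (‖z (false, k)‖ₑ ^ 2 + ‖z (true, k)‖ₑ ^ 2))) ?_ ?_
  · refine lintegral_mono_ae ?_
    filter_upwards [h, ae_ne_zero P] with k hk hk0
    have h0 := (oneParticleSymbol_pos hk0).le
    have h1 : 0 ≤ timeZeroSymbol P k := by
      rw [timeZeroSymbol_eq P hk0]
      have := rho_nonneg P (k := k)
      positivity
    simp only [← ofReal_norm, ← ENNReal.ofReal_pow (norm_nonneg _)]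
    rw [← ENNReal.ofReal_mul h1, ← ENNReal.ofReal_add (by positivity) (by positivity),
      ← ENNReal.ofReal_mul h0, ← ENNReal.ofReal_mul hC]
    refine ENNReal.ofReal_le_ofReal (hk.trans (le_of_eq ?_))
    ring
  · rw [lintegral_const_mul]
    · exact ENNReal.mul_lt_top ENNReal.ofReal_lt_top hfin
    · have h1 := (measurable_oneParticleSymbol P).ennreal_ofReal
      have h2 : Measurable fun k => z (false, k) := hz.comp (by fun_prop)
      have h3 : Measurable fun k => z (true, k) := hz.comp (by fun_prop)
      exact h1.mul ((h2.enorm.pow_const 2).add (h3.enorm.pow_const 2))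

theorem norm_sub_sq_le (a b : ℝ) (u v : ℂ) :
    ‖(a : ℂ) * u - (b : ℂ) * v‖ ^ 2 ≤ 2 * (a ^ 2 * ‖u‖ ^ 2 + b ^ 2 * ‖v‖ ^ 2) := by
  have h := norm_sub_le ((a : ℂ) * u) ((b : ℂ) * v)
  rw [norm_mul, norm_mul, Complex.norm_real, Complex.norm_real, Real.norm_eq_abs, Real.norm_eq_abs] at h
  calc _ ≤ (|a| * ‖u‖ + |b| * ‖v‖) ^ 2 := pow_le_pow_left₀ (norm_nonneg _) h 2
    _ ≤ 2 * ((|a| * ‖u‖) ^ 2 + (|b| * ‖v‖) ^ 2) := add_sq_le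
    _ = _ := by rw [mul_pow, mul_pow, sq_abs, sq_abs]

/-- A hermitian vector on whose support `ρ` is bounded is a boundary vector. -/
theorem exists_boundaryVector_eq {z : Lp ℂ 2 (oneParticleMeasure P)} {N : ℝ}
    (hz : ∀ᵐ k : Mom P, ∀ b, z (b, -k) = conj (z (b, k)))
    (hN : ∀ᵐ k : Mom P, ∀ b, N < rho P k → z (b, k) = 0) : ∃ p, boundaryVector p = z := by
  have hzm := (Lp.stronglyMeasurable z).measurable
  have hm0 : Measurable fun k => z (false, k) := hzm.comp (by fun_prop)
  have hm1 : Measurable fun k => conj (z (true, k)) :=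
    Complex.continuous_conj.measurable.comp (hzm.comp (by fun_prop))
  have hr := measurable_rho P
  -- Equating a boundary vector with `z` gives `√(1+ρ) g + √ρ g' = z(false)` and `√ρ g + √(1+ρ) g' =
  -- conj z(true)`. The determinant is `(1+ρ) - ρ = 1`, and Cramer's rule gives `g = w 1 0` and `g'
  -- = -(w 0 1)`.
  let w : ℝ → ℝ → Mom P → ℂ := fun a b k =>
    (Real.sqrt (a + rho P k) : ℂ) * z (false, k) - (Real.sqrt (b + rho P k) : ℂ) * conj (z (true, k))
  have hw : ∀ a b, a ∈ Set.Icc (0 : ℝ) 1 → b ∈ Set.Icc (0 : ℝ) 1 →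
      MemLp (w a b) 2 (timeZeroMeasure P) := by
    intro a b ha hb
    have hmw : Measurable (w a b) := by
      have h1 : Measurable fun k => (Real.sqrt (a + rho P k) : ℂ) := by fun_prop
      have h2 : Measurable fun k => (Real.sqrt (b + rho P k) : ℂ) := by fun_prop
      exact (h1.mul hm0).sub (h2.mul hm1)
    -- The factor `1 + 2|N|` bounds the weight `1+2ρ`, and `2(1+|N|)` comes from squaring the two
    -- terms of `w`.
    refine memLp_timeZero_of_bound (z := z) (C := (1 + 2 * |N|) * (2 * (1 + |N|))) hmw (by positivity) ?_
    filter_upwards [hN, ae_ne_zero P] with k hk hk0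
    have h0 := oneParticleSymbol_pos hk0
    have h1 := rho_nonneg P (k := k)
    have h2 := norm_sub_sq_le (Real.sqrt (a + rho P k)) (Real.sqrt (b + rho P k)) (z (false, k))
      (conj (z (true, k)))
    rw [Real.sq_sqrt (by linarith [ha.1]), Real.sq_sqrt (by linarith [hb.1]), RCLike.norm_conj] at h2
    rw [timeZeroSymbol_eq P hk0, mul_comm _ (oneParticleSymbol P k), mul_assoc]
    refine mul_le_mul_of_nonneg_left ?_ h0.le
    by_cases hρ : N < rho P k
    · have e0 := hk false hρ
      have e1 := hk true hρ
      simp only [w, e0, e1]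
      simp
    · have h3 : rho P k ≤ |N| := (not_lt.mp hρ).trans (le_abs_self N)
      rw [mul_assoc]
      refine mul_le_mul (by linarith) (h2.trans ?_) (sq_nonneg _) (by positivity)
      have h4 : (a + rho P k) * ‖z (false, k)‖ ^ 2 ≤ (1 + |N|) * ‖z (false, k)‖ ^ 2 :=
        mul_le_mul_of_nonneg_right (by linarith [ha.2]) (sq_nonneg _)
      have h5 : (b + rho P k) * ‖z (true, k)‖ ^ 2 ≤ (1 + |N|) * ‖z (true, k)‖ ^ 2 :=
        mul_le_mul_of_nonneg_right (by linarith [hb.2]) (sq_nonneg _)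
      linarith
  have hherm : ∀ a b, a ∈ Set.Icc (0 : ℝ) 1 → b ∈ Set.Icc (0 : ℝ) 1 → ∃ G : TimeZeroSpace P,
      ∀ᵐ k : Mom P, (G : Lp ℂ 2 (timeZeroMeasure P)) k = w a b k := by
    intro a b ha hb
    have hc := (hw a b ha hb).coeFn_toLp
    refine ⟨⟨(hw a b ha hb).toLp _, ?_⟩, ae_timeZero_iff.mp hc⟩
    change ∀ᵐ k ∂(timeZeroMeasure P), (hw a b ha hb).toLp _ (-k) = conj ((hw a b ha hb).toLp _ k)
    filter_upwards [hc, (measurePreserving_neg_timeZero P).quasiMeasurePreserving.ae hc,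
      ae_timeZero_iff.mpr hz] with k h1 h2 h3
    have hrn : rho P (-k) = rho P k := by simp only [rho, disp, norm_neg]
    rw [h1, h2]
    simp only [w, hrn, h3, map_sub, map_mul, Complex.conj_ofReal, Complex.conj_conj]
  have h01 : (0 : ℝ) ∈ Set.Icc (0 : ℝ) 1 := ⟨le_rfl, zero_le_one⟩
  have h11 : (1 : ℝ) ∈ Set.Icc (0 : ℝ) 1 := ⟨zero_le_one, le_rfl⟩
  obtain ⟨G, hc⟩ := hherm 1 0 h11 h01
  obtain ⟨G', hc'⟩ := hherm 0 1 h01 h11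
  refine ⟨(G, -G'), ?_⟩
  apply Lp.ext
  have hneg := ae_timeZero_iff.mp (Lp.coeFn_neg (G' : Lp ℂ 2 (timeZeroMeasure P)))
  have key : ∀ᵐ k : Mom P, ∀ b : Bool,
      arakiFun P 0 (G : Lp ℂ 2 (timeZeroMeasure P)) (b, k) +
        arakiFun P (P.β / 2) (-G' : Lp ℂ 2 (timeZeroMeasure P)) (b, k) = z (b, k) := by
    filter_upwards [hc, hc', hneg, ae_ne_zero P] with k h1 h2 h3 hk
    have hρ := rho_nonneg P (k := k)
    have e1 : (Real.sqrt (1 + rho P k) : ℂ) * Real.sqrt (1 + rho P k) = 1 + rho P k := by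
      rw [← Complex.ofReal_mul, Real.mul_self_sqrt (by linarith)]; push_cast; ring
    have e2 : (Real.sqrt (rho P k) : ℂ) * Real.sqrt (rho P k) = rho P k := by
      rw [← Complex.ofReal_mul, Real.mul_self_sqrt hρ]
    intro b
    cases b
    · simp only [arakiFun, Bool.false_eq_true, if_false, exp_neg_half_mul_sqrt hk, h1, h2, h3,
        Pi.neg_apply, zero_mul, neg_zero, Real.exp_zero, one_mul, w, zero_add]
      linear_combination z (false, k) * e1 - z (false, k) * e2
    · simp only [arakiFun, if_true, exp_half_mul_sqrt_rho hk, h1, h2, h3,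
        Pi.neg_apply, zero_mul, Real.exp_zero, one_mul, w, zero_add, map_neg, map_sub, map_mul,
        Complex.conj_ofReal, Complex.conj_conj]
      linear_combination z (true, k) * e1 - z (true, k) * e2
  filter_upwards [Lp.coeFn_add (araki (zero_mem_times P) G) (araki (half_mem_times P) (-G')),
    coeFn_araki (zero_mem_times P) G, coeFn_araki (half_mem_times P) (-G'),
    ae_oneParticle_of_ae (p := fun x => arakiFun P 0 (G : Lp ℂ 2 (timeZeroMeasure P)) x +
        arakiFun P (P.β / 2) (-G' : Lp ℂ 2 (timeZeroMeasure P)) x = z x) key]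
    with x h1 h2 h3 h4
  refine h1.trans ?_
  rw [Pi.add_apply, h2, h3]
  exact h4

theorem measurePreserving_reflect :
    MeasurePreserving (fun x : Bool × Mom P => (x.1, -x.2)) (oneParticleMeasure P)
      (oneParticleMeasure P) := by
  have hm : Measurable fun x : Bool × Mom P => (x.1, -x.2) := by fun_prop
  refine ⟨hm, ?_⟩
  ext A hA
  rw [Measure.map_apply hm hA, ← lintegral_indicator_one (hm hA), ← lintegral_indicator_one hA,
    lintegral_oneParticle (measurable_one.indicator (hm hA)),
    lintegral_oneParticle (measurable_one.indicator hA), ← lintegral_neg_eq_self]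
  refine lintegral_congr fun k => ?_
  have e : oneParticleSymbol P (-k) = oneParticleSymbol P k := by
    simp only [oneParticleSymbol, disp, norm_neg]
  have h : ∀ b, ((fun x : Bool × Mom P => (x.1, -x.2)) ⁻¹' A).indicator (1 : Bool × Mom P → ℝ≥0∞)
      (b, -k) = A.indicator 1 (b, k) := fun b => by
    change A.indicator 1 (b, - -k) = _
    rw [neg_neg]
  rw [e, h, h]

/-- Cutting a hermitian vector off to `ρ ≤ N` makes it a boundary vector, and the cutoffs converge
to it. The hermitian vectors span everything over the complex numbers. -/
theorem boundaryVector_total :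
    (Submodule.span ℂ (Set.range (boundaryVector (P := P)))).topologicalClosure = ⊤ := by
  set S := (Submodule.span ℂ (Set.range (boundaryVector (P := P)))).topologicalClosure with hS
  have hSc : IsClosed (S : Set (Lp ℂ 2 (oneParticleMeasure P))) := Submodule.isClosed_topologicalClosure _
  have herm : ∀ z : Lp ℂ 2 (oneParticleMeasure P),
      (∀ᵐ k : Mom P, ∀ b, z (b, -k) = conj (z (b, k))) → z ∈ S := by
    intro z hz
    have hA : ∀ N : ℕ, MeasurableSet {x : Bool × Mom P | rho P x.2 ≤ N} := fun N =>
      measurableSet_le ((measurable_rho P).comp measurable_snd) measurable_const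
    have hL : ∀ N : ℕ, MemLp ({x : Bool × Mom P | rho P x.2 ≤ N}.indicator z) 2
      (oneParticleMeasure P) := fun N => (Lp.memLp z).indicator (hA N)
    have hae : ∀ N : ℕ, ∀ᵐ k : Mom P, ∀ b, (hL N).toLp _ (b, k) =
        {x : Bool × Mom P | rho P x.2 ≤ N}.indicator z (b, k) := fun N =>
      ae_of_ae_oneParticle (hL N).coeFn_toLp
    have hmem : ∀ N : ℕ, (hL N).toLp _ ∈ S := by
      intro N
      obtain ⟨p, hp⟩ := exists_boundaryVector_eq (z := (hL N).toLp _) (N := N) (by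
        filter_upwards [hae N, ae_volume_neg (hae N), hz] with k h1 h2 h3
        intro b
        have hrn : rho P (-k) = rho P k := by simp only [rho, disp, norm_neg]
        rw [h1, h2]
        by_cases h : rho P k ≤ N
        · rw [Set.indicator_of_mem (show (b, -k) ∈ {x : Bool × Mom P | rho P x.2 ≤ N} by
            change rho P (-k) ≤ N; rwa [hrn]),
            Set.indicator_of_mem (show (b, k) ∈ {x : Bool × Mom P | rho P x.2 ≤ N} from h), h3]
        · rw [Set.indicator_of_notMem (show (b, -k) ∉ {x : Bool × Mom P | rho P x.2 ≤ N} by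
            change ¬ rho P (-k) ≤ N; rwa [hrn]),
            Set.indicator_of_notMem (show (b, k) ∉ {x : Bool × Mom P | rho P x.2 ≤ N} from h), map_zero])
        (by
        filter_upwards [hae N] with k h1
        intro b h
        rw [h1, Set.indicator_of_notMem]
        exact not_le.mpr h)
      exact hp ▸ Submodule.le_topologicalClosure _ (Submodule.subset_span ⟨p, rfl⟩)
    refine hSc.mem_of_tendsto (tendsto_Lp_two_of_dominated (τ := z) (C := 1) (fun N => ?_) ?_)
      (Eventually.of_forall hmem)
    · filter_upwards [(hL N).coeFn_toLp] with x hx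
      rw [hx, one_mul]
      exact norm_indicator_le_norm_self _ _
    · filter_upwards [ae_all_iff.mpr fun N => (hL N).coeFn_toLp] with x hx
      refine tendsto_const_nhds.congr' ?_
      filter_upwards [eventually_ge_atTop ⌈rho P x.2⌉₊] with N hN
      rw [hx, Set.indicator_of_mem]
      have h : rho P x.2 ≤ N := (Nat.le_ceil _).trans (by exact_mod_cast hN)
      exact h
  rw [Submodule.eq_top_iff']
  intro z
  -- This is the antilinear involution `R` whose fixed points are the hermitian vectors. Both `z +
  -- Rz` and `i(z - Rz)` are fixed by it, and `z` is a combination of them.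
  have hR : MemLp (fun x : Bool × Mom P => conj (z (x.1, -x.2))) 2 (oneParticleMeasure P) :=
    ((Lp.memLp z).comp_measurePreserving measurePreserving_reflect).star
  have hRc := ae_of_ae_oneParticle hR.coeFn_toLp
  have hadd := ae_of_ae_oneParticle (Lp.coeFn_add z (hR.toLp _))
  have hsub := ae_of_ae_oneParticle (Lp.coeFn_sub z (hR.toLp _))
  have hsm := ae_of_ae_oneParticle (Lp.coeFn_smul Complex.I (z - hR.toLp _))
  have h1 : z + hR.toLp _ ∈ S := herm _ (by
    filter_upwards [hadd, ae_volume_neg hadd, hRc, ae_volume_neg hRc] with k e1 e2 e3 e4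
    intro b
    rw [e1, e2, Pi.add_apply, Pi.add_apply, e3, e4]
    simp only [neg_neg, map_add, Complex.conj_conj]
    ring)
  have h2 : Complex.I • (z - hR.toLp _) ∈ S := herm _ (by
    filter_upwards [hsub, ae_volume_neg hsub, hRc, ae_volume_neg hRc, hsm, ae_volume_neg hsm]
      with k e1 e2 e3 e4 e5 e6
    intro b
    rw [e5, e6, Pi.smul_apply, Pi.smul_apply, e1, e2, Pi.sub_apply, Pi.sub_apply, e3, e4]
    simp only [neg_neg, map_sub, Complex.conj_conj, smul_eq_mul, map_mul, Complex.conj_I]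
    ring)
  have h3 : z = (2⁻¹ : ℂ) • (z + hR.toLp _) + (-(Complex.I * 2⁻¹)) • (Complex.I • (z - hR.toLp _)) := by
    rw [smul_smul, show -(Complex.I * 2⁻¹) * Complex.I = (2⁻¹ : ℂ) by
      rw [neg_mul, mul_right_comm, Complex.I_mul_I]; ring, ← smul_add]
    rw [show z + hR.toLp _ + (z - hR.toLp _) = (2 : ℂ) • z by rw [two_smul]; abel, smul_smul]
    norm_num
  rw [h3]
  exact S.add_mem (S.smul_mem _ h1) (S.smul_mem _ h2)

end Total

/-! ### Exponentials of the field -/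

section CharField

variable {P : Params}

/-- The function `e^{iφ(f)}`. -/
def charField (f : TestSpace P) (φ : PathSpace P) : ℂ := Complex.exp (Complex.I * pathField f φ)

theorem measurable_charField (f : TestSpace P) : Measurable (charField f) := by
  have := measurable_pathField f
  unfold charField
  fun_prop

theorem norm_charField (f : TestSpace P) (φ : PathSpace P) : ‖charField f φ‖ = 1 := by
  unfold charField
  rw [mul_comm, Complex.norm_exp_ofReal_mul_I]

theorem pathField_add (f f' : TestSpace P) (φ : PathSpace P) :
    pathField (f + f') φ = pathField f φ + pathField f' φ :=
  map_add (show Module.Dual ℝ (TestSpace P) from φ) f f'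

theorem pathField_smul (c : ℝ) (f : TestSpace P) (φ : PathSpace P) :
    pathField (c • f) φ = c * pathField f φ :=
  map_smul (show Module.Dual ℝ (TestSpace P) from φ) c f

theorem pathField_neg (f : TestSpace P) (φ : PathSpace P) : pathField (-f) φ = -pathField f φ :=
  map_neg (show Module.Dual ℝ (TestSpace P) from φ) f

theorem pathField_zero (φ : PathSpace P) : pathField (0 : TestSpace P) φ = 0 :=
  map_zero (show Module.Dual ℝ (TestSpace P) from φ)

theorem charField_add (f f' : TestSpace P) (φ : PathSpace P) :
    charField (f + f') φ = charField f φ * charField f' φ := by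
  unfold charField
  rw [pathField_add, ← Complex.exp_add]
  congr 1; push_cast; ring

theorem charField_neg (f : TestSpace P) (φ : PathSpace P) :
    charField (-f) φ = conj (charField f φ) := by
  unfold charField
  rw [pathField_neg, ← Complex.exp_conj]
  congr 1
  simp

theorem charField_zero (φ : PathSpace P) : charField (0 : TestSpace P) φ = 1 := by
  simp [charField, pathField_zero]

theorem charField_shift (t : ℝ) (f : TestSpace P) (φ : PathSpace P) :
    charField f (shift P t φ) = charField (translate P t f) φ := rfl

theorem measurable_shift (t : ℝ) : Measurable (shift P t) :=
  measurable_to_pathSpace fun f => measurable_pathField (translate P t f)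

theorem shift_shift (s t : ℝ) (φ : PathSpace P) : shift P s (shift P t φ) = shift P (t + s) φ := by
  refine LinearMap.ext fun f => ?_
  change pathField f (shift P s (shift P t φ)) = pathField f (shift P (t + s) φ)
  rw [pathField_shift, pathField_shift, pathField_shift, translate_translate]

/-- The exponentials generate the cylinder `σ`-algebra. -/
theorem cylinder_le_iSup_charField : (inferInstance : MeasurableSpace (PathSpace P)) ≤
    ⨆ f : TestSpace P, MeasurableSpace.comap (charField f) inferInstance := by
  set S : MeasurableSpace (PathSpace P) :=
    ⨆ f : TestSpace P, MeasurableSpace.comap (charField f) inferInstance with hS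
  refine iSup_le fun f => ?_
  have hc : ∀ f : TestSpace P, Measurable[S] (charField f) := fun f =>
    (comap_measurable (charField f)).mono
      (le_iSup (fun f : TestSpace P => MeasurableSpace.comap (charField f) inferInstance) f) le_rfl
  have hm : ∀ n : ℕ, Measurable[S] fun φ : PathSpace P =>
      ((n : ℝ) + 1) * (charField (((n : ℝ) + 1)⁻¹ • f) φ).im := fun n =>
    (Complex.measurable_im.comp (hc _)).const_mul _
  -- An exponential determines the field only modulo `2π`. Small multiples recover it: `(n+1)
  -- sin(φ(f)/(n+1)) → φ(f)`.
  have hl : ∀ φ : PathSpace P, Tendsto (fun n : ℕ =>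
      ((n : ℝ) + 1) * (charField (((n : ℝ) + 1)⁻¹ • f) φ).im) atTop (𝓝 (pathField f φ)) := by
    intro φ
    have hd : HasDerivAt (fun x : ℝ => Real.sin (x * pathField f φ)) (pathField f φ) 0 := by
      have := ((hasDerivAt_id (0 : ℝ)).mul_const (pathField f φ)).sin
      simpa using this
    have h1 : Tendsto (fun n : ℕ => ((n : ℝ) + 1)⁻¹) atTop (𝓝[≠] 0) := by
      refine tendsto_nhdsWithin_iff.mpr ⟨?_, Eventually.of_forall fun n => ?_⟩
      · simpa using tendsto_one_div_add_atTop_nhds_zero_nat (𝕜 := ℝ)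
      · have : (0 : ℝ) < ((n : ℝ) + 1)⁻¹ := by positivity
        exact this.ne'
    have h2 := hd.tendsto_slope_zero.comp h1
    refine h2.congr fun n => ?_
    have h3 : (charField (((n : ℝ) + 1)⁻¹ • f) φ).im =
        Real.sin (((n : ℝ) + 1)⁻¹ * pathField f φ) := by
      rw [charField, pathField_smul, mul_comm Complex.I, Complex.exp_ofReal_mul_I_im]
    rw [h3]
    simp
  have : Measurable[S] (pathField f) :=
    measurable_of_tendsto_metrizable hm (tendsto_pi_nhds.mpr hl)
  exact this.comap_le

/-- A finite measure on path space is determined by its characteristic functional. -/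
theorem eq_of_forall_integral_charField_eq {μ ν : Measure (PathSpace P)} [IsFiniteMeasure μ]
    [IsFiniteMeasure ν] (h : ∀ f : TestSpace P, ∫ φ, charField f φ ∂μ = ∫ φ, charField f φ ∂ν) :
    μ = ν := by
  -- In `L²(μ+ν)` an indicator is a limit of combinations of exponentials, and integration against
  -- `μ` or `ν` is continuous there because both are dominated by the finite measure `μ+ν`.
  have hle1 : μ ≤ μ + ν := Measure.le_add_right le_rfl
  have hle2 : ν ≤ μ + ν := Measure.le_add_left le_rfl
  have hint : ∀ (κ : Measure (PathSpace P)), κ ≤ μ + ν → ∀ F : Lp ℂ 2 (μ + ν), Integrable F κ :=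
    fun κ hκ F => ((Lp.memLp F).integrable (by norm_num)).mono_measure hκ
  have hcont : ∀ (κ : Measure (PathSpace P)), κ ≤ μ + ν →
      Continuous fun F : Lp ℂ 2 (μ + ν) => ∫ φ, F φ ∂κ := by
    intro κ hκ
    rw [continuous_iff_seqContinuous]
    intro F G hFG
    refine tendsto_integral_of_L1' _ (hint κ hκ G).aestronglyMeasurable (Eventually.of_forall fun n => hint κ hκ (F n)) ?_
    have h2 := (Lp.tendsto_Lp_iff_tendsto_eLpNorm' F G).mp hFG
    have h3 : Tendsto (fun n => eLpNorm (⇑(F n) - ⇑G) 2 (μ + ν) *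
        (μ + ν) Set.univ ^ (1 / (1 : ℝ≥0∞).toReal - 1 / (2 : ℝ≥0∞).toReal)) atTop (𝓝 0) := by
      have := ENNReal.Tendsto.mul_const h2 (b := (μ + ν) Set.univ ^ (1 / (1 : ℝ≥0∞).toReal - 1 / (2 : ℝ≥0∞).toReal))
        (Or.inr (ENNReal.rpow_ne_top_of_nonneg (by norm_num) (measure_ne_top _ _)))
      simpa using this
    refine tendsto_of_tendsto_of_tendsto_of_le_of_le tendsto_const_nhds h3 (fun _ => zero_le)
      fun n => ?_
    refine (eLpNorm_mono_measure _ hκ).trans ?_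
    exact eLpNorm_le_eLpNorm_mul_rpow_measure_univ (by norm_num)
      ((Lp.aestronglyMeasurable (F n)).sub (Lp.aestronglyMeasurable G))
  ext A hA
  have hL : MemLp (A.indicator fun _ => (1 : ℂ)) 2 (μ + ν) := (memLp_const 1).indicator hA
  have hS : Measurable[⨆ f : TestSpace P, MeasurableSpace.comap (charField f) inferInstance]
      (A.indicator fun _ => (1 : ℂ)) :=
    (measurable_const.indicator hA).mono cylinder_le_iSup_charField le_rfl
  have hmem := mem_closure_span_of_unitary_system (ν := μ + ν) (e := charField (P := P))
    measurable_charField norm_charField (fun f f' => ⟨f + f', charField_add f f'⟩)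
    (fun f => ⟨-f, charField_neg f⟩) ⟨0, charField_zero⟩ rfl (ψ := hL.toLp _)
    (hS.stronglyMeasurable.aestronglyMeasurable.congr hL.coeFn_toLp.symm)
  have hclosed : IsClosed {F : Lp ℂ 2 (μ + ν) | ∫ φ, F φ ∂μ = ∫ φ, F φ ∂ν} :=
    isClosed_eq (hcont μ hle1) (hcont ν hle2)
  have ha1 : ∀ {p : PathSpace P → Prop}, (∀ᵐ φ ∂(μ + ν), p φ) → ∀ᵐ φ ∂μ, p φ := fun hp =>
    (Measure.absolutelyContinuous_of_le hle1).ae_le hp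
  have ha2 : ∀ {p : PathSpace P → Prop}, (∀ᵐ φ ∂(μ + ν), p φ) → ∀ᵐ φ ∂ν, p φ := fun hp =>
    (Measure.absolutelyContinuous_of_le hle2).ae_le hp
  have hsub : (Submodule.span ℂ {F : Lp ℂ 2 (μ + ν) | ∃ f : TestSpace P, F =ᵐ[μ + ν] charField f} :
      Set (Lp ℂ 2 (μ + ν))) ⊆ {F : Lp ℂ 2 (μ + ν) | ∫ φ, F φ ∂μ = ∫ φ, F φ ∂ν} := by
    intro F hF
    change ∫ φ, F φ ∂μ = ∫ φ, F φ ∂ν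
    induction hF using Submodule.span_induction with
    | mem F hF =>
      obtain ⟨f, hf⟩ := hF
      rw [integral_congr_ae (ha1 hf), integral_congr_ae (ha2 hf), h]
    | zero =>
      have := Lp.coeFn_zero ℂ 2 (μ + ν)
      rw [integral_congr_ae (ha1 this), integral_congr_ae (ha2 this)]; simp
    | add F G _ _ hF hG =>
      have := Lp.coeFn_add F G
      rw [integral_congr_ae (ha1 this), integral_congr_ae (ha2 this)]
      simp only [Pi.add_apply]
      rw [integral_add (hint μ hle1 F) (hint μ hle1 G), integral_add (hint ν hle2 F) (hint ν hle2 G),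
        hF, hG]
    | smul c F _ hF =>
      have := Lp.coeFn_smul c F
      rw [integral_congr_ae (ha1 this), integral_congr_ae (ha2 this)]
      simp only [Pi.smul_apply]
      rw [integral_smul, integral_smul, hF]
  have hfin : ∫ φ, hL.toLp _ φ ∂μ = ∫ φ, hL.toLp _ φ ∂ν := hclosed.closure_subset_iff.mpr hsub hmem
  rw [integral_congr_ae (ha1 hL.coeFn_toLp), integral_congr_ae (ha2 hL.coeFn_toLp),
    integral_indicator_const _ hA, integral_indicator_const _ hA] at hfin
  have hr : μ.real A = ν.real A := by
    have := congrArg Complex.re hfin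
    simpa using this
  exact (measureReal_eq_measureReal_iff).mp hr

variable {μ : Measure (PathSpace P)} [IsProbabilityMeasure μ]

/-- Translation multiplies Fourier coefficients by phases, so it preserves `q` and with it the
characteristic functional. -/
theorem measurePreserving_shift (hμ : IsGaussianPathMeasure P μ) (t : ℝ) :
    MeasurePreserving (shift P t) μ μ := by
  refine ⟨measurable_shift t, ?_⟩
  have := Measure.isProbabilityMeasure_map (μ := μ) (measurable_shift (P := P) t).aemeasurable
  refine eq_of_forall_integral_charField_eq fun f => ?_
  rw [integral_map (measurable_shift t).aemeasurable (measurable_charField f).aestronglyMeasurable]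
  simp only [charField_shift]
  have h1 := hμ (translate P t f)
  have h2 := hμ f
  rw [covForm_translate] at h1
  exact h1.trans h2.symm

/-! ### The exponentials in `L²` -/

theorem memLp_charField (μ : Measure (PathSpace P)) [IsProbabilityMeasure μ] (f : TestSpace P) (p : ℝ≥0∞) :
    MemLp (charField f) p μ :=
  MemLp.of_bound (measurable_charField f).aestronglyMeasurable 1
    (Eventually.of_forall fun φ => (norm_charField f φ).le)

/-- The function `e^{iφ(f)}` as an element of `L²`. -/
def charLp (μ : Measure (PathSpace P)) [IsProbabilityMeasure μ] (f : TestSpace P) : Lp ℂ 2 μ :=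
  (memLp_charField μ f 2).toLp _

theorem coeFn_charLp (f : TestSpace P) : charLp μ f =ᵐ[μ] charField f :=
  (memLp_charField μ f 2).coeFn_toLp

/-- The integrand is `e^{iφ(f'-f)}`, and `q(f'-f)` is expanded by polarization. -/
theorem inner_charLp (hμ : IsGaussianPathMeasure P μ) (f f' : TestSpace P) :
    inner ℂ (charLp μ f) (charLp μ f') = Complex.exp (-(covForm P f : ℂ) / 4 - covForm P f' / 4 +
      inner ℂ (f : Lp ℂ 2 (covMeasure P)) (f' : Lp ℂ 2 (covMeasure P)) / 2) := by
  have e : ∫ φ, charField (-f + f') φ ∂μ = _ := hμ (-f + f')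
  have h1 := covForm_add (-f) f'
  rw [covForm_neg, Submodule.coe_neg, inner_neg_left] at h1
  rw [h1] at e
  rw [L2.inner_def]
  refine Eq.trans (integral_congr_ae ?_) (e.trans ?_)
  · filter_upwards [coeFn_charLp (μ := μ) f, coeFn_charLp (μ := μ) f'] with φ h1 h2
    rw [h1, h2, charField_add, charField_neg]
    simp [RCLike.inner_apply, mul_comm]
  · congr 1
    ring

end CharField

/-! ### Subgroups of sharp-time test functions and their `σ`-algebras -/

section TimeGroups

variable {P : Params}

theorem sharpTimeZero_add (g g' : TimeZeroSpace P) :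
    sharpTimeZero P (g + g') = sharpTimeZero P g + sharpTimeZero P g' := by
  apply Subtype.ext
  apply Lp.ext
  have h0 : ∀ᵐ x ∂(covMeasure P), ((g + g' : TimeZeroSpace P) : Lp ℂ 2 (timeZeroMeasure P)) x.2 =
      (g : Lp ℂ 2 (timeZeroMeasure P)) x.2 + (g' : Lp ℂ 2 (timeZeroMeasure P)) x.2 :=
    ae_of_ae_snd .count (q := fun k => ((g + g' : TimeZeroSpace P) : Lp ℂ 2 (timeZeroMeasure P)) k =
      (g : Lp ℂ 2 (timeZeroMeasure P)) k + (g' : Lp ℂ 2 (timeZeroMeasure P)) k)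
      (ae_timeZero_iff.mp (Lp.coeFn_add (g : Lp ℂ 2 (timeZeroMeasure P)) g'))
  filter_upwards [(memLp_sharpTime P (g + g' : TimeZeroSpace P)).coeFn_toLp,
    (memLp_sharpTime P g).coeFn_toLp, (memLp_sharpTime P g').coeFn_toLp,
    Lp.coeFn_add (sharpTimeZero P g : Lp ℂ 2 (covMeasure P)) (sharpTimeZero P g'), h0]
    with x h1 h2 h3 h4 h5
  refine h1.trans (Eq.trans ?_ h4.symm)
  rw [h5, mul_add]
  exact (congrArg₂ _ h2 h3).symm

/-- The map `g ↦ δ_s ⊗ g`. -/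
def sharpHom (s : ℝ) : TimeZeroSpace P →+ TestSpace P :=
  AddMonoidHom.mk' (sharpAt s) fun g g' => by
    unfold sharpAt
    rw [sharpTimeZero_add, map_add]

theorem sharpHom_apply (s : ℝ) (g : TimeZeroSpace P) : sharpHom s g = sharpAt s g := rfl

/-- The group of test functions generated by the sharp-time test functions at times in `I`. -/
def timeGroup (P : Params) (I : Set ℝ) : AddSubgroup (TestSpace P) :=
  AddSubgroup.closure {f | ∃ s ∈ I, ∃ g, f = sharpAt s g}

theorem sigmaAt_eq (s : ℝ) : sigmaAt P s =
    ⨆ g : TimeZeroSpace P, MeasurableSpace.comap (charField (sharpAt s g)) inferInstance := by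
  rw [sigmaAt, sigmaZero, MeasurableSpace.comap_iSup]
  refine iSup_congr fun g => ?_
  rw [MeasurableSpace.comap_comp]
  rfl

theorem measurable_charField_of_mem {I : Set ℝ} {f : TestSpace P} (hf : f ∈ timeGroup P I) :
    Measurable[sigmaOn P I] (charField f) := by
  induction hf using AddSubgroup.closure_induction with
  | mem f hf =>
    obtain ⟨s, hs, g, rfl⟩ := hf
    refine (comap_measurable (charField (sharpAt s g))).mono ?_ le_rfl
    refine le_trans ?_ (le_iSup₂ (f := fun t (_ : t ∈ I) => sigmaAt P t) s hs)
    rw [sigmaAt_eq]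
    exact le_iSup (fun g : TimeZeroSpace P =>
      MeasurableSpace.comap (charField (sharpAt s g)) inferInstance) g
  | zero =>
    have : charField (0 : TestSpace P) = fun _ => 1 := funext charField_zero
    rw [this]; exact measurable_const
  | add f f' _ _ h h' =>
    have : charField (f + f') = fun φ => charField f φ * charField f' φ :=
      funext (charField_add f f')
    rw [this]; exact h.mul h'
  | neg f _ h =>
    have : charField (-f) = fun φ => conj (charField f φ) := funext (charField_neg f)
    rw [this]; exact Complex.continuous_conj.measurable.comp h

theorem sigmaOn_le (I : Set ℝ) : sigmaOn P I ≤
    ⨆ f : timeGroup P I, MeasurableSpace.comap (charField (f : TestSpace P)) inferInstance := by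
  refine iSup₂_le fun s hs => ?_
  rw [sigmaAt_eq]
  refine iSup_le fun g => ?_
  exact le_iSup (fun f : timeGroup P I => MeasurableSpace.comap (charField (f : TestSpace P)) inferInstance)
    ⟨sharpAt s g, AddSubgroup.subset_closure ⟨s, hs, g, rfl⟩⟩

theorem sigmaZero_eq : sigmaZero P = sigmaOn P {0} := by
  have h : sigmaZero P = sigmaAt P 0 := by rw [sigmaAt, shift_zero, MeasurableSpace.comap_id]
  rw [h, sigmaOn, iSup_singleton]

theorem sigmaOn_le_cylinder (I : Set ℝ) : sigmaOn P I ≤ (inferInstance : MeasurableSpace (PathSpace P)) :=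
  (sigmaOn_le I).trans (iSup_le fun f => (measurable_charField (f : TestSpace P)).comap_le)

variable {μ : Measure (PathSpace P)} [IsProbabilityMeasure μ]

/-- A group of test functions gives exponentials closed under products and conjugation, so the
density theorem applies. Continuous identities for functions of the fields at times in `I` need then
be checked only on exponentials. -/
theorem mem_closure_span_charLp {I : Set ℝ} {ψ : Lp ℂ 2 μ}
    (hψ : AEStronglyMeasurable[sigmaOn P I] ψ μ) :
    ψ ∈ (Submodule.span ℂ (charLp μ '' (timeGroup P I : Set (TestSpace P)))).topologicalClosure := by
  have h := mem_closure_span_of_unitary_system (ν := μ)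
    (e := fun f : timeGroup P I => charField (f : TestSpace P))
    (fun f => measurable_charField _) (fun f => norm_charField _)
    (fun f f' => ⟨f + f', charField_add _ _⟩) (fun f => ⟨-f, charField_neg _⟩)
    ⟨0, charField_zero⟩ rfl (hψ.mono (sigmaOn_le I))
  refine closure_mono ?_ h
  refine Submodule.span_mono ?_
  rintro F ⟨f, hf⟩
  exact ⟨f, f.2, Lp.ext ((coeFn_charLp _).trans hf.symm)⟩

theorem charLp_mem_lpMeas {I : Set ℝ} {f : TestSpace P} (hf : f ∈ timeGroup P I) :
    charLp μ f ∈ lpMeas ℂ ℂ (sigmaOn P I) 2 μ := by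
  rw [mem_lpMeas_iff_aestronglyMeasurable]
  exact (measurable_charField_of_mem hf).stronglyMeasurable.aestronglyMeasurable.congr
    (coeFn_charLp f).symm

end TimeGroups

/-! ### One-particle vectors representing test functions -/

section Represents

variable {P : Params}

/-- `g ↦ araki g` as a real linear map. -/
def arakiLin {s : ℝ} (hs : s ∈ Set.Icc 0 (P.β / 2)) :
    TimeZeroSpace P →ₗ[ℝ] Lp ℂ 2 (oneParticleMeasure P) where
  toFun g := araki hs g
  map_add' g g' := by
    apply Lp.ext
    have h : ∀ᵐ x ∂(oneParticleMeasure P),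
        ((g + g' : TimeZeroSpace P) : Lp ℂ 2 (timeZeroMeasure P)) x.2 =
          (g : Lp ℂ 2 (timeZeroMeasure P)) x.2 + (g' : Lp ℂ 2 (timeZeroMeasure P)) x.2 :=
      ae_oneParticle_of_ae (p := fun x => ((g + g' : TimeZeroSpace P) : Lp ℂ 2 (timeZeroMeasure P)) x.2 =
          (g : Lp ℂ 2 (timeZeroMeasure P)) x.2 + (g' : Lp ℂ 2 (timeZeroMeasure P)) x.2) (by
        filter_upwards [ae_timeZero_iff.mp (Lp.coeFn_add (g : Lp ℂ 2 (timeZeroMeasure P)) g')]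
          with k hk
        exact fun _ => hk)
    filter_upwards [h, Lp.coeFn_add (araki hs g) (araki hs g'), coeFn_araki hs g, coeFn_araki hs g',
      coeFn_araki hs (g + g' : TimeZeroSpace P)] with x h1 h2 h3 h4 h5
    rw [h5, h2, Pi.add_apply, h3, h4]
    simp only [arakiFun, h1, map_add]
    split_ifs <;> ring
  map_smul' c g := by
    apply Lp.ext
    have h : ∀ᵐ x ∂(oneParticleMeasure P),
        ((c • g : TimeZeroSpace P) : Lp ℂ 2 (timeZeroMeasure P)) x.2 =
          c • (g : Lp ℂ 2 (timeZeroMeasure P)) x.2 :=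
      ae_oneParticle_of_ae (p := fun x => ((c • g : TimeZeroSpace P) : Lp ℂ 2 (timeZeroMeasure P)) x.2 =
          c • (g : Lp ℂ 2 (timeZeroMeasure P)) x.2) (by
        filter_upwards [ae_timeZero_iff.mp (Lp.coeFn_smul c (g : Lp ℂ 2 (timeZeroMeasure P)))]
          with k hk
        exact fun _ => hk)
    filter_upwards [h, Lp.coeFn_smul c (araki hs g), coeFn_araki hs g,
      coeFn_araki hs (c • g : TimeZeroSpace P)] with x h1 h2 h3 h4
    rw [h4, RingHom.id_apply, h2, Pi.smul_apply, h3]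
    simp only [arakiFun, h1, Complex.real_smul, map_mul, Complex.conj_ofReal]
    split_ifs <;> ring

/-- The test function `δ_0 ⊗ g + δ_{β/2} ⊗ g'`. -/
def boundaryTest (p : TimeZeroSpace P × TimeZeroSpace P) : TestSpace P :=
  sharpAt 0 p.1 + sharpAt (P.β / 2) p.2

/-- The vector `z` represents the test function `f` if its inner products with all boundary
vectors agree with those of `f` with the boundary test functions. -/
def Represents (f : TestSpace P) (z : Lp ℂ 2 (oneParticleMeasure P)) : Prop :=
  ∀ p, inner ℂ (boundaryVector p) z =
    inner ℂ (boundaryTest p : Lp ℂ 2 (covMeasure P)) (f : Lp ℂ 2 (covMeasure P))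

theorem Represents.zero : Represents (0 : TestSpace P) 0 := fun p => by simp

theorem Represents.add {f f' : TestSpace P} {z z' : Lp ℂ 2 (oneParticleMeasure P)}
    (h : Represents f z) (h' : Represents f' z') : Represents (f + f') (z + z') := fun p => by
  rw [inner_add_right, h, h', Submodule.coe_add, inner_add_right]

theorem Represents.neg {f : TestSpace P} {z : Lp ℂ 2 (oneParticleMeasure P)}
    (h : Represents f z) : Represents (-f) (-z) := fun p => by
  rw [inner_neg_right, h, Submodule.coe_neg, inner_neg_right]

/-- A one-particle form of the Markov property: an interior time is seen from the boundary only
through the vector `e^{-sL} z_0(g)`. -/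
theorem represents_sharpAt {s : ℝ} (hs : s ∈ Set.Icc 0 (P.β / 2)) (g : TimeZeroSpace P) :
    Represents (sharpAt s g) (araki hs g) := fun p => by
  rw [boundaryVector, boundaryTest, Submodule.coe_add, inner_add_left, inner_add_left,
    inner_araki_eq_inner_sharpAt (Or.inl rfl), inner_araki_eq_inner_sharpAt (Or.inr rfl)]

theorem represents_boundary (p : TimeZeroSpace P × TimeZeroSpace P) :
    Represents (boundaryTest p) (boundaryVector p) :=
  (represents_sharpAt _ _).add (represents_sharpAt _ _)

theorem sharpAt_zero_right (s : ℝ) : sharpAt s (0 : TimeZeroSpace P) = 0 := map_zero (sharpHom s)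

theorem boundaryVector_left (g : TimeZeroSpace P) : boundaryVector (g, 0) = leftArakiWoods P g := by
  have h : araki (half_mem_times P) ((0 : TimeZeroSpace P) : Lp ℂ 2 (timeZeroMeasure P)) = 0 :=
    map_zero (arakiLin (half_mem_times P))
  rw [boundaryVector, araki_zero, h, add_zero]

theorem boundaryTest_left (g : TimeZeroSpace P) : boundaryTest (g, 0) = sharpTimeZero P g := by
  rw [boundaryTest, sharpAt_zero, sharpAt_zero_right, add_zero]

theorem boundaryTest_mem (p : TimeZeroSpace P × TimeZeroSpace P) :
    boundaryTest p ∈ timeGroup P {0, P.β / 2} :=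
  add_mem (AddSubgroup.subset_closure ⟨0, by simp, p.1, rfl⟩)
    (AddSubgroup.subset_closure ⟨P.β / 2, by simp, p.2, rfl⟩)

theorem exists_boundaryTest_eq {f : TestSpace P} (hf : f ∈ timeGroup P {0, P.β / 2}) :
    ∃ p, f = boundaryTest p := by
  have hle : timeGroup P {0, P.β / 2} ≤ AddMonoidHom.range
      ((sharpHom (P := P) 0).coprod (sharpHom (P.β / 2))) := by
    refine (AddSubgroup.closure_le _).mpr ?_
    rintro _ ⟨s, hs | hs, g, rfl⟩
    · refine ⟨(g, 0), ?_⟩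
      rw [hs]; simp [sharpHom_apply, sharpAt_zero_right]
    · refine ⟨(0, g), ?_⟩
      rw [Set.mem_singleton_iff.mp hs]; simp [sharpHom_apply, sharpAt_zero_right]
  obtain ⟨p, hp⟩ := hle hf
  exact ⟨p, hp.symm⟩

theorem exists_sharpTimeZero_eq {f : TestSpace P} (hf : f ∈ timeGroup P {0}) :
    ∃ g, f = sharpTimeZero P g := by
  have hle : timeGroup P {0} ≤ AddMonoidHom.range (sharpHom (P := P) 0) := by
    refine (AddSubgroup.closure_le _).mpr ?_
    rintro _ ⟨s, hs, g, rfl⟩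
    exact ⟨g, by rw [Set.mem_singleton_iff.mp hs, sharpHom_apply]⟩
  obtain ⟨g, hg⟩ := hle hf
  exact ⟨g, by rw [← hg, sharpHom_apply, sharpAt_zero]⟩

end Represents

/-! ### The embedding of Fock space into `L²` of path space -/

section Embedding

variable {P : Params}

/-- The constant `i/√2`. -/
def segalConst : ℂ := Complex.I / (Real.sqrt 2 : ℝ)

theorem segalConst_mul_self : segalConst * segalConst = -(1 / 2) := by
  have h2 : (Real.sqrt 2 : ℂ) * Real.sqrt 2 = 2 := by
    rw [← Complex.ofReal_mul, Real.mul_self_sqrt (by norm_num)]; norm_num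
  rw [segalConst, div_mul_div_comm, Complex.I_mul_I, h2]
  ring

theorem conj_segalConst_mul : conj segalConst * segalConst = 1 / 2 := by
  have h : conj segalConst = -segalConst := by
    simp [segalConst, neg_div]
  rw [h, neg_mul, segalConst_mul_self, neg_neg]

theorem segalConst_ne_zero : segalConst ≠ 0 := fun h => by
  have := segalConst_mul_self
  rw [h] at this
  norm_num at this

/-- The vectors `c • boundaryVector p` form a real subspace, being the range of a real linear map,
and the nonzero factor `c` does not change their complex span. -/
theorem coherent_boundary_total : (Submodule.span ℂ (Set.range
    fun p : TimeZeroSpace P × TimeZeroSpace P => coherent (segalConst • boundaryVector p))).topologicalClosure = ⊤ := by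
  let K : Submodule ℝ (Lp ℂ 2 (oneParticleMeasure P)) := LinearMap.range
    (segalConst • (arakiLin (zero_mem_times P)).coprod (arakiLin (half_mem_times P)))
  have hK : (K : Set (Lp ℂ 2 (oneParticleMeasure P))) =
      Set.range fun p => segalConst • boundaryVector p := rfl
  have h := coherent_total (K := K) (by
    rw [hK, eq_top_iff, ← boundaryVector_total]
    refine Submodule.topologicalClosure_mono (Submodule.span_le.mpr ?_)
    rintro _ ⟨p, rfl⟩
    have h1 := Submodule.smul_mem _ segalConst⁻¹ (Submodule.subset_span (R := ℂ)
      (Set.mem_range_self (f := fun p => segalConst • boundaryVector p) p))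
    rwa [inv_smul_smul₀ segalConst_ne_zero] at h1)
  rwa [hK, ← Set.range_comp] at h

variable {μ : Measure (PathSpace P)}

theorem isClosed_lpMeas (I : Set ℝ) :
    IsClosed (lpMeas ℂ ℂ (sigmaOn P I) 2 μ : Set (Lp ℂ 2 μ)) := by
  have : Fact (sigmaOn P I ≤ (inferInstance : MeasurableSpace (PathSpace P))) := ⟨sigmaOn_le_cylinder I⟩
  have h : CompleteSpace (lpMeas ℂ ℂ (sigmaOn P I) 2 μ) := inferInstance
  exact (completeSpace_coe_iff_isComplete.mp h).isClosed

theorem coeFn_mulOp (G : TimeZeroAlgebra P μ) (F : PhysSpace P μ) :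
    (mulOp G F : Lp ℂ 2 μ) =ᵐ[μ] fun φ => (G : Lp ℂ ∞ μ) φ * (F : Lp ℂ 2 μ) φ :=
  (ContinuousLinearMap.mul ℂ ℂ).coeFn_holder _ _

theorem transport_apply (T : PhysSpace P μ ≃ₗᵢ[ℂ] ThermalFock P) (A : PhysSpace P μ →L[ℂ] PhysSpace P μ)
    (ξ : ThermalFock P) : transport T A ξ = T (A (T.symm ξ)) := rfl

variable [IsProbabilityMeasure μ]

/-- By `|i/√2|² = 1/2`, both Gram matrices have entries `exp(⟨f, f'⟩/2)`. The factors `e^{q/4}`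
remove the Gaussian normalization of the exponentials. -/
theorem exists_embedding (hμ : IsGaussianPathMeasure P μ) :
    ∃ J : ThermalFock P →ₗᵢ[ℂ] Lp ℂ 2 μ, ∀ p, J (coherent (segalConst • boundaryVector p)) =
      Complex.exp ((covForm P (boundaryTest p) : ℂ) / 4) • charLp μ (boundaryTest p) := by
  refine exists_linearIsometry_of_gram coherent_boundary_total fun p p' => ?_
  rw [inner_smul_left, inner_smul_right, inner_charLp hμ, inner_coherent, inner_smul_left,
    inner_smul_right, ← Complex.exp_conj, ← Complex.exp_add, ← Complex.exp_add, ← mul_assoc,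
    conj_segalConst_mul, represents_boundary p' p, map_div₀, Complex.conj_ofReal, Complex.conj_ofNat]
  congr 1
  ring

/-- The isometric embedding of Fock space into `L²(Q, μ)` with range `L²(Q, 𝔖_{{0, β/2}}, μ)`. -/
def embedding (hμ : IsGaussianPathMeasure P μ) : ThermalFock P →ₗᵢ[ℂ] Lp ℂ 2 μ :=
  (exists_embedding hμ).choose

theorem embedding_coherent (hμ : IsGaussianPathMeasure P μ) (p : TimeZeroSpace P × TimeZeroSpace P) :
    embedding hμ (coherent (segalConst • boundaryVector p)) =
      Complex.exp ((covForm P (boundaryTest p) : ℂ) / 4) • charLp μ (boundaryTest p) :=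
  (exists_embedding hμ).choose_spec p

/-- The adjoint of the embedding of Fock space into `L²(Q, μ)`. -/
def projection (hμ : IsGaussianPathMeasure P μ) : Lp ℂ 2 μ →L[ℂ] ThermalFock P :=
  ContinuousLinearMap.adjoint (embedding hμ).toContinuousLinearMap

theorem inner_projection (hμ : IsGaussianPathMeasure P μ) (ξ : ThermalFock P) (F : Lp ℂ 2 μ) :
    inner ℂ ξ (projection hμ F) = inner ℂ (embedding hμ ξ) F :=
  ContinuousLinearMap.adjoint_inner_right _ _ _

theorem projection_embedding (hμ : IsGaussianPathMeasure P μ) (ξ : ThermalFock P) :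
    projection hμ (embedding hμ ξ) = ξ :=
  ext_inner_left ℂ fun η => by rw [inner_projection, LinearIsometry.inner_map_map]

theorem eq_of_inner_coherent_boundary {ξ η : ThermalFock P}
    (h : ∀ p, inner ℂ (coherent (segalConst • boundaryVector p)) ξ =
      inner ℂ (coherent (segalConst • boundaryVector p)) η) : ξ = η := by
  have e := clm_ext_of_total coherent_boundary_total (A := innerSL ℂ ξ) (B := innerSL ℂ η) (by
    rintro _ ⟨p, rfl⟩
    rw [innerSL_apply_apply, innerSL_apply_apply, ← inner_conj_symm, h, inner_conj_symm])
  exact ext_inner_right ℂ fun ζ => congrArg (fun A => A ζ) e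

/-- Tested against the total family of boundary coherent vectors, the left side involves `f` only
through its covariance with boundary test functions and through `q(f)`. The first is encoded in `z`;
the second, which need not equal `‖z‖²`, survives as the prefactor. -/
theorem projection_charLp (hμ : IsGaussianPathMeasure P μ) {f : TestSpace P}
    {z : Lp ℂ 2 (oneParticleMeasure P)} (h : Represents f z) :
    projection hμ (charLp μ f) =
      Complex.exp (-(covForm P f : ℂ) / 4) • coherent (segalConst • z) := by
  refine eq_of_inner_coherent_boundary fun p => ?_
  rw [inner_projection, embedding_coherent, inner_smul_left, inner_smul_right, inner_charLp hμ,
    inner_coherent, inner_smul_left, inner_smul_right, ← Complex.exp_conj, ← Complex.exp_add,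
    ← Complex.exp_add, ← mul_assoc, conj_segalConst_mul, h p, map_div₀, Complex.conj_ofReal,
    Complex.conj_ofNat]
  congr 1
  ring

/-- Weyl operators act on the projections of exponentials by multiplication. -/
theorem IsWeylOperator.apply_projection (hμ : IsGaussianPathMeasure P μ) {g : TimeZeroSpace P}
    {W : ThermalFock P →L[ℂ] ThermalFock P} (hW : IsWeylOperator (leftArakiWoods P g) W)
    {f : TestSpace P} {z : Lp ℂ 2 (oneParticleMeasure P)} (h : Represents f z) :
    W (projection hμ (charLp μ f)) = projection hμ (charLp μ (f + sharpTimeZero P g)) := by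
  have hg : Represents (sharpTimeZero P g) (leftArakiWoods P g) := by
    rw [← boundaryVector_left, ← boundaryTest_left]; exact represents_boundary _
  have e1 : inner ℂ (leftArakiWoods P g) z =
      inner ℂ (f : Lp ℂ 2 (covMeasure P)) (sharpTimeZero P g : Lp ℂ 2 (covMeasure P)) := by
    rw [← boundaryVector_left, h, boundaryTest_left, ← conj_inner_testSpace, inner_conj_symm]
  have e2 : ((‖leftArakiWoods P g‖ ^ 2 : ℝ) : ℂ) = covForm P (sharpTimeZero P g) := by
    have h1 := hg (g, 0)
    rw [boundaryVector_left, boundaryTest_left, inner_self_eq_norm_sq_to_K,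
      inner_self_eq_norm_sq_to_K] at h1
    rw [covForm_eq_norm_sq]
    exact_mod_cast h1
  rw [projection_charLp hμ h, projection_charLp hμ (h.add hg), map_smul, hW, covForm_add, smul_smul,
    ← Complex.exp_add, e2, smul_add]
  change Complex.exp (_ + (_ + segalConst * inner ℂ _ (segalConst • z))) • _ = _
  -- The Weyl phase becomes `-½⟨f, j_0 g⟩` because `(i/√2)² = -1/2`. This is the cross term of `-q(f
  -- + j_0 g)/4`.
  rw [inner_smul_right, ← mul_assoc, segalConst_mul_self, e1]
  congr 2
  ring

theorem projection_one (hμ : IsGaussianPathMeasure P μ) :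
    projection hμ (charLp μ 0) = vacuum (oneParticleMeasure P) := by
  have h0 : covForm P (0 : TestSpace P) = 0 := by
    rw [covForm_eq_norm_sq]; simp
  rw [projection_charLp hμ Represents.zero, h0, smul_zero]
  simp [vacuum]

theorem coe_thermalOne : (thermalOne P μ : Lp ℂ 2 μ) = charLp μ 0 := by
  apply Lp.ext
  filter_upwards [coeFn_charLp (μ := μ) (0 : TestSpace P), (memLp_const (μ := μ) (p := 2) (1 : ℂ)).coeFn_toLp]
    with φ h1 h2
  rw [h1, charField_zero]
  exact h2

theorem embedding_mem (hμ : IsGaussianPathMeasure P μ) (ξ : ThermalFock P) :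
    embedding hμ ξ ∈ lpMeas ℂ ℂ (sigmaOn P {0, P.β / 2}) 2 μ := by
  have hle : (Submodule.span ℂ (Set.range fun p : TimeZeroSpace P × TimeZeroSpace P =>
      coherent (segalConst • boundaryVector p))).topologicalClosure ≤
      (lpMeas ℂ ℂ (sigmaOn P {0, P.β / 2}) 2 μ).comap (embedding hμ).toLinearMap := by
    refine Submodule.topologicalClosure_minimal _ (Submodule.span_le.mpr ?_)
      ((isClosed_lpMeas _).preimage (embedding hμ).continuous)
    rintro _ ⟨p, rfl⟩
    change embedding hμ _ ∈ lpMeas ℂ ℂ (sigmaOn P {0, P.β / 2}) 2 μ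
    rw [embedding_coherent]
    exact Submodule.smul_mem _ _ (charLp_mem_lpMeas (boundaryTest_mem p))
  exact hle (coherent_boundary_total ▸ Submodule.mem_top)

/-- The range of an isometry is closed. It contains the exponentials of boundary test functions,
hence every square-integrable function of the boundary fields. -/
theorem embedding_projection (hμ : IsGaussianPathMeasure P μ) {F : Lp ℂ 2 μ}
    (hF : AEStronglyMeasurable[sigmaOn P {0, P.β / 2}] F μ) :
    embedding hμ (projection hμ F) = F := by
  have hle : (Submodule.span ℂ (charLp μ '' (timeGroup P {0, P.β / 2} : Set (TestSpace P)))).topologicalClosure ≤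
      LinearMap.range (embedding hμ).toLinearMap := by
    refine Submodule.topologicalClosure_minimal _ (Submodule.span_le.mpr ?_)
      (embedding hμ).isometry.isClosedEmbedding.isClosed_range
    rintro _ ⟨f, hf, rfl⟩
    obtain ⟨p, rfl⟩ := exists_boundaryTest_eq hf
    refine ⟨(Complex.exp ((covForm P (boundaryTest p) : ℂ) / 4))⁻¹ •
      coherent (segalConst • boundaryVector p), ?_⟩
    change embedding hμ _ = _
    rw [map_smul, embedding_coherent, smul_smul, inv_mul_cancel₀ (Complex.exp_ne_zero _), one_smul]
  obtain ⟨ξ, rfl⟩ := hle (mem_closure_span_charLp hF)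
  exact congrArg _ (projection_embedding hμ ξ)

/-- The unitary onto Fock space given by the projection. -/
def euclideanUnitary (hμ : IsGaussianPathMeasure P μ) : PhysSpace P μ ≃ₗᵢ[ℂ] ThermalFock P :=
  LinearIsometryEquiv.symm
    { toFun := fun ξ => ⟨embedding hμ ξ, embedding_mem hμ ξ⟩
      invFun := fun F => projection hμ F
      left_inv := projection_embedding hμ
      right_inv := fun F => Subtype.ext (embedding_projection hμ (mem_lpMeas_iff_aestronglyMeasurable.mp F.2))
      map_add' := fun ξ η => Subtype.ext (map_add (embedding hμ) ξ η)
      map_smul' := fun c ξ => Subtype.ext (map_smul (embedding hμ) c ξ)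
      norm_map' := (embedding hμ).norm_map }

theorem euclideanUnitary_apply (hμ : IsGaussianPathMeasure P μ) (F : PhysSpace P μ) :
    euclideanUnitary hμ F = projection hμ F := rfl

theorem isEuclideanUnitary_euclideanUnitary (hμ : IsGaussianPathMeasure P μ) :
    IsEuclideanUnitary (euclideanUnitary hμ) where
  map_one := by rw [euclideanUnitary_apply, coe_thermalOne, projection_one]
  map_exp g := by
    obtain ⟨W, hW⟩ := exists_isWeylOperator (leftArakiWoods P g)
    -- The Weyl relation is required on all coherent vectors, while the transported operator is
    -- computed on boundary ones. Comparison with an existing Weyl operator on this total set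
    -- bridges the gap.
    suffices h : transport (euclideanUnitary hμ) (mulOp (expFieldAlg μ g)) = W by rwa [h]
    refine clm_ext_of_total coherent_boundary_total ?_
    rintro _ ⟨p, rfl⟩
    change transport _ _ (coherent (segalConst • boundaryVector p)) =
      W (coherent (segalConst • boundaryVector p))
    set ξ := coherent (segalConst • boundaryVector p) with hξ
    have e1 : ξ = Complex.exp ((covForm P (boundaryTest p) : ℂ) / 4) •
        projection hμ (charLp μ (boundaryTest p)) := by
      rw [← map_smul, ← embedding_coherent hμ, projection_embedding]
    have e4 : W ξ = projection hμ (Complex.exp ((covForm P (boundaryTest p) : ℂ) / 4) •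
        charLp μ (boundaryTest p + sharpTimeZero P g)) := by
      rw [e1, map_smul, hW.apply_projection hμ (represents_boundary p), map_smul]
    rw [transport_apply, euclideanUnitary_apply, e4]
    congr 1
    apply Lp.ext
    have e2 : ((euclideanUnitary hμ).symm ξ : Lp ℂ 2 μ) = embedding hμ ξ := rfl
    have e3 : ((expFieldAlg μ g : TimeZeroAlgebra P μ) : Lp ℂ ∞ μ) =ᵐ[μ] expField g :=
      (memLp_expField μ g).coeFn_toLp
    filter_upwards [coeFn_mulOp (expFieldAlg μ g) ((euclideanUnitary hμ).symm ξ), e3,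
      coeFn_charLp (μ := μ) (boundaryTest p), coeFn_charLp (μ := μ) (boundaryTest p + sharpTimeZero P g),
      Lp.coeFn_smul (Complex.exp ((covForm P (boundaryTest p) : ℂ) / 4)) (charLp μ (boundaryTest p)),
      Lp.coeFn_smul (Complex.exp ((covForm P (boundaryTest p) : ℂ) / 4))
        (charLp μ (boundaryTest p + sharpTimeZero P g))] with φ h1 h2 h3 h4 h5 h6
    rw [h1, e2, hξ, embedding_coherent, h5, h6, Pi.smul_apply, Pi.smul_apply, h2, h3, h4,
      charField_add, smul_eq_mul, smul_eq_mul]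
    change charField (sharpTimeZero P g) φ * _ = _
    ring

end Embedding

/-! ### Time translations and `e^{-tL}` -/

section TimeEvolution

variable {P : Params}

/-- On generators `z_s(g)` is sent to `z_{s+t}(g)`. All three relations are additive, so they extend
to the group. The condition `t + b ≤ β/2` keeps the translated times in the admissible range. -/
theorem exists_represents_translate {b t : ℝ} (ht : 0 ≤ t) (htb : t + b ≤ P.β / 2) {f : TestSpace P}
    (hf : f ∈ timeGroup P (Set.Icc 0 b)) : ∃ z z', Represents f z ∧ Represents (translate P t f) z' ∧
      ∀ᵐ x ∂(oneParticleMeasure P), z' x = (Real.exp (-(t * liouvilleSymbol P x)) : ℂ) * z x := by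
  induction hf using AddSubgroup.closure_induction with
  | mem f hf =>
    obtain ⟨s, hs, g, rfl⟩ := hf
    have hs' : s ∈ Set.Icc 0 (P.β / 2) := ⟨hs.1, by linarith [hs.2]⟩
    have hst : s + t ∈ Set.Icc 0 (P.β / 2) := ⟨add_nonneg hs.1 ht, by linarith [hs.2]⟩
    refine ⟨araki hs' g, araki hst g, represents_sharpAt _ _, ?_, araki_shift hs' hst g⟩
    rw [translate_sharpAt, add_comm]
    exact represents_sharpAt _ _
  | zero =>
    refine ⟨0, 0, Represents.zero, by rw [map_zero]; exact Represents.zero, ?_⟩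
    filter_upwards [Lp.coeFn_zero ℂ 2 (oneParticleMeasure P)] with x hx
    rw [hx, Pi.zero_apply, mul_zero]
  | add f f' _ _ h h' =>
    obtain ⟨z, w, h1, h2, h3⟩ := h
    obtain ⟨z', w', h1', h2', h3'⟩ := h'
    refine ⟨z + z', w + w', h1.add h1', by rw [map_add]; exact h2.add h2', ?_⟩
    filter_upwards [h3, h3', Lp.coeFn_add z z', Lp.coeFn_add w w'] with x e1 e2 e3 e4
    rw [e3, e4, Pi.add_apply, Pi.add_apply, e1, e2, mul_add]
  | neg f _ h =>
    obtain ⟨z, w, h1, h2, h3⟩ := h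
    refine ⟨-z, -w, h1.neg, by rw [map_neg]; exact h2.neg, ?_⟩
    filter_upwards [h3, Lp.coeFn_neg z, Lp.coeFn_neg w] with x e1 e2 e3
    rw [e2, e3, Pi.neg_apply, Pi.neg_apply, e1, mul_neg]

theorem exists_represents {f : TestSpace P} (hf : f ∈ timeGroup P (Set.Icc 0 (P.β / 2))) :
    ∃ z, Represents f z := by
  obtain ⟨z, _, h, _⟩ := exists_represents_translate le_rfl (zero_add _).le hf
  exact ⟨z, h⟩

theorem evolve_evolve (s t : ℝ) (F : PathSpace P → ℂ) :
    evolve P s (evolve P t F) = evolve P (s + t) F := by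
  funext φ
  simp only [evolve]
  rw [shift_shift]

theorem evolve_zero (F : PathSpace P → ℂ) : evolve P 0 F = F := by
  funext φ; rw [evolve, shift_zero]; rfl

variable {μ : Measure (PathSpace P)} {n : ℕ}

/-- Multiplication by a bounded function on `L²`. -/
def mulLp (F : Lp ℂ ∞ μ) : Lp ℂ 2 μ →L[ℂ] Lp ℂ 2 μ := (ContinuousLinearMap.mul ℂ ℂ).holderL μ ∞ 2 2 F

theorem coeFn_mulLp (F : Lp ℂ ∞ μ) (τ : Lp ℂ 2 μ) : mulLp F τ =ᵐ[μ] fun φ => F φ * τ φ :=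
  (ContinuousLinearMap.mul ℂ ℂ).coeFn_holder _ _

/-- The product of the functions `U_{s_i} G_i` over `i ∈ A`. -/
def evolvedProd (G : Fin n → TimeZeroAlgebra P μ) (s : Fin n → ℝ) (A : Finset (Fin n))
    (φ : PathSpace P) : ℂ := ∏ i ∈ A, evolve P (s i) (G i : Lp ℂ ∞ μ) φ

theorem evolvedProd_empty (G : Fin n → TimeZeroAlgebra P μ) (s : Fin n → ℝ) :
    evolvedProd G s ∅ = fun _ => 1 := funext fun _ => Finset.prod_empty

theorem evolve_evolvedProd (G : Fin n → TimeZeroAlgebra P μ) (t : ℝ) (s : Fin n → ℝ) (A : Finset (Fin n)) :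
    evolve P t (evolvedProd G s A) = evolvedProd G (fun i => t + s i) A := by
  funext φ
  change ∏ i ∈ A, evolve P t (evolve P (s i) (G i : Lp ℂ ∞ μ)) φ = _
  simp only [evolve_evolve]
  rfl

theorem evolvedProd_insert (G : Fin n → TimeZeroAlgebra P μ) (s : Fin n → ℝ) {i : Fin n} {A : Finset (Fin n)} (hi : i ∉ A) :
    evolvedProd G s (insert i A) = fun φ => evolve P (s i) (G i : Lp ℂ ∞ μ) φ * evolvedProd G s A φ :=
  funext fun _ => Finset.prod_insert hi

variable [IsProbabilityMeasure μ]

theorem compMeasurePreserving_charLp (hμ : IsGaussianPathMeasure P μ) (t : ℝ) (f : TestSpace P) :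
    Lp.compMeasurePreserving (shift P t) (measurePreserving_shift hμ t) (charLp μ f) =
      charLp μ (translate P t f) := by
  apply Lp.ext
  filter_upwards [Lp.coeFn_compMeasurePreserving (charLp μ f) (measurePreserving_shift hμ t),
    (measurePreserving_shift hμ t).quasiMeasurePreserving.ae (coeFn_charLp f),
    coeFn_charLp (translate P t f)] with φ h1 h2 h3
  rw [h1, h3, Function.comp_apply, h2, charField_shift]

/-- On exponentials both projections are multiples of coherent vectors related by `e^{-tL}`, with
the same prefactor because `q` is translation invariant. Closedness of the graph extends this to all
`F` without bounding `e^{-tL}`. -/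
theorem expGraph_projection_translate (hμ : IsGaussianPathMeasure P μ) {b t : ℝ} (ht : 0 ≤ t)
    (htb : t + b ≤ P.β / 2) {F : Lp ℂ 2 μ} (hF : AEStronglyMeasurable[sigmaOn P (Set.Icc 0 b)] F μ) :
    ExpGraph (liouvilleSymbol P) t (projection hμ F) (projection hμ
      (Lp.compMeasurePreserving (shift P t) (measurePreserving_shift hμ t) F)) := by
  let U : Lp ℂ 2 μ →L[ℂ] Lp ℂ 2 μ :=
    (Lp.compMeasurePreservingₗᵢ ℂ (shift P t) (measurePreserving_shift hμ t)).toContinuousLinearMap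
  let R : Lp ℂ 2 μ →L[ℂ] ThermalFock P × ThermalFock P :=
    (projection hμ).prod ((projection hμ).comp U)
  have hle : (Submodule.span ℂ (charLp μ '' (timeGroup P (Set.Icc 0 b) : Set (TestSpace P)))).topologicalClosure ≤
      (expGraphSubmodule (oneParticleMeasure P) (liouvilleSymbol P) t).comap R.toLinearMap := by
    refine Submodule.topologicalClosure_minimal _ (Submodule.span_le.mpr ?_)
      (isClosed_expGraphSubmodule.preimage R.continuous)
    rintro _ ⟨f, hf, rfl⟩
    obtain ⟨z, z', h1, h2, h3⟩ := exists_represents_translate ht htb hf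
    have hU : U (charLp μ f) = charLp μ (translate P t f) := compMeasurePreserving_charLp hμ t f
    have e : R (charLp μ f) = Complex.exp (-(covForm P f : ℂ) / 4) •
        (coherent (segalConst • z), coherent (segalConst • z')) := by
      change (projection hμ (charLp μ f), projection hμ (U (charLp μ f))) = _
      rw [hU, projection_charLp hμ h1, projection_charLp hμ h2, covForm_translate, Prod.smul_mk]
    change R (charLp μ f) ∈ expGraphSubmodule (oneParticleMeasure P) (liouvilleSymbol P) t
    rw [e]
    refine Submodule.smul_mem _ _ (expGraph_coherent ?_)
    filter_upwards [h3, Lp.coeFn_smul segalConst z, Lp.coeFn_smul segalConst z'] with x e1 e2 e3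
    rw [e2, e3, Pi.smul_apply, Pi.smul_apply, e1, mul_smul_comm]
  exact hle (mem_closure_span_charLp hF)

theorem expGraph_projection_evolve (hμ : IsGaussianPathMeasure P μ) {b t : ℝ} (ht : 0 ≤ t)
    (htb : t + b ≤ P.β / 2) {F : PathSpace P → ℂ}
    (hF : AEStronglyMeasurable[sigmaOn P (Set.Icc 0 b)] F μ) (h : MemLp F 2 μ)
    (h' : MemLp (evolve P t F) 2 μ) :
    ExpGraph (liouvilleSymbol P) t (projection hμ (h.toLp F)) (projection hμ (h'.toLp _)) := by
  have := expGraph_projection_translate hμ ht htb (hF.congr h.coeFn_toLp.symm)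
  rwa [Lp.toLp_compMeasurePreserving] at this

/-! ### Multiplication operators on projected vectors -/

theorem coeFn_expFieldAlg (g : TimeZeroSpace P) :
    ((expFieldAlg μ g : TimeZeroAlgebra P μ) : Lp ℂ ∞ μ) =ᵐ[μ] charField (sharpTimeZero P g) :=
  (memLp_expField μ g).coeFn_toLp

theorem mulLp_expFieldAlg_charLp (g : TimeZeroSpace P) (f : TestSpace P) :
    mulLp (expFieldAlg μ g : Lp ℂ ∞ μ) (charLp μ f) = charLp μ (f + sharpTimeZero P g) := by
  apply Lp.ext
  filter_upwards [coeFn_mulLp (expFieldAlg μ g : Lp ℂ ∞ μ) (charLp μ f), coeFn_expFieldAlg (μ := μ) g,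
    coeFn_charLp (μ := μ) f, coeFn_charLp (μ := μ) (f + sharpTimeZero P g)] with φ h1 h2 h3 h4
  rw [h1, h2, h3, h4, charField_add, mul_comm]

variable {T : PhysSpace P μ ≃ₗᵢ[ℂ] ThermalFock P}

/-- On exponentials of fields in `[0, β/2]` this is the Weyl relation, the only property of `T`
used. Both sides are continuous in `F`. -/
theorem transport_expFieldAlg_projection (hμ : IsGaussianPathMeasure P μ) (hT : IsEuclideanUnitary T)
    (g : TimeZeroSpace P) {F : Lp ℂ 2 μ}
    (hF : AEStronglyMeasurable[sigmaOn P (Set.Icc 0 (P.β / 2))] F μ) :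
    transport T (mulOp (expFieldAlg μ g)) (projection hμ F) =
      projection hμ (mulLp (expFieldAlg μ g : Lp ℂ ∞ μ) F) := by
  let A := (transport T (mulOp (expFieldAlg μ g))).comp (projection hμ)
  let B := (projection hμ).comp (mulLp (expFieldAlg μ g : Lp ℂ ∞ μ))
  have hle : (Submodule.span ℂ (charLp μ '' (timeGroup P (Set.Icc 0 (P.β / 2)) : Set (TestSpace P)))).topologicalClosure ≤
      LinearMap.eqLocus A.toLinearMap B.toLinearMap := by
    refine Submodule.topologicalClosure_minimal _ (Submodule.span_le.mpr ?_)
      (isClosed_eq A.continuous B.continuous)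
    rintro _ ⟨f, hf, rfl⟩
    obtain ⟨z, hz⟩ := exists_represents hf
    change transport T _ (projection hμ (charLp μ f)) = projection hμ (mulLp _ (charLp μ f))
    rw [(hT.map_exp g).apply_projection hμ hz, mulLp_expFieldAlg_charLp]
  exact hle (mem_closure_span_charLp hF)

/-- Multiplication by `G` in the time-zero algebra is intertwined with the projection on bounded
functions of the fields at times in `[0, β/2]`. -/
theorem transport_mulOp_projection (hμ : IsGaussianPathMeasure P μ) (hT : IsEuclideanUnitary T)
    (G : TimeZeroAlgebra P μ) {F : PathSpace P → ℂ} (hF : MemLp F ∞ μ)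
    (hFm : AEStronglyMeasurable[sigmaOn P (Set.Icc 0 (P.β / 2))] F μ) (h : MemLp F 2 μ)
    (h' : MemLp (fun φ => (G : Lp ℂ ∞ μ) φ * F φ) 2 μ) :
    transport T (mulOp G) (projection hμ (h.toLp F)) = projection hμ (h'.toLp _) := by
  -- With `F` fixed, the claim is read as a statement linear in `G`: multiplication of `w` by `τ`
  -- gives `T⁻¹J*(Fτ)`. For exponentials `τ` at time zero it is already known.
  set w : PhysSpace P μ := T.symm (projection hμ (h.toLp F)) with hw
  let B : Lp ℂ 2 μ →L[ℂ] Lp ℂ 2 μ := mulLp (hF.toLp F)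
  have hB : ∀ τ : Lp ℂ 2 μ, B τ =ᵐ[μ] fun φ => F φ * τ φ := fun τ => by
    filter_upwards [coeFn_mulLp (hF.toLp F) τ, hF.coeFn_toLp] with φ h1 h2
    rw [h1, h2]
  let R : Lp ℂ 2 μ → Lp ℂ 2 μ := fun τ => (T.symm (projection hμ (B τ)) : PhysSpace P μ)
  have hR : Continuous R := continuous_subtype_val.comp
    (T.symm.continuous.comp ((projection hμ).continuous.comp B.continuous))
  -- The function `w` is only square integrable, so `τ ↦ wτ` need not be bounded on `L²`, but its
  -- graph is closed. Boundedness of `F` makes `R` continuous.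
  have hcl : IsClosed {τ : Lp ℂ 2 μ | R τ =ᵐ[μ] fun φ => (w : Lp ℂ 2 μ) φ * τ φ} :=
    (isClosed_setOf_ae_eq_mul (ν := μ) (w : Lp ℂ 2 μ)).preimage (continuous_id.prodMk hR)
  have hspan : (Submodule.span ℂ (charLp μ '' (timeGroup P {0} : Set (TestSpace P))) : Set (Lp ℂ 2 μ)) ⊆
      {τ : Lp ℂ 2 μ | R τ =ᵐ[μ] fun φ => (w : Lp ℂ 2 μ) φ * τ φ} := by
    intro τ hτ
    change R τ =ᵐ[μ] fun φ => (w : Lp ℂ 2 μ) φ * τ φ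
    induction hτ using Submodule.span_induction with
    | mem τ hτ =>
      obtain ⟨f, hf, rfl⟩ := hτ
      obtain ⟨g, rfl⟩ := exists_sharpTimeZero_eq hf
      have e1 : mulLp (expFieldAlg μ g : Lp ℂ ∞ μ) (h.toLp F) = B (charLp μ (sharpTimeZero P g)) := by
        apply Lp.ext
        filter_upwards [hB (charLp μ (sharpTimeZero P g)), coeFn_expFieldAlg (μ := μ) g,
          coeFn_charLp (μ := μ) (sharpTimeZero P g), h.coeFn_toLp,
          coeFn_mulLp (expFieldAlg μ g : Lp ℂ ∞ μ) (h.toLp F)] with φ h1 h2 h3 h4 h5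
        rw [h1, h5, h2, h3, h4, mul_comm]
      have e2 := transport_expFieldAlg_projection hμ hT g (hFm.congr h.coeFn_toLp.symm)
      rw [transport_apply, e1, ← hw] at e2
      have e3 : R (charLp μ (sharpTimeZero P g)) = mulOp (expFieldAlg μ g) w := by
        change ((T.symm (projection hμ (B (charLp μ (sharpTimeZero P g)))) : PhysSpace P μ) : Lp ℂ 2 μ) = _
        rw [← e2, LinearIsometryEquiv.symm_apply_apply]
      rw [e3]
      filter_upwards [coeFn_mulOp (expFieldAlg μ g) w, coeFn_expFieldAlg (μ := μ) g,
        coeFn_charLp (μ := μ) (sharpTimeZero P g)] with φ h1 h2 h3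
      rw [h1, h2, h3, mul_comm]
    | zero =>
      have e : R 0 = 0 := by simp [R]
      rw [e]
      filter_upwards [Lp.coeFn_zero ℂ 2 μ] with φ h1
      rw [h1, Pi.zero_apply, mul_zero]
    | add τ τ' _ _ h1 h2 =>
      have e : R (τ + τ') = R τ + R τ' := by simp [R]
      rw [e]
      filter_upwards [h1, h2, Lp.coeFn_add (R τ) (R τ'), Lp.coeFn_add τ τ'] with φ e1 e2 e3 e4
      rw [e3, e4, Pi.add_apply, Pi.add_apply, e1, e2, mul_add]
    | smul c τ _ h1 =>
      have e : R (c • τ) = c • R τ := by simp [R]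
      rw [e]
      filter_upwards [h1, Lp.coeFn_smul c (R τ), Lp.coeFn_smul c τ] with φ e1 e2 e3
      rw [e2, e3, Pi.smul_apply, Pi.smul_apply, e1, mul_smul_comm]
  -- A bounded `G` lies in `L²` of a probability measure, so it is an admissible value of `τ` in the
  -- closure of the time-zero exponentials.
  have hG2 : MemLp (G : Lp ℂ ∞ μ) 2 μ := (Lp.memLp (G : Lp ℂ ∞ μ)).mono_exponent le_top
  have hGm : AEStronglyMeasurable[sigmaOn P {0}] (hG2.toLp _) μ := by
    rw [← sigmaZero_eq]
    exact (mem_lpMeas_iff_aestronglyMeasurable.mp G.2).congr hG2.coeFn_toLp.symm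
  have key : R (hG2.toLp _) =ᵐ[μ] fun φ => (w : Lp ℂ 2 μ) φ * hG2.toLp _ φ :=
    hcl.closure_subset_iff.mpr hspan (mem_closure_span_charLp hGm)
  have e1 : B (hG2.toLp _) = h'.toLp _ := by
    apply Lp.ext
    filter_upwards [hB (hG2.toLp _), hG2.coeFn_toLp, h'.coeFn_toLp] with φ h1 h2 h3
    rw [h1, h2, h3, mul_comm]
  have e2 : mulOp G w = T.symm (projection hμ (B (hG2.toLp _))) := by
    apply Subtype.ext
    apply Lp.ext
    filter_upwards [coeFn_mulOp G w, key, hG2.coeFn_toLp] with φ h1 h2 h3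
    refine h1.trans (Eq.trans ?_ h2.symm)
    rw [h3, mul_comm]
  rw [transport_apply, ← hw, e2, LinearIsometryEquiv.apply_symm_apply, e1]

/-! ### Time-ordered products -/

theorem memLp_evolve (hμ : IsGaussianPathMeasure P μ) (t : ℝ) {F : PathSpace P → ℂ} {p : ℝ≥0∞}
    (hF : MemLp F p μ) : MemLp (evolve P t F) p μ :=
  hF.comp_measurePreserving (measurePreserving_shift hμ t)

/-- `G` has only an almost everywhere `𝔖_0`-measurable representative. Invariance of `μ` ensures
that the exceptional null set stays null after translation. -/
theorem aestronglyMeasurable_evolve (hμ : IsGaussianPathMeasure P μ) {I : Set ℝ} {t : ℝ} (ht : t ∈ I)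
    (G : TimeZeroAlgebra P μ) : AEStronglyMeasurable[sigmaOn P I] (evolve P t (G : Lp ℂ ∞ μ)) μ := by
  obtain ⟨g, hg, hGg⟩ := mem_lpMeas_iff_aestronglyMeasurable.mp G.2
  refine ⟨evolve P t g, ?_, (measurePreserving_shift hμ t).quasiMeasurePreserving.ae hGg⟩
  have h1 : StronglyMeasurable[sigmaAt P t] (evolve P t g) :=
    hg.comp_measurable (comap_measurable (shift P t))
  exact h1.mono (le_iSup₂ (f := fun t (_ : t ∈ I) => sigmaAt P t) t ht)

variable (G : Fin n → TimeZeroAlgebra P μ)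

theorem memLp_evolvedProd_top (hμ : IsGaussianPathMeasure P μ) (s : Fin n → ℝ) (A : Finset (Fin n)) :
    MemLp (evolvedProd G s A) ∞ μ := by
  induction A using Finset.induction_on with
  | empty =>
    rw [evolvedProd_empty]
    exact memLp_const 1
  | insert i A hi ih =>
    have h := (memLp_evolve hμ (s i) (Lp.memLp (G i : Lp ℂ ∞ μ)))
    rw [evolvedProd_insert G s hi]
    exact ih.mul' h

theorem memLp_evolvedProd (hμ : IsGaussianPathMeasure P μ) (s : Fin n → ℝ) (A : Finset (Fin n)) :
    MemLp (evolvedProd G s A) 2 μ := (memLp_evolvedProd_top G hμ s A).mono_exponent le_top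

theorem aestronglyMeasurable_evolvedProd (hμ : IsGaussianPathMeasure P μ) {s : Fin n → ℝ}
    {A : Finset (Fin n)} {I : Set ℝ} (h : ∀ i ∈ A, s i ∈ I) :
    AEStronglyMeasurable[sigmaOn P I] (evolvedProd G s A) μ := by
  induction A using Finset.induction_on with
  | empty =>
    rw [evolvedProd_empty]
    exact aestronglyMeasurable_const
  | insert i A hi ih =>
    rw [evolvedProd_insert G s hi]
    exact (aestronglyMeasurable_evolve hμ (h i (Finset.mem_insert_self i A)) (G i)).mul
      (ih fun j hj => h j (Finset.mem_insert_of_mem hj))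

/-- The vector of Fock space given by the product of the `U_{s_i} G_i` over `i ∈ A`. -/
def evolvedVector (hμ : IsGaussianPathMeasure P μ) (s : Fin n → ℝ) (A : Finset (Fin n)) : ThermalFock P :=
  projection hμ ((memLp_evolvedProd G hμ s A).toLp _)

theorem evolvedVector_empty (hμ : IsGaussianPathMeasure P μ) (s : Fin n → ℝ) :
    evolvedVector G hμ s ∅ = vacuum (oneParticleMeasure P) := by
  rw [← projection_one hμ]
  refine congrArg (projection hμ) (Lp.ext ?_)
  filter_upwards [(memLp_evolvedProd G hμ s ∅).coeFn_toLp, coeFn_charLp (μ := μ) (0 : TestSpace P)]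
    with φ h1 h2
  rw [h1, h2, charField_zero, evolvedProd_empty]

theorem embedding_vacuum (hμ : IsGaussianPathMeasure P μ) :
    embedding hμ (vacuum (oneParticleMeasure P)) = charLp μ 0 := by
  rw [← projection_one hμ]
  exact embedding_projection hμ (mem_lpMeas_iff_aestronglyMeasurable.mp (charLp_mem_lpMeas (zero_mem _)))

theorem inner_vacuum_evolvedVector (hμ : IsGaussianPathMeasure P μ) (s : Fin n → ℝ) (A : Finset (Fin n)) :
    inner ℂ (vacuum (oneParticleMeasure P)) (evolvedVector G hμ s A) = ∫ φ, evolvedProd G s A φ ∂μ := by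
  rw [evolvedVector, inner_projection, embedding_vacuum, L2.inner_def]
  refine integral_congr_ae ?_
  filter_upwards [(memLp_evolvedProd G hμ s A).coeFn_toLp, coeFn_charLp (μ := μ) (0 : TestSpace P)]
    with φ h1 h2
  rw [h1, h2, charField_zero]
  simp

/-- One step of the correlation formula. -/
theorem imagTimeGraph_evolvedProd (hμ : IsGaussianPathMeasure P μ) (hT : IsEuclideanUnitary T)
    {t : Fin n → ℝ} {j : Fin n} {A : Finset (Fin n)} (hj : j ∉ A) (htj : 0 ≤ t j)
    (htj' : t j ≤ P.β / 2) (hA : ∀ i ∈ A, t j ≤ t i ∧ t i ≤ P.β / 2) :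
    ImagTimeGraph (liouvilleSymbol P) (t j) (transport T (mulOp (G j)))
      (evolvedVector G hμ t A)
      (evolvedVector G hμ t (insert j A)) := by
  -- Times are measured from `t j`: by the ordering they stay nonnegative, and `G j` sits at time
  -- zero, where multiplication by it is intertwined with the projection.
  set s : Fin n → ℝ := fun i => t i - t j with hs
  have hts : (fun i => t j + s i) = t := funext fun i => by simp [hs]
  have hsI : ∀ i ∈ insert j A, s i ∈ Set.Icc 0 (P.β / 2 - t j) := fun i hi => by
    rcases Finset.mem_insert.mp hi with rfl | hi
    · exact ⟨by simp [hs], by simp only [hs]; linarith⟩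
    · have := hA i hi
      exact ⟨by simp only [hs]; linarith, by simp only [hs]; linarith⟩
  have hev : ∀ B, evolve P (t j) (evolvedProd G s B) = evolvedProd G t B := fun B => by
    rw [evolve_evolvedProd, hts]
  have key : ∀ B ⊆ insert j A, ExpGraph (liouvilleSymbol P) (t j)
      (projection hμ ((memLp_evolvedProd G hμ s B).toLp _))
      (projection hμ ((memLp_evolvedProd G hμ t B).toLp _)) := by
    intro B hB
    have := expGraph_projection_evolve hμ (b := P.β / 2 - t j) htj (by linarith)
      (aestronglyMeasurable_evolvedProd G hμ fun i hi => hsI i (hB hi)) (memLp_evolvedProd G hμ s B)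
      (by rw [hev]; exact memLp_evolvedProd G hμ t B)
    simpa only [hev] using this
  -- The intermediate vector belongs to the times shifted back by `t j`. Reading the graph of
  -- `e^{-t_j L}` backwards proves that the given vector lies in the domain of `e^{t_j L}`.
  refine ⟨projection hμ ((memLp_evolvedProd G hμ s A).toLp _), (key A (Finset.subset_insert j A)).neg, ?_⟩
  have e : evolvedProd G s (insert j A) = fun φ => (G j : Lp ℂ ∞ μ) φ * evolvedProd G s A φ := by
    rw [evolvedProd_insert G s hj]
    simp only [hs, sub_self, evolve_zero]
  have h2 := transport_mulOp_projection hμ hT (G j) (memLp_evolvedProd_top G hμ s A)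
    (aestronglyMeasurable_evolvedProd G hμ fun i hi => by
      have := hsI i (Finset.mem_insert_of_mem hi)
      exact ⟨this.1, by linarith [this.2]⟩) (memLp_evolvedProd G hμ s A)
    (e ▸ memLp_evolvedProd G hμ s (insert j A))
  rw [h2]
  have h3 := key (insert j A) subset_rfl
  simp only [e] at h3
  exact h3

theorem hasImagTimeCorrelation (hμ : IsGaussianPathMeasure P μ) (hT : IsEuclideanUnitary T)
    {t : Fin n → ℝ} (hmono : Monotone t) (ht : ∀ j, t j ∈ Set.Icc 0 (P.β / 2)) :
    HasImagTimeCorrelation (liouvilleSymbol P) t (fun j => transport T (mulOp (G j)))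
      (∫ φ, ∏ j, evolve P (t j) (G j : Lp ℂ ⊤ μ) φ ∂μ) := by
  -- The `j`-th vector uses the factors with index at least `j`: none for the last `j`, all for `j =
  -- 0`, and passing from `j.succ` to `j.castSucc` adds exactly `j`.
  let A : Fin (n + 1) → Finset (Fin n) := fun j => Finset.univ.filter fun i => j ≤ i.castSucc
  refine ⟨fun j => evolvedVector G hμ t (A j), ?_, fun j => ?_, ?_⟩
  · have hA : A (Fin.last n) = ∅ := Finset.filter_eq_empty_iff.mpr fun i _ =>
      not_le.mpr (Fin.castSucc_lt_last i)
    change evolvedVector G hμ t (A (Fin.last n)) = _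
    rw [hA, evolvedVector_empty]
  · have hA : A j.castSucc = insert j (A j.succ) := by
      ext i
      simp only [A, Finset.mem_filter, Finset.mem_univ, true_and, Finset.mem_insert, Fin.le_def, Fin.ext_iff,
        Fin.val_castSucc, Fin.val_succ]
      omega
    have hj : j ∉ A j.succ := by simp [A, Fin.le_def]
    change ImagTimeGraph _ (t j) (transport T (mulOp (G j))) (evolvedVector G hμ t (A j.succ))
      (evolvedVector G hμ t (A j.castSucc))
    rw [hA]
    refine imagTimeGraph_evolvedProd G hμ hT hj (ht j).1 (ht j).2 fun i hi => ⟨hmono ?_, (ht i).2⟩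
    have h : j.succ ≤ i.castSucc := (Finset.mem_filter.mp hi).2
    rw [Fin.le_def, Fin.val_succ, Fin.val_castSucc] at h
    exact Fin.le_def.mpr (by omega)
  · have hA : A 0 = Finset.univ := Finset.filter_true_of_mem fun i _ => Fin.zero_le _
    change inner ℂ _ (evolvedVector G hμ t (A 0)) = _
    rw [hA, inner_vacuum_evolvedVector]
    rfl

end TimeEvolution

end ThermalBose

end

/-! ### The theorem -/

theorem mainTheorem8 (P : ThermalBose.Params) :
    (∃ μ : MeasureTheory.ProbabilityMeasure (ThermalBose.PathSpace P),
      ThermalBose.IsGaussianPathMeasure P (μ : MeasureTheory.Measure (ThermalBose.PathSpace P))) ∧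
    ∀ (μ : MeasureTheory.Measure (ThermalBose.PathSpace P)) [MeasureTheory.IsProbabilityMeasure μ],
      ThermalBose.IsGaussianPathMeasure P μ →
      (∃ T : ThermalBose.PhysSpace P μ ≃ₗᵢ[ℂ] ThermalBose.ThermalFock P,
        ThermalBose.IsEuclideanUnitary T) ∧
      ∀ T : ThermalBose.PhysSpace P μ ≃ₗᵢ[ℂ] ThermalBose.ThermalFock P,
        ThermalBose.IsEuclideanUnitary T →
        ∀ (n : ℕ) (_ : 1 ≤ n) (t : Fin n → ℝ) (_ : Monotone t)
          (_ : ∀ j, t j ∈ Set.Icc (0 : ℝ) (P.β / 2))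
          (G : Fin n → ThermalBose.TimeZeroAlgebra P μ),
          ThermalBose.HasImagTimeCorrelation (ThermalBose.liouvilleSymbol P) t
            (fun j => ThermalBose.transport T (ThermalBose.mulOp (G j)))
            (∫ φ, ∏ j, ThermalBose.evolve P (t j)
              (G j : MeasureTheory.Lp ℂ ⊤ μ) φ ∂μ) := by
  refine ⟨ThermalBose.exists_isGaussianPathMeasure P, fun μ _ hμ => ⟨⟨ThermalBose.euclideanUnitary hμ,
    ThermalBose.isEuclideanUnitary_euclideanUnitary hμ⟩, ?_⟩⟩
  intro T hT n _ t hmono ht G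
  exact ThermalBose.hasImagTimeCorrelation G hμ hT hmono ht
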